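/- **Setting.** Let $\mathcal P_{\mathcal X}$ be a probability distribution on $\mathbb R^d$ that is concentrated on $\mathcal X\subseteq\mathbb R^d$, let $\Delta=\{m\in\mathbb R^K: m\ge 0,\ \mathbf 1^{\top}m=1\}$, and let $f^\natural$ be a measurable function on $\mathbb R^d$ with $f^\natural(x)\in\Delta$ for $x\in\mathcal X$. For samples $X=[x_1,\dots,x_N]$ with $N\ge1$ put $M^\natural=[f^\natural(x_1),\dots,f^\natural(x_N)]\in\mathbb R^{K\times N}$. Given $X$, there are $M$ annotations $S=\{(i_m,j_m,y_m)\}_{m=1}^M$: the pairs $(i_m,j_m)$ are independent and uniform on $[N]\times[N]$, and, given the pairs, the labels are independent with $y_m\sim\mathsf{Bernoulli}(\langle f^\natural(x_{i_m}),f^\natural(x_{j_m})\rangle)$. For each $M$ let $\mathcal F_M$ be the class of all functions $x\mapsto o\big(\sigma_L(A_L\sigma_{L-1}(\cdots\sigma_1(A_1x)))\big)$, where $o:\mathbb R^K\to\Delta$ is a fixed 1-Lipschitz output layer (for instance softmax), the fixed nonlinearities $\sigma_i$ are $\rho_i$-Lipschitz (Euclidean norms) with $\sigma_i(0)=0$,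 and the weight matrices range over all $A_i$ with spectral norm $\|A_i\|_2\le s_i$ and $\|A_i^{\top}-Z_i^{\top}\|_{2,1}\le b_i$ for given reference matrices $Z_i$ and bounds $s_i>0$, $b_i\ge0$ (where $\|\cdot\|_{2,1}$ is the sum of the Euclidean norms of the columns). All of these data may depend on $M$. With $D$ the largest layer dimension, put $$R_{\rm NET}=\log(2D^2)\Big(\prod_j s_j^2\rho_j^2\Big)\Big(\sum_i (b_i/s_i)^{2/3}\Big)^3 .$$ Assume that there are $0<\alpha<1$ (depending on $M$) with $\alpha<\langle f(x),f(y)\rangle<1-\alpha$ for all $x,y\in\mathcal X$ and $f\in\mathcal F_M$, and that $f^\natural$ is within $\nu$ (depending on $M$) of some element of $\mathcal F_M$, uniformly on $\mathcal X$, where $\nu/\alpha\to0$ as $M\to\infty$; this holds with $\nu=0$ if $f^\natural\in\mathcal F_M$ on $\mathcal X$ for every $M$. Keep $d,K,N$, $\mathcal P_{\mathcal X}$, $f^\natural$ fixed, and let $M\to\infty$ such that $$\max\big(\log(1/\alpha),\ \log(M)\sqrt{R_{\rm NET}}/\alpha\big)/\sqrt M\longrightarrow 0 .$$ A *learned network*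 $f^\star$ is any minimizer over $\mathcal F_M$ of the logistic loss $$\frac1M\sum_{m=1}^M\Big(y_m\log\frac1{\langle f(x_{i_m}),f(x_{j_m})\rangle}+(1-y_m)\log\frac1{1-\langle f(x_{i_m}),f(x_{j_m})\rangle}\Big),$$ and $M^\star=[f^\star(x_1),\dots,f^\star(x_N)]$. The matrix $M^\natural$ satisfies the *sufficiently scattered condition* (SSC) if for some $\mathcal S\subseteq[N]$ one has $\{x\in\mathbb R^K:\sqrt{K-1}\,\|x\|\le\mathbf 1^{\top}x\}\subseteq\mathrm{cone}(M^\natural[:,\mathcal S])$, and $\mathrm{cone}(M^\natural[:,\mathcal S])\subseteq\mathrm{cone}(Q)$ holds for no orthogonal $Q$ other than permutation matrices; here $\mathrm{cone}$ is the conic hull of the columns. For $0<\delta<1$ put $$B_\delta=\frac8{NK}+\frac{12\sqrt{2R_{\rm NET}}\,\|X\|_{\rm F}\log N}{NK\log2}+8\sqrt{\frac{2\log(4/\delta)}{NK^2}} .$$ **Theorem.** (i) For all fixed samples $x_1,\dots,x_N\in\mathcal X$ for which $M^\natural$ satisfies the SSC (no anchor samples are needed), in the limit $\Pi^\star M^\star=M^\natural$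 for a permutation matrix $\Pi^\star$: for every $\varepsilon>0$, with probability tending to 1 over the annotations, every learned network admits a permutation matrix $\Pi^\star$ with $\|\Pi^\star M^\star-M^\natural\|_{\rm F}\le\varepsilon$. (ii) Let $x_1,\dots,x_N$ be i.i.d. from $\mathcal P_{\mathcal X}$. If every $\mathcal F_M$ is closed under permutations of the $K$ output coordinates (relabelling of the clusters), then for all $0<\delta<1$ and $\varepsilon>0$ and all sufficiently large $M$, with probability at least $1-\delta$ over samples and annotations: if $M^\natural$ satisfies the SSC, then every learned network admits a permutation matrix $\Pi^\star$ with $\|\Pi^\star M^\star-M^\natural\|_{\rm F}\le\varepsilon$ and $$\mathbb E_{x\sim\mathcal P_{\mathcal X}}\Big[\tfrac1K\|\Pi^\star f^\star(x)-f^\natural(x)\|^2\Big]\le B_\delta .$$ Without closedness under relabelling: for every $0<\delta<1$ there is $\varepsilon>0$ such that for every fixed permutation matrix $\Pi$ and every $M$, with probability at least $1-\delta$, every learned network with $\|\Pi M^\star-M^\natural\|_{\rm F}\le\varepsilon$ (in particular with $\Pi M^\star=M^\natural$) satisfies $\mathbb E_{x\sim\mathcal P_{\mathcal X}}\big[\tfrac1K\|\Pi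 f^\star(x)-f^\natural(x)\|^2\big]\le B_\delta$. -/

import Mathlib

open Filter Topology MeasureTheory

noncomputable section

/-! ### Membership vectors and the sufficiently scattered condition -/

/-- Real `n`-dimensional space with the Euclidean norm. -/
abbrev RVec (n : ℕ) : Type := EuclideanSpace ℝ (Fin n)

/-- The probability simplex in dimension `K`. -/
def probSimplex (K : ℕ) : Set (RVec K) :=
  {m | (∀ k, 0 ≤ m k) ∧ ∑ k, m k = 1}

/-- The Frobenius norm. -/
def frobNorm {m n : ℕ} (A : Matrix (Fin m) (Fin n) ℝ) : ℝ :=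
  √(∑ i, ∑ j, A i j ^ 2)

/-- The matrix `[f(x_1), …, f(x_N)]` whose columns are the membership vectors of the samples. -/
def membershipMatrix {d K N : ℕ} (f : RVec d → RVec K) (X : Fin N → RVec d) :
    Matrix (Fin K) (Fin N) ℝ :=
  Matrix.of fun k n => f (X n) k

/-- The data matrix `[x_1, …, x_N]`. -/
def dataMatrix {d N : ℕ} (X : Fin N → RVec d) : Matrix (Fin d) (Fin N) ℝ :=
  Matrix.of fun i n => X n i

/-- The conic hull of the columns of a matrix. -/
def colCone {K : ℕ} {ι : Type} [Fintype ι] (A : Matrix (Fin K) ι ℝ) : Set (RVec K) :=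
  {y | ∃ θ : ι → ℝ, (∀ i, 0 ≤ θ i) ∧ y = WithLp.toLp 2 (A.mulVec θ)}

/-- The second order cone `{x | √(K-1) ‖x‖ ≤ 1ᵀ x}`. -/
def scatterCone (K : ℕ) : Set (RVec K) :=
  {x | √((K : ℝ) - 1) * ‖x‖ ≤ ∑ k, x k}

/-- The sufficiently scattered condition for the columns of a matrix. -/
def SufficientlyScattered {K N : ℕ} (A : Matrix (Fin K) (Fin N) ℝ) : Prop :=
  ∃ J : Finset (Fin N),
    scatterCone K ⊆ colCone (A.submatrix id (Subtype.val : {n // n ∈ J} → Fin N)) ∧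
    ∀ Q ∈ Matrix.orthogonalGroup (Fin K) ℝ,
      colCone (A.submatrix id (Subtype.val : {n // n ∈ J} → Fin N)) ⊆ colCone Q →
        ∃ π : Equiv.Perm (Fin K), Q = π.permMatrix ℝ

/-! ### Neural networks and their spectral complexity -/

/-- The data of one layer `x ↦ σ (A x)` from dimension `m` to dimension `n`: the fixed
nonlinearity with its Lipschitz constant, the reference matrix, and the bounds on the trainable
weight matrix `A`. -/
structure LayerSpec (m n : ℕ) where
  /-- the nonlinearity -/
  act : RVec n → RVec n
  /-- its Lipschitz constant -/
  lip : NNReal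
  act_lipschitz : LipschitzWith lip act
  act_zero : act 0 = 0
  /-- the reference matrix -/
  ref : Matrix (Fin n) (Fin m) ℝ
  /-- the bound on the spectral norm -/
  s : ℝ
  s_pos : 0 < s
  /-- the bound on the (2,1) norm of the deviation from the reference matrix -/
  b : ℝ
  b_nonneg : 0 ≤ b

/-- The spectral norm, that is, the operator norm between Euclidean spaces. -/
def specNorm {m n : ℕ} (A : Matrix (Fin n) (Fin m) ℝ) : ℝ :=
  ‖(Matrix.toEuclideanLin A).toContinuousLinearMap‖

/-- The (2,1) norm: the sum of the Euclidean norms of the columns. -/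
def norm21 {m n : ℕ} (A : Matrix (Fin m) (Fin n) ℝ) : ℝ :=
  ∑ j, √(∑ i, A i j ^ 2)

/-- The weight matrices that a layer admits. -/
def LayerSpec.weights {m n : ℕ} (ℓ : LayerSpec m n) : Set (Matrix (Fin n) (Fin m) ℝ) :=
  {A | specNorm A ≤ ℓ.s ∧ norm21 (A.transpose - ℓ.ref.transpose) ≤ ℓ.b}

/-- A feedforward architecture: a finite chain of layers, the first one being applied first. -/
inductive Architecture : ℕ → ℕ → Type
  | nil (n : ℕ) : Architecture n n
  | cons {m n p : ℕ} (ℓ : LayerSpec m n) (rest : Architecture n p) : Architecture m p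

namespace Architecture

/-- All functions `x ↦ σ_L (A_L σ_{L-1} (⋯ σ_1 (A_1 x)))` with admissible weights. -/
def nets : {m p : ℕ} → Architecture m p → Set (RVec m → RVec p)
  | _, _, nil _ => {id}
  | _, _, cons ℓ rest =>
      {h | ∃ A ∈ ℓ.weights, ∃ g ∈ rest.nets,
        h = fun x => g (ℓ.act (Matrix.toEuclideanLin A x))}

/-- The largest dimension occurring in the architecture. -/
def width : {m p : ℕ} → Architecture m p → ℕ
  | _, _, nil n => n
  | m, _, cons _ rest => max m rest.width

/-- `∏_j s_j² ρ_j²`. -/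
def lipProd : {m p : ℕ} → Architecture m p → ℝ
  | _, _, nil _ => 1
  | _, _, cons ℓ rest => ℓ.s ^ 2 * (ℓ.lip : ℝ) ^ 2 * rest.lipProd

/-- `∑_i (b_i / s_i)^{2/3}`. -/
def ratioSum : {m p : ℕ} → Architecture m p → ℝ
  | _, _, nil _ => 0
  | _, _, cons ℓ rest => (ℓ.b / ℓ.s) ^ (2 / 3 : ℝ) + rest.ratioSum

/-- The spectral complexity `log (2 D²) (∏_j s_j² ρ_j²) (∑_i (b_i / s_i)^{2/3})³`. -/
def complexity {m p : ℕ} (a : Architecture m p) : ℝ :=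
  Real.log (2 * (a.width : ℝ) ^ 2) * a.lipProd * a.ratioSum ^ 3

end Architecture

/-- An output layer: a 1-Lipschitz map into the probability simplex. -/
structure OutputLayer (K : ℕ) where
  /-- the map -/
  toFun : RVec K → RVec K
  lipschitz : LipschitzWith 1 toFun
  mem_simplex : ∀ z, toFun z ∈ probSimplex K

/-- The softmax function. -/
def softmax {K : ℕ} (z : RVec K) : RVec K :=
  WithLp.toLp 2 fun k => Real.exp (z k) / ∑ l, Real.exp (z l)

lemma sum_exp_pos {K : ℕ} [NeZero K] (z : RVec K) : 0 < ∑ l, Real.exp (z l) :=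
  Finset.sum_pos (fun _ _ => Real.exp_pos _) Finset.univ_nonempty

lemma softmax_mem_simplex {K : ℕ} [NeZero K] (z : RVec K) : softmax z ∈ probSimplex K := by
  have h := sum_exp_pos z
  refine ⟨fun k => ?_, ?_⟩
  · simp only [softmax]
    positivity
  · simp only [softmax]
    rw [← Finset.sum_div, div_self h.ne']

lemma softmax_lipschitz {K : ℕ} [NeZero K] : LipschitzWith 1 (softmax : RVec K → RVec K) := by
  refine LipschitzWith.of_dist_le_mul fun z w => ?_
  rw [NNReal.coe_one, one_mul, dist_comm z w, dist_comm (softmax z), dist_eq_norm, dist_eq_norm]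
  set u : RVec K := w - z with hu
  let p : ℝ → RVec K := fun t => softmax (z + t • u)
  let v : ℝ → RVec K := fun t =>
    WithLp.toLp 2 fun k => p t k * (u k - ∑ l, p t l * u l)
  have hd : ∀ t : ℝ, HasDerivAt p (v t) t := by
    intro t
    have hE : ∀ k, HasDerivAt (fun t : ℝ => Real.exp ((z + t • u) k))
        (Real.exp ((z + t • u) k) * u k) t := by
      intro k
      have h1 : HasDerivAt (fun t : ℝ => (z + t • u) k) (u k) t := by
        simpa using ((hasDerivAt_id t).mul_const (u k)).const_add (z k)
      exact h1.exp
    have hS : HasDerivAt (fun t : ℝ => ∑ l, Real.exp ((z + t • u) l))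
        (∑ l, Real.exp ((z + t • u) l) * u l) t := HasDerivAt.fun_sum fun l _ => hE l
    have hpos := sum_exp_pos (z + t • u)
    have hcoord : ∀ k, HasDerivAt (fun t : ℝ => p t k) (v t k) t := by
      intro k
      have h2 := (hE k).div hS hpos.ne'
      refine h2.congr_deriv ?_
      simp only [v, p, softmax]
      have h3 : ∑ l, Real.exp ((z + t • u) l) / (∑ l, Real.exp ((z + t • u) l)) * u l
          = (∑ l, Real.exp ((z + t • u) l) * u l) / (∑ l, Real.exp ((z + t • u) l)) := by
        rw [Finset.sum_div]
        exact Finset.sum_congr rfl fun l _ => by ring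
      rw [h3]
      field_simp
    have key : HasDerivAt (fun t : ℝ => fun k => p t k) (fun k => v t k) t := by
      rw [hasDerivAt_pi]
      intro k
      exact hcoord k
    exact (EuclideanSpace.equiv (Fin K) ℝ).symm.hasFDerivAt.comp_hasDerivAt t key
  have hb : ∀ t : ℝ, ‖v t‖ ≤ ‖u‖ := by
    intro t
    obtain ⟨h0, h1⟩ := softmax_mem_simplex (z + t • u)
    have hle : ∀ k, p t k ≤ 1 := fun k =>
      h1 ▸ Finset.single_le_sum (f := fun k => softmax (z + t • u) k)
        (fun l _ => h0 l) (Finset.mem_univ k)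
    set c := ∑ l, p t l * u l with hc
    have hnn : ∀ k, 0 ≤ p t k := h0
    have hsum : ∑ k, p t k = 1 := h1
    rw [EuclideanSpace.norm_eq, EuclideanSpace.norm_eq]
    apply Real.sqrt_le_sqrt
    simp only [Real.norm_eq_abs, sq_abs]
    calc ∑ k, (p t k * (u k - c)) ^ 2
        ≤ ∑ k, p t k * (u k - c) ^ 2 := by
          refine Finset.sum_le_sum fun k _ => ?_
          nlinarith [mul_nonneg (mul_nonneg (hnn k) (sub_nonneg.2 (hle k))) (sq_nonneg (u k - c))]
      _ = ∑ k, (p t k * u k ^ 2 - 2 * c * (p t k * u k) + c ^ 2 * p t k) :=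
          Finset.sum_congr rfl fun k _ => by ring
      _ = ∑ k, p t k * u k ^ 2 - c ^ 2 := by
          rw [Finset.sum_add_distrib, Finset.sum_sub_distrib, ← Finset.mul_sum, ← Finset.mul_sum,
            hsum, ← hc]
          ring
      _ ≤ ∑ k, p t k * u k ^ 2 := by nlinarith [sq_nonneg c]
      _ ≤ ∑ k, u k ^ 2 := Finset.sum_le_sum fun k _ => by nlinarith [hle k, sq_nonneg (u k)]
  have h := norm_image_sub_le_of_norm_deriv_le_segment_01' (f := p) (f' := v) (C := ‖u‖)
    (fun t _ => (hd t).hasDerivWithinAt) (fun t _ => hb t)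
  simpa [p, hu] using h

/-- The softmax output layer. -/
def softmaxLayer (K : ℕ) [NeZero K] : OutputLayer K :=
  ⟨softmax, softmax_lipschitz, softmax_mem_simplex⟩

/-- A network class: an architecture followed by an output layer. -/
structure NetworkClass (d K : ℕ) where
  /-- the architecture of the network proper -/
  arch : Architecture d K
  /-- the output layer -/
  out : OutputLayer K

/-- The functions of a network class. -/
def NetworkClass.functions {d K : ℕ} (F : NetworkClass d K) : Set (RVec d → RVec K) :=
  {f | ∃ g ∈ F.arch.nets, f = fun x => F.out.toFun (g x)}

/-- The complexity measure of a network class. -/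
def NetworkClass.R {d K : ℕ} (F : NetworkClass d K) : ℝ := F.arch.complexity

/-- The vector `Π v` for the permutation matrix `Π` of `π`. -/
def permVec {K : ℕ} (π : Equiv.Perm (Fin K)) (v : RVec K) : RVec K :=
  Matrix.toEuclideanLin (π.permMatrix ℝ) v

/-- The class is closed under relabelling the clusters. -/
def NetworkClass.RelabelClosed {d K : ℕ} (F : NetworkClass d K) : Prop :=
  ∀ π : Equiv.Perm (Fin K), ∀ f ∈ F.functions, (fun x => permVec π (f x)) ∈ F.functions

/-! ### Pairwise annotations and the logistic loss -/

/-- An annotation `(i, j, y)`; `y = true` stands for "similar", that is, for `y = 1`. -/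
abbrev Annotation (N : ℕ) : Type := (Fin N × Fin N) × Bool

/-- The similarity `⟨f(x_i), f(x_j)⟩` of the pair `(i, j)`. -/
def similarity {d K N : ℕ} (f : RVec d → RVec K) (X : Fin N → RVec d) (p : Fin N × Fin N) : ℝ :=
  inner ℝ (f (X p.1)) (f (X p.2))

/-- The probability of the annotations `S` given the samples `X`: the pairs are independent and
uniform on `[N] × [N]`, and given the pair `(i, j)` the label is Bernoulli with parameter
`⟨f(x_i), f(x_j)⟩`. -/
def annotationWeight {d K N M : ℕ} (f : RVec d → RVec K) (X : Fin N → RVec d)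
    (S : Fin M → Annotation N) : ENNReal :=
  ∏ m, ENNReal.ofReal
    (1 / (N : ℝ) ^ 2 * bif (S m).2 then similarity f X (S m).1 else 1 - similarity f X (S m).1)

/-- The law of `M` annotations given the samples `X`. -/
def annotationLaw {d K N : ℕ} (f : RVec d → RVec K) (X : Fin N → RVec d) (M : ℕ) :
    Measure (Fin M → Annotation N) :=
  Measure.count.withDensity fun S => annotationWeight f X S

/-- The joint law of `N` i.i.d. samples from `P` and of `M` annotations of them. -/
def jointLaw {d K : ℕ} (P : Measure (RVec d)) (f : RVec d → RVec K) (N M : ℕ) :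
    Measure ((Fin N → RVec d) × (Fin M → Annotation N)) :=
  ((Measure.pi fun _ : Fin N => P).prod Measure.count).withDensity
    fun z => annotationWeight f z.1 z.2

/-- The logistic loss for pairwise annotations. -/
def lossCC {d K N M : ℕ} (X : Fin N → RVec d) (S : Fin M → Annotation N)
    (f : RVec d → RVec K) : ℝ :=
  1 / (M : ℝ) * ∑ m, bif (S m).2 then Real.log (1 / similarity f X (S m).1)
    else Real.log (1 / (1 - similarity f X (S m).1))

/-- The learned networks: all minimizers of the logistic loss over the network class. -/
def learned {d K N M : ℕ} (F : NetworkClass d K) (X : Fin N → RVec d)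
    (S : Fin M → Annotation N) : Set (RVec d → RVec K) :=
  {f | f ∈ F.functions ∧ ∀ g ∈ F.functions, lossCC X S f ≤ lossCC X S g}

/-- The error `‖Π M_f - M_g‖_F` on the samples. -/
def sampleError {d K N : ℕ} (π : Equiv.Perm (Fin K)) (f g : RVec d → RVec K)
    (X : Fin N → RVec d) : ℝ :=
  frobNorm (π.permMatrix ℝ * membershipMatrix f X - membershipMatrix g X)

/-- The expected error `E_{x ∼ P} [ (1/K) ‖Π f(x) - g(x)‖² ]`. -/
def expectedError {d K : ℕ} (P : Measure (RVec d)) (π : Equiv.Perm (Fin K))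
    (f g : RVec d → RVec K) : ℝ :=
  ∫ x, 1 / (K : ℝ) * ‖permVec π (f x) - g x‖ ^ 2 ∂P

/-- The generalization bound. -/
def genBound {d N : ℕ} (K : ℕ) (R : ℝ) (X : Fin N → RVec d) (δ : ℝ) : ℝ :=
  8 / ((N : ℝ) * K)
    + 12 * √(2 * R) * frobNorm (dataMatrix X) * Real.log N / ((N : ℝ) * K * Real.log 2)
    + 8 * √(2 * Real.log (4 / δ) / ((N : ℝ) * (K : ℝ) ^ 2))

end

/-! Recovery on the samples. With `N` fixed, an annotation takes only `2 N²` values and the loss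
depends on the annotations only through their empirical frequencies (`lossCC_eq`), which concentrate
around their probabilities uniformly in the samples (`annotationLaw_atypical_le`). A learned network
has at least the likelihood of a network `h` of the class close to the target, and the similarities
of `h` stay away from 0 and 1 by a constant independent of `M` (`exists_approximation`). Through
`log x ≤ 2 (√x - 1)` this likelihood comparison bounds a Hellinger distance
(`sum_sq_sqrt_sub_sqrt_le`). Only upper bounds on the likelihood ratios enter, so similarities of
the learned network may come arbitrarily close to 0 or 1. Its Gram matrix on the samples is
therefore almost that of the target (`exists_abs_similarity_sub_le`).

A nonnegative matrix with exactly the Gram matrix of a sufficiently scattered one differs from it by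
an orthogonal map, which the SSC forces to be a permutation (`SufficientlyScattered.exists_perm`).
Compactness of the simplex makes this stable: the sets `ambiguous K N ε η` decrease, as `η → 0`,
into `ambiguous K N ε 0`, which contains no scattered memberships. For random samples, continuity of
the measure along this decreasing sequence replaces a quantitative stability constant.

Generalization. Half the squared error takes values in `[0, 1]`. McDiarmid's inequality, applied to
the uniform deviation minus twice the empirical Rademacher average, gives a bound that depends on
the data (`measure_exists_lt_integral_le`). The Rademacher average is bounded by chaining
(`radAvg_fmax_le_of_cover`) with covering numbers of networks obtained layer by layer from Maurey's
sparsification (`Architecture.exists_cover`). The classes are first taken finite, so that maxima are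
measurable; a dense sequence passes to the full class. If the class is closed under relabelling, the
bound is needed for the identity permutation only, so no union over permutations is paid for. -/

noncomputable section

/-! ### The bounded differences inequality -/

section BoundedDifferences

variable {E : Type*}

/-- A function on a product space has bounded differences `c` if changing one coordinate changes
its value by at most `c`. -/
def BoundedDiff {n : ℕ} (g : (Fin n → E) → ℝ) (c : ℝ) : Prop :=
  ∀ X i y, |g (Function.update X i y) - g X| ≤ c

lemma BoundedDiff.cons_right {n : ℕ} {g : (Fin (n + 1) → E) → ℝ} {c : ℝ} (h : BoundedDiff g c)
    (x : E) : BoundedDiff (fun Y : Fin n → E => g (Fin.cons x Y)) c := by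
  intro Y i y
  have := h (Fin.cons x Y) i.succ y
  rwa [← Fin.cons_update] at this

lemma BoundedDiff.cons_left {n : ℕ} {g : (Fin (n + 1) → E) → ℝ} {c : ℝ} (h : BoundedDiff g c)
    (Y : Fin n → E) (x y : E) : g (Fin.cons x Y) - g (Fin.cons y Y) ≤ c := by
  have := h (Fin.cons y Y) 0 x
  rw [Fin.update_cons_zero] at this
  exact (le_abs_self _).trans this

variable [MeasurableSpace E]

lemma integral_pi_fin_succ (μ : Measure E) [IsProbabilityMeasure μ] {n : ℕ}
    (F : (Fin (n + 1) → E) → ℝ) :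
    ∫ X, F X ∂(Measure.pi fun _ : Fin (n + 1) => μ)
      = ∫ z, F (Fin.cons z.1 z.2) ∂(μ.prod (Measure.pi fun _ : Fin n => μ)) := by
  rw [← ((measurePreserving_piFinSuccAbove (fun _ : Fin (n + 1) => μ) 0).symm).integral_comp']
  simp [MeasurableEquiv.piFinSuccAbove_symm_apply, Fin.insertNthEquiv]

lemma measurable_fin_cons {n : ℕ} :
    Measurable fun z : E × (Fin n → E) => (Fin.cons z.1 z.2 : Fin (n + 1) → E) := by
  rw [measurable_pi_iff]
  intro i
  refine Fin.cases ?_ (fun j => ?_) i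
  · simpa using measurable_fst
  · simp only [Fin.cons_succ]
    fun_prop

lemma integrable_of_abs_le {Ω : Type*} [MeasurableSpace Ω] {ν : Measure Ω} [IsFiniteMeasure ν]
    {g : Ω → ℝ} (hg : Measurable g) {C : ℝ} (hC : ∀ x, |g x| ≤ C) : Integrable g ν :=
  Integrable.of_bound hg.aestronglyMeasurable C (Eventually.of_forall hC)

lemma abs_integral_le_of_abs_le {Ω : Type*} [MeasurableSpace Ω] {ν : Measure Ω}
    [IsProbabilityMeasure ν] {g : Ω → ℝ} {C : ℝ} (hC : ∀ x, |g x| ≤ C) : |∫ x, g x ∂ν| ≤ C := by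
  have := norm_integral_le_of_norm_le_const (μ := ν) (f := g) (C := C) (Eventually.of_forall hC)
  simpa using this

/-- Hoeffding's lemma: the oscillation bound puts the range of `g` in an interval of length `c` that
starts at its infimum. -/
lemma mgf_slice_le (μ : Measure E) [IsProbabilityMeasure μ] {g : E → ℝ} (hg : Measurable g)
    {c : ℝ} (hd : ∀ x y, g x - g y ≤ c) (t : ℝ) :
    ∫ x, Real.exp (t * (g x - ∫ y, g y ∂μ)) ∂μ ≤ Real.exp (c ^ 2 / 4 * t ^ 2 / 2) := by
  obtain ⟨x0⟩ : Nonempty E := μ.nonempty_of_neZero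
  have hbdd : BddBelow (Set.range g) := ⟨g x0 - c, by rintro _ ⟨y, rfl⟩; linarith [hd x0 y]⟩
  have hIcc : ∀ x, g x ∈ Set.Icc (⨅ y, g y) ((⨅ y, g y) + c) := by
    intro x
    have : Nonempty E := ⟨x0⟩
    refine ⟨ciInf_le hbdd x, ?_⟩
    have : g x - c ≤ ⨅ y, g y := le_ciInf fun y => by linarith [hd x y]
    linarith
  have h := ProbabilityTheory.hasSubgaussianMGF_of_mem_Icc (μ := μ) hg.aemeasurable
    (Eventually.of_forall hIcc)
  have h2 := h.mgf_le t
  simp only [ProbabilityTheory.mgf] at h2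
  refine h2.trans_eq ?_
  congr 1
  have : ((⨅ y, g y) + c - ⨅ y, g y) = c := by ring
  rw [this]
  push_cast
  rw [Real.norm_eq_abs, div_pow, sq_abs]
  ring

/-- McDiarmid's bound for the moment generating function. -/
theorem mgf_le_of_boundedDiff (μ : Measure E) [IsProbabilityMeasure μ] {c : ℝ} (t : ℝ) :
    ∀ {n : ℕ} {g : (Fin n → E) → ℝ}, Measurable g → (∃ C, ∀ X, |g X| ≤ C) → BoundedDiff g c →
      ∫ X, Real.exp (t * (g X - ∫ Y, g Y ∂(Measure.pi fun _ => μ))) ∂(Measure.pi fun _ => μ)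
        ≤ Real.exp (n * (c ^ 2 / 4 * t ^ 2 / 2)) := by
  intro n
  induction n with
  | zero =>
    intro g hg _ _
    have h0 : ∀ X Y : Fin 0 → E, g X = g Y := fun X Y => congrArg g (Subsingleton.elim X Y)
    have h1 : ∀ X, g X - ∫ Y, g Y ∂(Measure.pi fun _ : Fin 0 => μ) = 0 := by
      intro X
      rw [integral_congr_ae (Eventually.of_forall fun Y => h0 Y X)]
      simp
    simp [h1]
  | succ n ih =>
    rintro g hg ⟨C, hC⟩ hd
    set ν := Measure.pi fun _ : Fin n => μ with hν
    set m := ∫ Y, g Y ∂(Measure.pi fun _ : Fin (n + 1) => μ) with hm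
    have hgc : Measurable fun z : E × (Fin n → E) => g (Fin.cons z.1 z.2) :=
      hg.comp measurable_fin_cons
    -- Averaging out the first coordinate keeps the mean and the bounded differences. So the
    -- induction hypothesis handles `gb - m`, and Hoeffding's lemma handles `g - gb` for frozen
    -- remaining coordinates.
    let gb : (Fin n → E) → ℝ := fun Y => ∫ x, g (Fin.cons x Y) ∂μ
    have hgb : Measurable gb := by
      have := (hgc.stronglyMeasurable.integral_prod_left' (μ := μ)).measurable
      exact this
    have hslice : ∀ Y, Measurable fun x => g (Fin.cons x Y) := fun Y =>
      hgc.comp (measurable_id.prodMk measurable_const)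
    have hsi : ∀ Y, Integrable (fun x => g (Fin.cons x Y)) μ := fun Y =>
      integrable_of_abs_le (hslice Y) (fun x => hC _)
    have hgbC : ∀ Y, |gb Y| ≤ C := fun Y => abs_integral_le_of_abs_le fun x => hC _
    have hgbd : BoundedDiff gb c := by
      intro Y i y
      simp only [gb]
      rw [← integral_sub (hsi _) (hsi _)]
      exact abs_integral_le_of_abs_le fun x => hd.cons_right x Y i y
    have hgbm : ∫ Y, gb Y ∂ν = m := by
      rw [hm, integral_pi_fin_succ, integral_prod_symm _ (integrable_of_abs_le hgc fun z => hC _)]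
    have hIH := ih hgb ⟨C, hgbC⟩ hgbd
    rw [hgbm] at hIH
    have hCm : |m| ≤ C := abs_integral_le_of_abs_le hC
    have hexpb : ∀ a : ℝ, |a| ≤ C + C → |Real.exp (t * a)| ≤ Real.exp (|t| * (C + C)) := by
      intro a ha
      rw [abs_of_pos (Real.exp_pos _)]
      refine Real.exp_le_exp.2 ((le_abs_self _).trans ?_)
      rw [abs_mul]
      gcongr
    have hsub : ∀ a b : ℝ, |a| ≤ C → |b| ≤ C → |a - b| ≤ C + C := fun a b ha hb =>
      (abs_sub a b).trans (add_le_add ha hb)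
    rw [integral_pi_fin_succ, integral_prod_symm]
    · calc ∫ Y, ∫ x, Real.exp (t * (g (Fin.cons x Y) - m)) ∂μ ∂ν
          ≤ ∫ Y, Real.exp (c ^ 2 / 4 * t ^ 2 / 2) * Real.exp (t * (gb Y - m)) ∂ν := by
            refine integral_mono_of_nonneg
              (Eventually.of_forall fun Y => integral_nonneg fun x => (Real.exp_pos _).le) ?_
              (Eventually.of_forall fun Y => ?_)
            · refine Integrable.const_mul ?_ _
              exact integrable_of_abs_le (by fun_prop)
                (fun Y => hexpb _ (hsub _ _ (hgbC Y) hCm))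
            · have h1 := mgf_slice_le μ (hslice Y) (hd.cons_left Y) t
              have h2 : ∀ x, Real.exp (t * (g (Fin.cons x Y) - m))
                  = Real.exp (t * (g (Fin.cons x Y) - gb Y)) * Real.exp (t * (gb Y - m)) := by
                intro x
                rw [← Real.exp_add]
                ring_nf
              simp only [h2]
              rw [integral_mul_const]
              exact mul_le_mul_of_nonneg_right h1 (Real.exp_pos _).le
        _ ≤ Real.exp (c ^ 2 / 4 * t ^ 2 / 2) * Real.exp (n * (c ^ 2 / 4 * t ^ 2 / 2)) := by
            rw [integral_const_mul]
            exact mul_le_mul_of_nonneg_left hIH (Real.exp_pos _).le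
        _ = Real.exp ((n + 1 : ℕ) * (c ^ 2 / 4 * t ^ 2 / 2)) := by
            rw [← Real.exp_add]
            push_cast
            ring_nf
    · refine integrable_of_abs_le (C := Real.exp (|t| * (C + C))) ?_
        (fun z => hexpb _ (hsub _ _ (hC _) hCm))
      exact ((hgc.sub_const m).const_mul t).exp

/-- McDiarmid's inequality for a function of `n` i.i.d. variables. -/
theorem measure_ge_le_of_boundedDiff (μ : Measure E) [IsProbabilityMeasure μ] {c : ℝ}
    (hc : 0 < c) {n : ℕ} (hn : 0 < n) {g : (Fin n → E) → ℝ} (hg : Measurable g)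
    (hb : ∃ C, ∀ X, |g X| ≤ C) (hd : BoundedDiff g c) {u : ℝ} (hu : 0 ≤ u) :
    Measure.pi (fun _ : Fin n => μ) {X | (∫ Y, g Y ∂(Measure.pi fun _ => μ)) + u ≤ g X}
      ≤ ENNReal.ofReal (Real.exp (-(2 * u ^ 2 / (n * c ^ 2)))) := by
  set ν := Measure.pi fun _ : Fin n => μ
  set m := ∫ Y, g Y ∂ν with hm
  have hn' : (0 : ℝ) < n := by exact_mod_cast hn
  obtain ⟨C, hC⟩ := hb
  have hCm : |m| ≤ C := abs_integral_le_of_abs_le hC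
  have hint : Integrable (fun X => Real.exp (4 * u / (n * c ^ 2) * (g X - m))) ν := by
    refine integrable_of_abs_le (C := Real.exp (4 * u / (n * c ^ 2) * (C + C))) (by fun_prop) ?_
    intro X
    rw [abs_of_pos (Real.exp_pos _)]
    refine Real.exp_le_exp.2 (mul_le_mul_of_nonneg_left ?_ (by positivity))
    exact (le_abs_self _).trans ((abs_sub _ _).trans (add_le_add (hC X) hCm))
  -- The parameter `t = 4 u / (n c²)` minimizes the Chernoff exponent `-t u + n c² t² / 8`.
  have h1 := ProbabilityTheory.measure_ge_le_exp_mul_mgf (μ := ν) (X := fun X => g X - m) u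
    (t := 4 * u / (n * c ^ 2)) (by positivity) hint
  have h2 := mgf_le_of_boundedDiff μ (4 * u / (n * c ^ 2)) hg ⟨C, hC⟩ hd
  have h3 : ν.real {X | u ≤ g X - m} ≤ Real.exp (-(2 * u ^ 2 / (n * c ^ 2))) := by
    refine h1.trans ((mul_le_mul_of_nonneg_left h2 (Real.exp_pos _).le).trans_eq ?_)
    rw [← Real.exp_add]
    congr 1
    field_simp
    ring
  have h4 : {X | m + u ≤ g X} = {X | u ≤ g X - m} := by
    ext X
    simp only [Set.mem_ofPred_eq]
    constructor <;> intro h <;> linarith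
  rw [h4, ← ofReal_measureReal]
  exact ENNReal.ofReal_le_ofReal h3

end BoundedDifferences

/-! ### Finite maxima and Rademacher averages -/

section Rademacher

variable {ι : Type*} [Fintype ι] [Nonempty ι]

/-- The maximum of a nonempty finite family of reals. -/
def fmax (f : ι → ℝ) : ℝ := Finset.univ.sup' Finset.univ_nonempty f

lemma le_fmax (f : ι → ℝ) (i : ι) : f i ≤ fmax f := Finset.le_sup' f (Finset.mem_univ i)

lemma fmax_le {f : ι → ℝ} {c : ℝ} (h : ∀ i, f i ≤ c) : fmax f ≤ c :=
  Finset.sup'_le _ _ fun i _ => h i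

lemma exists_fmax_eq (f : ι → ℝ) : ∃ i, fmax f = f i := by
  obtain ⟨i, _, hi⟩ := Finset.exists_mem_eq_sup' Finset.univ_nonempty f
  exact ⟨i, hi⟩

lemma fmax_add_le (f g : ι → ℝ) : fmax (fun i => f i + g i) ≤ fmax f + fmax g :=
  fmax_le fun i => add_le_add (le_fmax f i) (le_fmax g i)

lemma abs_fmax_sub_fmax_le {f g : ι → ℝ} {c : ℝ} (h : ∀ i, |f i - g i| ≤ c) :
    |fmax f - fmax g| ≤ c := by
  rw [abs_le]
  constructor
  · have : fmax g ≤ fmax f + c := fmax_le fun i => by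
      linarith [le_fmax f i, (abs_le.1 (h i)).1]
    linarith
  · have : fmax f ≤ fmax g + c := fmax_le fun i => by
      linarith [le_fmax g i, (abs_le.1 (h i)).2]
    linarith

lemma abs_fmax_le {f : ι → ℝ} {c : ℝ} (h : ∀ i, |f i| ≤ c) : |fmax f| ≤ c := by
  obtain ⟨i, hi⟩ := exists_fmax_eq f
  rw [hi]
  exact h i

lemma measurable_fmax {Ω : Type*} [MeasurableSpace Ω] {f : ι → Ω → ℝ} (hf : ∀ i, Measurable (f i)) :
    Measurable fun ω => fmax fun i => f i ω := by
  have := Finset.measurable_sup' (Finset.univ_nonempty (α := ι)) (f := f) fun i _ => hf i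
  convert this using 1
  ext ω
  simp [fmax, Finset.sup'_apply]

/-- The sign `±1` of a Boolean. -/
def rsign (b : Bool) : ℝ := bif b then 1 else -1

lemma abs_rsign (b : Bool) : |rsign b| = 1 := by cases b <;> simp [rsign]

lemma rsign_sq (b : Bool) : rsign b ^ 2 = 1 := by cases b <;> simp [rsign]

lemma rsign_not (b : Bool) : rsign (!b) = -rsign b := by cases b <;> simp [rsign]

variable {N : ℕ}

/-- The average over all choices of signs. -/
def radAvg (F : (Fin N → Bool) → ℝ) : ℝ := (∑ σ, F σ) / 2 ^ N

lemma radAvg_mono {F G : (Fin N → Bool) → ℝ} (h : ∀ σ, F σ ≤ G σ) : radAvg F ≤ radAvg G :=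
  div_le_div_of_nonneg_right (Finset.sum_le_sum fun σ _ => h σ) (by positivity)

lemma radAvg_add (F G : (Fin N → Bool) → ℝ) :
    radAvg (fun σ => F σ + G σ) = radAvg F + radAvg G := by
  simp [radAvg, Finset.sum_add_distrib, add_div]

lemma radAvg_sub (F G : (Fin N → Bool) → ℝ) :
    radAvg (fun σ => F σ - G σ) = radAvg F - radAvg G := by
  simp [radAvg, Finset.sum_sub_distrib, sub_div]

lemma radAvg_sum {κ : Type*} (s : Finset κ) (F : κ → (Fin N → Bool) → ℝ) :
    radAvg (fun σ => ∑ j ∈ s, F j σ) = ∑ j ∈ s, radAvg (F j) := by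
  simp only [radAvg]
  rw [Finset.sum_comm, Finset.sum_div]

lemma radAvg_const_mul (c : ℝ) (F : (Fin N → Bool) → ℝ) :
    radAvg (fun σ => c * F σ) = c * radAvg F := by
  simp [radAvg, ← Finset.mul_sum, mul_div_assoc]

lemma radAvg_const (c : ℝ) : radAvg (fun _ : Fin N → Bool => c) = c := by
  simp [radAvg]

lemma abs_radAvg_le {F : (Fin N → Bool) → ℝ} {c : ℝ} (h : ∀ σ, |F σ| ≤ c) : |radAvg F| ≤ c := by
  have h1 := radAvg_mono fun σ => (abs_le.1 (h σ)).1
  have h2 := radAvg_mono fun σ => (abs_le.1 (h σ)).2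
  rw [radAvg_const] at h1 h2
  exact abs_le.2 ⟨h1, h2⟩

lemma radAvg_comp_not (F : (Fin N → Bool) → ℝ) :
    radAvg (fun σ => F fun n => !(σ n)) = radAvg F := by
  simp only [radAvg]
  congr 1
  exact Function.Bijective.sum_comp
    (e := fun (σ : Fin N → Bool) n => !(σ n))
    (Function.Involutive.bijective fun σ => by ext; simp) F

/-- The pairing of a sign vector with a real vector. -/
def signDot (σ : Fin N → Bool) (v : RVec N) : ℝ := ∑ n, rsign (σ n) * v n

lemma signDot_sub (σ : Fin N → Bool) (v w : RVec N) :
    signDot σ (v - w) = signDot σ v - signDot σ w := by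
  simp [signDot, mul_sub, Finset.sum_sub_distrib]

lemma signDot_le (σ : Fin N → Bool) (v : RVec N) : signDot σ v ≤ √N * ‖v‖ := by
  have h := Finset.sum_mul_sq_le_sq_mul_sq Finset.univ (fun n => rsign (σ n)) (fun n => v n)
  simp only [rsign_sq, Finset.sum_const, Finset.card_univ, Fintype.card_fin, nsmul_eq_mul,
    mul_one] at h
  rw [EuclideanSpace.norm_eq, ← Real.sqrt_mul (Nat.cast_nonneg N)]
  simp only [Real.norm_eq_abs, sq_abs]
  exact Real.le_sqrt_of_sq_le h

lemma radAvg_prod (f : Fin N → Bool → ℝ) :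
    radAvg (fun σ => ∏ n, f n (σ n)) = ∏ n, (f n true + f n false) / 2 := by
  rw [radAvg, Finset.prod_div_distrib]
  congr 1
  · have := Finset.prod_univ_sum (fun _ : Fin N => (Finset.univ : Finset Bool)) f
    rw [Fintype.piFinset_univ] at this
    simpa using this.symm
  · simp

/-- The average over independent signs factors into hyperbolic cosines, and `cosh x ≤ exp (x² / 2)`.
-/
lemma radAvg_exp_le (v : RVec N) (t : ℝ) :
    radAvg (fun σ => Real.exp (t * signDot σ v)) ≤ Real.exp (t ^ 2 * ‖v‖ ^ 2 / 2) := by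
  have h1 : ∀ σ : Fin N → Bool, Real.exp (t * signDot σ v)
      = ∏ n, Real.exp (t * (rsign (σ n) * v n)) := by
    intro σ
    rw [← Real.exp_sum, signDot, Finset.mul_sum]
  simp only [h1]
  rw [radAvg_prod (fun n b => Real.exp (t * (rsign b * v n)))]
  have h2 : ∀ n, (Real.exp (t * (rsign true * v n)) + Real.exp (t * (rsign false * v n))) / 2
      ≤ Real.exp ((t * v n) ^ 2 / 2) := by
    intro n
    have := Real.cosh_le_exp_half_sq (t * v n)
    rw [Real.cosh_eq] at this
    simpa [rsign] using this
  refine (Finset.prod_le_prod (fun n _ => by positivity) fun n _ => h2 n).trans_eq ?_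
  rw [← Real.exp_sum, EuclideanSpace.norm_sq_eq, ← Finset.sum_div, Finset.mul_sum]
  simp [mul_pow]

lemma radAvg_signDot (v : RVec N) : radAvg (fun σ => signDot σ v) = 0 := by
  have h := radAvg_comp_not fun σ => signDot σ v
  have h2 : ∀ σ : Fin N → Bool, signDot (fun n => !(σ n)) v = (-1) * signDot σ v := by
    intro σ
    simp [signDot, rsign_not]
  simp only [h2, radAvg_const_mul] at h
  linarith

/-- Massart's finite class lemma. -/
lemma radAvg_fmax_le (v : ι → RVec N) {r L : ℝ} (hr : 0 ≤ r) (hv : ∀ i, ‖v i‖ ≤ r)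
    (hL : Real.log ((Finset.univ.image v).card) ≤ L) :
    radAvg (fun σ => fmax fun i => signDot σ (v i)) ≤ r * √(2 * L) := by
  set n : ℝ := ((Finset.univ.image v).card : ℝ) with hn
  have hn1 : 1 ≤ n := by
    rw [hn]
    exact_mod_cast Finset.card_pos.2 (Finset.univ_nonempty.image v)
  have hL0 : 0 ≤ L := (Real.log_nonneg hn1).trans hL
  have key : ∀ t > 0, radAvg (fun σ => fmax fun i => signDot σ (v i)) ≤ L / t + t * r ^ 2 / 2 := by
    intro t ht
    -- The tangent inequality `x ≤ (c - 1) + exp (x - c)` replaces Jensen's inequality for the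
    -- logarithm; this `c` is the logarithm of the bound for the averaged sum of exponentials, which
    -- makes it lossless.
    set c : ℝ := Real.log n + t ^ 2 * r ^ 2 / 2 with hc
    have h1 : ∀ σ : Fin N → Bool, t * (fmax fun i => signDot σ (v i))
        ≤ (c - 1) + Real.exp (-c) * ∑ w ∈ Finset.univ.image v, Real.exp (t * signDot σ w) := by
      intro σ
      obtain ⟨i, hi⟩ := exists_fmax_eq fun i => signDot σ (v i)
      rw [hi]
      have h2 : Real.exp (t * signDot σ (v i))
          ≤ ∑ w ∈ Finset.univ.image v, Real.exp (t * signDot σ w) :=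
        Finset.single_le_sum (f := fun w => Real.exp (t * signDot σ w))
          (fun _ _ => (Real.exp_pos _).le) (Finset.mem_image_of_mem v (Finset.mem_univ i))
      have h3 := Real.add_one_le_exp (t * signDot σ (v i) - c)
      have h4 : Real.exp (t * signDot σ (v i) - c)
          = Real.exp (-c) * Real.exp (t * signDot σ (v i)) := by
        rw [← Real.exp_add]; ring_nf
      have h5 := mul_le_mul_of_nonneg_left h2 (Real.exp_pos (-c)).le
      linarith
    have h6 := radAvg_mono h1
    rw [radAvg_const_mul, radAvg_add, radAvg_const, radAvg_const_mul, radAvg_sum] at h6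
    have h7 : ∑ w ∈ Finset.univ.image v, radAvg (fun σ => Real.exp (t * signDot σ w))
        ≤ Real.exp c := by
      have h8 : ∀ w ∈ Finset.univ.image v, radAvg (fun σ => Real.exp (t * signDot σ w))
          ≤ Real.exp (t ^ 2 * r ^ 2 / 2) := by
        intro w hw
        obtain ⟨i, _, rfl⟩ := Finset.mem_image.1 hw
        refine (radAvg_exp_le _ _).trans (Real.exp_le_exp.2 ?_)
        gcongr
        exact hv i
      refine (Finset.sum_le_sum h8).trans_eq ?_
      rw [Finset.sum_const, nsmul_eq_mul, hc, Real.exp_add, Real.exp_log (by linarith)]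
    have h9 := mul_le_mul_of_nonneg_left h7 (Real.exp_pos (-c)).le
    rw [← Real.exp_add, neg_add_cancel, Real.exp_zero] at h9
    have h10 : t * radAvg (fun σ => fmax fun i => signDot σ (v i)) ≤ L + t ^ 2 * r ^ 2 / 2 := by
      linarith
    rw [show L / t + t * r ^ 2 / 2 = (L + t ^ 2 * r ^ 2 / 2) / t by field_simp, le_div_iff₀ ht]
    linarith
  refine le_of_forall_pos_le_add fun ε hε => ?_
  set s := √(2 * L) with hs
  have hs0 : 0 ≤ s := Real.sqrt_nonneg _
  have hs2 : s ^ 2 = 2 * L := Real.sq_sqrt (by linarith)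
  -- choose `t` close to the optimal value `s / r`
  by_cases hr0 : r = 0
  · have h := key ((L + 1) / ε) (by positivity)
    refine h.trans ?_
    rw [hr0]
    have : L / ((L + 1) / ε) ≤ ε := by
      rw [div_div_eq_mul_div, div_le_iff₀ (by positivity)]
      nlinarith
    simpa using this
  · have hrp : 0 < r := lt_of_le_of_ne hr (Ne.symm hr0)
    have hη : 0 < ε / r := by positivity
    refine (key ((s + ε / r) / r) (by positivity)).trans ?_
    have e1 : L = s ^ 2 / 2 := by linarith
    have h2 : L / ((s + ε / r) / r) ≤ r * s / 2 := by
      rw [e1, div_div_eq_mul_div, div_le_iff₀ (by positivity)]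
      nlinarith [mul_nonneg (mul_nonneg hs0 hη.le) hr]
    have h3 : (s + ε / r) / r * r ^ 2 / 2 = r * s / 2 + ε / 2 := by
      field_simp
    linarith

/-- Chaining: the Rademacher average of a class of vectors with entries in `[0,1]` whose covering
numbers at scale `r` are at most `exp (B² / r²)`. -/
theorem radAvg_fmax_le_of_cover (hN : 0 < N) (T : ι → RVec N)
    (hT : ∀ i n, 0 ≤ T i n ∧ T i n ≤ 1) {B : ℝ} (hB : 0 ≤ B)
    (hcov : ∀ r > 0, ∃ C : Finset (RVec N), Real.log C.card ≤ B ^ 2 / r ^ 2 ∧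
      ∀ i, ∃ c ∈ C, ‖T i - c‖ ≤ r) (m : ℕ) :
    radAvg (fun σ => fmax fun i => signDot σ (T i)) ≤ N / 2 / 4 ^ m + m * (15 / 2 * B) := by
  have hN' : (0 : ℝ) < N := by exact_mod_cast hN
  -- The centre of the cube covers everything at the coarsest scale `√N / 2`. It costs no entropy,
  -- and its own Rademacher average vanishes.
  set ctr : RVec N := WithLp.toLp 2 fun _ => 1 / 2 with hctr
  let r : ℕ → ℝ := fun j => √N / 2 / 4 ^ j
  have hr : ∀ j, 0 < r j := fun j => by positivity
  have hr4 : ∀ j, r j = 4 * r (j + 1) := fun j => by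
    simp only [r, pow_succ]
    field_simp
  have hctrd : ∀ i, ‖T i - ctr‖ ≤ r 0 := by
    intro i
    simp only [r, pow_zero, div_one]
    rw [EuclideanSpace.norm_eq, show √(N : ℝ) / 2 = √(N / 4) by
      rw [Real.sqrt_div hN'.le, show (4 : ℝ) = 2 ^ 2 by norm_num, Real.sqrt_sq (by norm_num)]]
    apply Real.sqrt_le_sqrt
    calc ∑ n, ‖(T i - ctr) n‖ ^ 2 ≤ ∑ _n : Fin N, (1 / 4 : ℝ) := by
          refine Finset.sum_le_sum fun n _ => ?_
          rw [Real.norm_eq_abs, sq_abs]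
          have := hT i n
          simp only [hctr, PiLp.sub_apply]
          nlinarith
      _ = N / 4 := by simp; ring
  have hex : ∀ j, ∃ C : Finset (RVec N), (Real.log C.card ≤ B ^ 2 / r j ^ 2 ∧
      ∀ i, ∃ c ∈ C, ‖T i - c‖ ≤ r j) ∧ (j = 0 → C = {ctr}) := by
    intro j
    by_cases hj : j = 0
    · subst hj
      refine ⟨{ctr}, ⟨?_, fun i => ⟨ctr, by simp, hctrd i⟩⟩, fun _ => rfl⟩
      simp only [Finset.card_singleton, Nat.cast_one, Real.log_one]
      positivity
    · obtain ⟨C, hC⟩ := hcov (r j) (hr j)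
      exact ⟨C, hC, fun h => absurd h hj⟩
  choose C hC hC0 using hex
  have hp : ∀ j i, ∃ c ∈ C j, ‖T i - c‖ ≤ r j := fun j => (hC j).2
  choose p hpC hpr using hp
  have hp0 : ∀ i, p 0 i = ctr := by
    intro i
    have := hpC 0 i
    rw [hC0 0 rfl] at this
    simpa using this
  have hcard : ∀ j, 1 ≤ ((C j).card : ℝ) := by
    intro j
    obtain ⟨i⟩ := ‹Nonempty ι›
    exact_mod_cast Finset.card_pos.2 ⟨_, hpC j i⟩
  have hlink : ∀ j, radAvg (fun σ => fmax fun i => signDot σ (p (j + 1) i - p j i))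
      ≤ 15 / 2 * B := by
    intro j
    -- Triangle inequality through `T i`: `r j + r (j + 1) = (4 + 1) r (j + 1)`.
    have h1 : ∀ i, ‖p (j + 1) i - p j i‖ ≤ 5 * r (j + 1) := by
      intro i
      have : p (j + 1) i - p j i = (T i - p j i) - (T i - p (j + 1) i) := by abel
      rw [this]
      refine (norm_sub_le _ _).trans ?_
      linarith [hpr j i, hpr (j + 1) i, hr4 j]
    -- Links are differences of two centres, so the entropies add up. The coarser scale is four
    -- times larger and contributes only `1 / 16` of the finer one.
    have h2 : Real.log ((Finset.univ.image fun i => p (j + 1) i - p j i).card)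
        ≤ 17 / 16 * (B ^ 2 / r (j + 1) ^ 2) := by
      have h3 : (Finset.univ.image fun i => p (j + 1) i - p j i).card
          ≤ (C (j + 1)).card * (C j).card := by
        rw [← Finset.card_product]
        refine (Finset.card_le_card ?_).trans
          (Finset.card_image_le (s := C (j + 1) ×ˢ C j) (f := fun q => q.1 - q.2))
        intro w hw
        obtain ⟨i, _, rfl⟩ := Finset.mem_image.1 hw
        exact Finset.mem_image.2 ⟨(p (j + 1) i, p j i),
          Finset.mem_product.2 ⟨hpC _ i, hpC _ i⟩, rfl⟩
      have h4 : (1 : ℝ) ≤ (Finset.univ.image fun i => p (j + 1) i - p j i).card := by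
        exact_mod_cast Finset.card_pos.2 (Finset.univ_nonempty.image _)
      have h5 : Real.log ((Finset.univ.image fun i => p (j + 1) i - p j i).card)
          ≤ Real.log ((C (j + 1)).card * (C j).card : ℝ) :=
        Real.log_le_log (by linarith) (by exact_mod_cast h3)
      rw [Real.log_mul (by linarith [hcard (j + 1)]) (by linarith [hcard j])] at h5
      have h6 := (hC j).1
      rw [hr4 j, mul_pow] at h6
      have h7 : B ^ 2 / (4 ^ 2 * r (j + 1) ^ 2) = 1 / 16 * (B ^ 2 / r (j + 1) ^ 2) := by
        have := hr (j + 1)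
        field_simp
        norm_num
      linarith [(hC (j + 1)).1]
    have hrp := hr (j + 1)
    refine (radAvg_fmax_le _ (by positivity) h1 h2).trans ?_
    -- `√(17 / 8) ≤ 3 / 2`; with the link length `5 r (j + 1)` this yields `15 / 2 * B`, the same at
    -- every scale.
    have h8 : √(2 * (17 / 16 * (B ^ 2 / r (j + 1) ^ 2))) ≤ 3 / 2 * (B / r (j + 1)) := by
      rw [Real.sqrt_le_left (by positivity), mul_pow, div_pow B]
      have : 0 ≤ B ^ 2 / r (j + 1) ^ 2 := by positivity
      nlinarith
    refine (mul_le_mul_of_nonneg_left h8 (by positivity)).trans_eq ?_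
    field_simp
    ring
  have hpt : ∀ σ : Fin N → Bool, (fmax fun i => signDot σ (T i))
      ≤ (√N * r m + signDot σ ctr)
        + ∑ j ∈ Finset.range m, fmax fun i => signDot σ (p (j + 1) i - p j i) := by
    intro σ
    refine fmax_le fun i => ?_
    have h1 : ∑ j ∈ Finset.range m, signDot σ (p (j + 1) i - p j i)
        = signDot σ (p m i) - signDot σ ctr := by
      simp only [signDot_sub]
      rw [Finset.sum_range_sub (fun j => signDot σ (p j i)), hp0]
    have h2 : ∑ j ∈ Finset.range m, signDot σ (p (j + 1) i - p j i)
        ≤ ∑ j ∈ Finset.range m, fmax fun i => signDot σ (p (j + 1) i - p j i) :=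
      Finset.sum_le_sum fun j _ => le_fmax (fun i => signDot σ (p (j + 1) i - p j i)) i
    have h3 := signDot_le σ (T i - p m i)
    rw [signDot_sub] at h3
    have h4 := mul_le_mul_of_nonneg_left (hpr m i) (Real.sqrt_nonneg (N : ℝ))
    linarith
  refine (radAvg_mono hpt).trans ?_
  rw [radAvg_add, radAvg_add, radAvg_const, radAvg_signDot, radAvg_sum]
  have h1 : ∑ j ∈ Finset.range m, radAvg (fun σ => fmax fun i => signDot σ (p (j + 1) i - p j i))
      ≤ m * (15 / 2 * B) := by
    refine (Finset.sum_le_sum fun j _ => hlink j).trans_eq ?_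
    simp
  have h2 : √(N : ℝ) * r m = N / 2 / 4 ^ m := by
    simp only [r]
    rw [← mul_div_assoc, ← mul_div_assoc, Real.mul_self_sqrt hN'.le]
  linarith

/-! ### Symmetrization -/

variable {E : Type*}

/-- The empirical Rademacher average of a finite class of functions (not normalized by the number
of samples). -/
def empRad (h : ι → E → ℝ) (X : Fin N → E) : ℝ :=
  radAvg fun σ => fmax fun i => ∑ n, rsign (σ n) * h i (X n)

lemma abs_sum_le_card {f : Fin N → ℝ} {c : ℝ} (h : ∀ n, |f n| ≤ c) : |∑ n, f n| ≤ N * c := by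
  refine (Finset.abs_sum_le_sum_abs _ _).trans ((Finset.sum_le_sum fun n _ => h n).trans_eq ?_)
  simp

lemma abs_signSum_le {h : ι → E → ℝ} (hb : ∀ i x, |h i x| ≤ 1) (σ : Fin N → Bool)
    (X : Fin N → E) : |fmax fun i => ∑ n, rsign (σ n) * h i (X n)| ≤ N * 1 :=
  abs_fmax_le fun i => abs_sum_le_card fun n => by
    rw [abs_mul, abs_rsign, one_mul]
    exact hb _ _

variable [MeasurableSpace E]

lemma integral_comp_measurePreserving {Ω Ω' : Type*} [MeasurableSpace Ω] [MeasurableSpace Ω']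
    {ν : Measure Ω} {ν' : Measure Ω'} {f : Ω → Ω'} (hf : MeasurePreserving f ν ν') {F : Ω' → ℝ}
    (hF : Measurable F) : ∫ x, F (f x) ∂ν = ∫ y, F y ∂ν' := by
  rw [← hf.map_eq, integral_map hf.measurable.aemeasurable hF.aestronglyMeasurable]

lemma measurable_signSum {h : ι → E → ℝ} (hm : ∀ i, Measurable (h i)) (σ : Fin N → Bool) :
    Measurable fun X : Fin N → E => fmax fun i => ∑ n, rsign (σ n) * h i (X n) :=
  measurable_fmax fun i => Finset.measurable_sum _ fun n _ =>
    ((hm i).comp (measurable_pi_apply n)).const_mul _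

/-- Expectations are replaced by an independent ghost sample. Exchanging a sample point with its
ghost preserves the law, which inserts arbitrary signs, and the two halves then separate. -/
theorem integral_fmax_le_empRad (μ : Measure E) [IsProbabilityMeasure μ] (h : ι → E → ℝ)
    (hm : ∀ i, Measurable (h i)) (hb : ∀ i x, |h i x| ≤ 1) :
    ∫ X, (fmax fun i => ∑ n : Fin N, (∫ x, h i x ∂μ - h i (X n))) ∂(Measure.pi fun _ => μ)
      ≤ 2 * ∫ X, empRad h X ∂(Measure.pi fun _ : Fin N => μ) := by
  set ν := Measure.pi fun _ : Fin N => μ with hν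
  set ρ := Measure.pi fun _ : Fin N => μ.prod μ with hρ
  -- the ghost sample
  let D : (Fin N → Bool) → (Fin N → E × E) → ℝ := fun σ Z =>
    fmax fun i => ∑ n, rsign (σ n) * (h i (Z n).1 - h i (Z n).2)
  have hDm : ∀ σ, Measurable (D σ) := fun σ => measurable_fmax fun i =>
    Finset.measurable_sum _ fun n _ =>
      (((hm i).comp (measurable_fst.comp (measurable_pi_apply n))).sub
        ((hm i).comp (measurable_snd.comp (measurable_pi_apply n)))).const_mul _
  have hDb : ∀ σ Z, |D σ Z| ≤ N * 2 := fun σ Z => abs_fmax_le fun i => abs_sum_le_card fun n => by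
    rw [abs_mul, abs_rsign, one_mul]
    refine (abs_sub _ _).trans ?_
    linarith [hb i (Z n).1, hb i (Z n).2]
  let D1 : (Fin N → E) × (Fin N → E) → ℝ := fun z =>
    fmax fun i => ∑ n, (h i (z.1 n) - h i (z.2 n))
  have hD1m : Measurable D1 := measurable_fmax fun i =>
    Finset.measurable_sum _ fun n _ =>
      (((hm i).comp ((measurable_pi_apply n).comp measurable_fst)).sub
        ((hm i).comp ((measurable_pi_apply n).comp measurable_snd)))
  have hD1b : ∀ z, |D1 z| ≤ N * 2 := fun z => abs_fmax_le fun i => abs_sum_le_card fun n => by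
    refine (abs_sub _ _).trans ?_
    linarith [hb i (z.1 n), hb i (z.2 n)]
  -- A maximum of integrals is at most the integral of the maximum.
  have step1 : ∫ X, (fmax fun i => ∑ n : Fin N, (∫ x, h i x ∂μ - h i (X n))) ∂ν
      ≤ ∫ z, D1 z ∂(ν.prod ν) := by
    rw [integral_prod_symm _ (integrable_of_abs_le hD1m hD1b)]
    have hslice : ∀ Y, Measurable fun X : Fin N → E => D1 (X, Y) := fun Y =>
      hD1m.comp (measurable_id.prodMk measurable_const)
    refine integral_mono ?_ ?_ fun Y => ?_
    · refine integrable_of_abs_le (C := N * 2) ?_ fun X => ?_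
      · exact measurable_fmax fun i => Finset.measurable_sum _ fun n _ =>
          ((hm i).comp (measurable_pi_apply n)).const_sub _
      · refine abs_fmax_le fun i => abs_sum_le_card fun n => ?_
        refine (abs_sub _ _).trans ?_
        linarith [hb i (X n), abs_integral_le_of_abs_le (ν := μ) (hb i)]
    · exact (integrable_of_abs_le hD1m hD1b).integral_prod_right
    · refine fmax_le fun i => ?_
      have e1 : ∑ n : Fin N, (∫ x, h i x ∂μ - h i (Y n))
          = ∫ X, ∑ n : Fin N, (h i (X n) - h i (Y n)) ∂ν := by
        have hX : ∀ n : Fin N, Integrable (fun X : Fin N → E => h i (X n)) ν := fun n =>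
          integrable_of_abs_le ((hm i).comp (measurable_pi_apply n)) fun X => hb i _
        rw [integral_finsetSum (f := fun n (X : Fin N → E) => h i (X n) - h i (Y n)) _
          fun n _ => (hX n).sub (integrable_const _)]
        refine Finset.sum_congr rfl fun n _ => ?_
        rw [integral_sub (hX n) (integrable_const _),
          integral_comp_measurePreserving (measurePreserving_eval (fun _ : Fin N => μ) n) (hm i)]
        simp
      rw [e1]
      refine integral_mono ?_ (integrable_of_abs_le (hslice Y) fun X => hD1b _) fun X =>
        le_fmax (fun i => ∑ n, (h i (X n) - h i (Y n))) i
      refine integrable_of_abs_le (C := N * 2) ?_ fun X => abs_sum_le_card fun n => ?_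
      · exact Finset.measurable_sum _ fun n _ =>
          ((hm i).comp (measurable_pi_apply n)).sub_const _
      · refine (abs_sub _ _).trans ?_
        linarith [hb i (X n), hb i (Y n)]
  have step2 : ∫ z, D1 z ∂(ν.prod ν) = ∫ Z, D (fun _ => true) Z ∂ρ := by
    rw [← (measurePreserving_arrowProdEquivProdArrow E E (Fin N) (fun _ => μ)
      (fun _ => μ)).integral_comp']
    refine integral_congr_ae (Eventually.of_forall fun Z => ?_)
    simp [D1, D, MeasurableEquiv.arrowProdEquivProdArrow, Equiv.arrowProdEquivProdArrow, rsign]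
  -- Swap the pair exactly at the indices where the sign is negative.
  have step3 : ∀ σ, ∫ Z, D (fun _ => true) Z ∂ρ = ∫ Z, D σ Z ∂ρ := by
    intro σ
    let f : Fin N → E × E → E × E := fun n => bif σ n then id else Prod.swap
    have hf : ∀ n, MeasurePreserving (f n) (μ.prod μ) (μ.prod μ) := by
      intro n
      simp only [f]
      cases σ n
      · exact Measure.measurePreserving_swap
      · exact MeasurePreserving.id _
    have hp := measurePreserving_pi (fun _ : Fin N => μ.prod μ) (fun _ => μ.prod μ) hf
    rw [← integral_comp_measurePreserving hp (hDm _)]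
    refine integral_congr_ae (Eventually.of_forall fun Z => ?_)
    simp only [D, f]
    congr 1
    ext i
    refine Finset.sum_congr rfl fun n _ => ?_
    cases σ n <;> simp [rsign]
  let G : (Fin N → Bool) → (Fin N → E) → ℝ := fun σ X => fmax fun i => ∑ n, rsign (σ n) * h i (X n)
  have hGi : ∀ σ, Integrable (G σ) ν := fun σ =>
    integrable_of_abs_le (measurable_signSum hm σ) (abs_signSum_le hb σ)
  have step4 : ∀ σ, ∫ Z, D σ Z ∂ρ ≤ ∫ X, G σ X ∂ν + ∫ X, G (fun n => !(σ n)) X ∂ν := by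
    intro σ
    have h1 := measurePreserving_pi (fun _ : Fin N => μ.prod μ) (fun _ => μ)
      (f := fun _ => Prod.fst) fun _ => measurePreserving_fst
    have h2 := measurePreserving_pi (fun _ : Fin N => μ.prod μ) (fun _ => μ)
      (f := fun _ => Prod.snd) fun _ => measurePreserving_snd
    have e1 : ∫ X, G σ X ∂ν = ∫ Z, G σ (fun n => (Z n).1) ∂ρ :=
      (integral_comp_measurePreserving h1 (measurable_signSum hm σ)).symm
    have e2 : ∫ X, G (fun n => !(σ n)) X ∂ν = ∫ Z, G (fun n => !(σ n)) (fun n => (Z n).2) ∂ρ :=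
      (integral_comp_measurePreserving h2 (measurable_signSum hm _)).symm
    have i1 : Integrable (fun Z : Fin N → E × E => G σ (fun n => (Z n).1)) ρ :=
      integrable_of_abs_le ((measurable_signSum hm σ).comp h1.measurable)
        fun Z => abs_signSum_le hb σ _
    have i2 : Integrable (fun Z : Fin N → E × E => G (fun n => !(σ n)) (fun n => (Z n).2)) ρ :=
      integrable_of_abs_le ((measurable_signSum hm _).comp h2.measurable)
        fun Z => abs_signSum_le hb _ _
    rw [e1, e2, ← integral_add i1 i2]
    refine integral_mono (integrable_of_abs_le (hDm σ) (hDb σ)) (i1.add i2) fun Z => ?_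
    refine le_trans (le_of_eq ?_) (fmax_add_le _ _)
    simp only [D]
    congr 1
    ext i
    rw [← Finset.sum_add_distrib]
    refine Finset.sum_congr rfl fun n _ => ?_
    rw [rsign_not]
    ring
  have step5 : ∫ X, empRad h X ∂ν = radAvg fun σ => ∫ X, G σ X ∂ν := by
    simp only [empRad, radAvg]
    rw [integral_div, integral_finsetSum _ fun σ _ => hGi σ]
  calc _ ≤ ∫ Z, D (fun _ => true) Z ∂ρ := step1.trans_eq step2
    _ = radAvg fun _ : Fin N → Bool => ∫ Z, D (fun _ => true) Z ∂ρ := (radAvg_const _).symm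
    _ ≤ radAvg fun σ => ∫ X, G σ X ∂ν + ∫ X, G (fun n => !(σ n)) X ∂ν :=
        radAvg_mono fun σ => (step3 σ).trans_le (step4 σ)
    _ = 2 * ∫ X, empRad h X ∂ν := by
        rw [radAvg_add, radAvg_comp_not fun σ => ∫ X, G σ X ∂ν, step5]
        ring

end Rademacher

/-! ### Sparsification of convex combinations -/

section Sparsification

variable {V : Type*} [NormedAddCommGroup V] [InnerProductSpace ℝ V]

/-- Maurey's lemma: a convex combination of vectors of norm at most `W` is approximated by the
average of `k` of the vectors. -/
lemma exists_sum_near_of_convexComb {α : Type*} [Fintype α] (w : α → ℝ) (hw : ∀ a, 0 ≤ w a)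
    (hw1 : ∑ a, w a = 1) (v : α → V) {W : ℝ} (hv : ∀ a, ‖v a‖ ≤ W) (k : ℕ) :
    ∃ a : Fin k → α, ‖(k : ℝ) • (∑ b, w b • v b) - ∑ j, v (a j)‖ ^ 2 ≤ k * W ^ 2 := by
  set u := ∑ b, w b • v b with hu
  induction k with
  | zero => exact ⟨Fin.elim0, by simp⟩
  | succ k ih =>
    obtain ⟨a, ha⟩ := ih
    set r := (k : ℝ) • u - ∑ j, v (a j) with hr
    -- For `b` drawn with weights `w`, the increment `u - v b` has mean zero, so the cross term
    -- vanishes and the expected squared residual grows by at most `W²`. Some choice of `b` does no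
    -- worse than the mean.
    have hmean : ∑ b, w b * ‖r + u - v b‖ ^ 2 ≤ ‖r‖ ^ 2 + W ^ 2 := by
      have h1 : ∀ b, ‖r + u - v b‖ ^ 2
          = ‖r + u‖ ^ 2 - 2 * inner ℝ (r + u) (v b) + ‖v b‖ ^ 2 := fun b => norm_sub_sq_real _ _
      have h2 : ∑ b, w b * inner ℝ (r + u) (v b) = inner ℝ (r + u) u := by
        conv_rhs => rw [hu]
        rw [inner_sum]
        exact Finset.sum_congr rfl fun b _ => by rw [inner_smul_right]
      have h3 : ∑ b, w b * ‖v b‖ ^ 2 ≤ W ^ 2 := by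
        calc ∑ b, w b * ‖v b‖ ^ 2 ≤ ∑ b, w b * W ^ 2 := by
              refine Finset.sum_le_sum fun b _ => mul_le_mul_of_nonneg_left ?_ (hw b)
              exact pow_le_pow_left₀ (norm_nonneg _) (hv b) 2
          _ = W ^ 2 := by rw [← Finset.sum_mul, hw1, one_mul]
      have h4 : ∑ b, w b * ‖r + u - v b‖ ^ 2
          = ‖r + u‖ ^ 2 - 2 * inner ℝ (r + u) u + ∑ b, w b * ‖v b‖ ^ 2 := by
        rw [← h2, Finset.mul_sum]
        simp only [h1, mul_add, mul_sub, Finset.sum_add_distrib, Finset.sum_sub_distrib]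
        rw [← Finset.sum_mul, hw1, one_mul]
        congr 2
        exact Finset.sum_congr rfl fun b _ => by ring
      have h5 := norm_add_sq_real r u
      have h6 : inner ℝ (r + u) u = inner ℝ r u + ‖u‖ ^ 2 := by
        rw [inner_add_left, real_inner_self_eq_norm_sq]
      nlinarith [sq_nonneg ‖u‖]
    obtain ⟨b, hb⟩ : ∃ b, ‖r + u - v b‖ ^ 2 ≤ ‖r‖ ^ 2 + W ^ 2 := by
      by_contra hcon
      push Not at hcon
      have h1 : ∑ b, w b * (‖r‖ ^ 2 + W ^ 2) < ∑ b, w b * ‖r + u - v b‖ ^ 2 := by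
        obtain ⟨b0, hb0⟩ : ∃ b, 0 < w b := by
          by_contra h0
          push Not at h0
          have : ∑ a, w a ≤ 0 := Finset.sum_nonpos fun a _ => h0 a
          linarith
        exact Finset.sum_lt_sum (fun b _ => mul_le_mul_of_nonneg_left (hcon b).le (hw b))
          ⟨b0, Finset.mem_univ _, mul_lt_mul_of_pos_left (hcon b0) hb0⟩
      rw [← Finset.sum_mul, hw1, one_mul] at h1
      linarith
    refine ⟨Fin.cons b a, ?_⟩
    rw [Fin.sum_univ_succ]
    simp only [Fin.cons_zero, Fin.cons_succ]
    have e : ((k + 1 : ℕ) : ℝ) • u - (v b + ∑ j, v (a j)) = r + u - v b := by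
      rw [hr]
      push_cast
      rw [add_smul, one_smul]
      abel
    rw [e]
    push_cast
    linarith

/-- The atom of norm at most `W` in the direction of `± v`. -/
def signedAtom {ι : Type*} (W : ℝ) (v : ι → V) (p : ι × Bool) : V :=
  (rsign p.2 * (W * ‖v p.1‖⁻¹)) • v p.1

lemma norm_signedAtom_le {ι : Type*} {W : ℝ} (hW : 0 ≤ W) (v : ι → V) (p : ι × Bool) :
    ‖signedAtom W v p‖ ≤ W := by
  rw [signedAtom, norm_smul, Real.norm_eq_abs, abs_mul, abs_rsign, one_mul, abs_mul,
    abs_of_nonneg hW, abs_of_nonneg (inv_nonneg.2 (norm_nonneg _)), mul_assoc]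
  by_cases h : ‖v p.1‖ = 0
  · simp [h, hW]
  · rw [inv_mul_cancel₀ h, mul_one]

/-- Sparsification of a linear combination with weighted `ℓ¹` norm at most `W`. -/
lemma exists_avg_near {ι : Type*} [Fintype ι] [Nonempty ι] (β : ι → ℝ) (v : ι → V) {W : ℝ}
    (hW : 0 < W) (hβ : ∑ i, |β i| * ‖v i‖ ≤ W) {k : ℕ} (hk : 0 < k) :
    ∃ a : Fin k → ι × Bool,
      ‖∑ i, β i • v i - (k : ℝ)⁻¹ • ∑ j, signedAtom W v (a j)‖ ^ 2 ≤ W ^ 2 / k := by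
  set c : ℝ := (Fintype.card ι : ℝ) with hc
  have hc0 : 0 < c := by rw [hc]; exact_mod_cast Fintype.card_pos
  -- The mass missing from a probability vector. It is spread evenly over all atoms, where opposite
  -- signs cancel and the mean is unaffected.
  set l : ℝ := 1 - ∑ i, |β i| * ‖v i‖ / W with hl
  have hl0 : 0 ≤ l := by
    rw [hl, ← Finset.sum_div, sub_nonneg, div_le_one hW]
    exact hβ
  let w : ι × Bool → ℝ := fun p =>
    ((l / c + |β p.1| * ‖v p.1‖ / W) + rsign p.2 * (β p.1 * ‖v p.1‖ / W)) / 2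
  have hw : ∀ p, 0 ≤ w p := by
    rintro ⟨i, b⟩
    have h0 : 0 ≤ l / c := by positivity
    have h1 : |rsign b * (β i * ‖v i‖ / W)| = |β i| * ‖v i‖ / W := by
      rw [abs_mul, abs_rsign, one_mul, abs_div, abs_mul, abs_norm, abs_of_pos hW]
    have h2 := neg_abs_le (rsign b * (β i * ‖v i‖ / W))
    simp only [w]
    linarith
  have hw1 : ∑ p, w p = 1 := by
    rw [Fintype.sum_prod_type]
    have : ∀ i, ∑ b, w (i, b) = l / c + |β i| * ‖v i‖ / W := by
      intro i
      simp only [Fintype.univ_bool, w, rsign]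
      simp
      ring
    simp only [this, Finset.sum_add_distrib, Finset.sum_const, Finset.card_univ, nsmul_eq_mul]
    rw [← hc, mul_div_cancel₀ _ hc0.ne', hl]
    ring
  have hmean : ∑ p, w p • signedAtom W v p = ∑ i, β i • v i := by
    rw [Fintype.sum_prod_type]
    refine Finset.sum_congr rfl fun i _ => ?_
    simp only [Fintype.univ_bool, signedAtom, smul_smul]
    rw [Finset.sum_pair (by simp), ← add_smul]
    by_cases h : v i = 0
    · simp [h]
    · have hn : ‖v i‖ ≠ 0 := norm_ne_zero_iff.2 h
      congr 1
      simp only [w, rsign, cond_true, cond_false]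
      field_simp
      ring
  obtain ⟨a, ha⟩ := exists_sum_near_of_convexComb w hw hw1 (signedAtom W v)
    (norm_signedAtom_le hW.le v) k
  refine ⟨a, ?_⟩
  have hk' : (0 : ℝ) < k := by exact_mod_cast hk
  rw [hmean] at ha
  have e : ∑ i, β i • v i - (k : ℝ)⁻¹ • ∑ j, signedAtom W v (a j)
      = (k : ℝ)⁻¹ • ((k : ℝ) • (∑ i, β i • v i) - ∑ j, signedAtom W v (a j)) := by
    rw [smul_sub, smul_smul, inv_mul_cancel₀ hk'.ne', one_smul]
  rw [e, norm_smul, mul_pow, norm_inv, Real.norm_eq_abs, abs_of_pos hk']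
  refine (mul_le_mul_of_nonneg_left ha (by positivity)).trans_eq ?_
  field_simp

/-- The radial projection onto the closed ball of radius `ρ`. -/
def ballProj (ρ : ℝ) (y : V) : V := if ‖y‖ ≤ ρ then y else (ρ / ‖y‖) • y

lemma norm_ballProj_le {ρ : ℝ} (hρ : 0 ≤ ρ) (y : V) : ‖ballProj ρ y‖ ≤ ρ := by
  unfold ballProj
  split_ifs with h
  · exact h
  · push Not at h
    rw [norm_smul, Real.norm_eq_abs, abs_of_nonneg (by positivity), div_mul_cancel₀]
    exact (hρ.trans_lt h).ne'

/-- Projecting the centres of a cover costs no accuracy, and it bounds their norms, which the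
covering of the next layer needs. -/
lemma norm_sub_ballProj_le {ρ : ℝ} {x : V} (hx : ‖x‖ ≤ ρ) (y : V) :
    ‖x - ballProj ρ y‖ ≤ ‖x - y‖ := by
  unfold ballProj
  split_ifs with h
  · exact le_rfl
  · push Not at h
    have hρ : 0 ≤ ρ := (norm_nonneg x).trans hx
    have hy : 0 < ‖y‖ := hρ.trans_lt h
    refine le_of_sq_le_sq ?_ (norm_nonneg _)
    rw [norm_sub_sq_real, norm_sub_sq_real, inner_smul_right, norm_smul, Real.norm_eq_abs,
      abs_of_nonneg (by positivity), div_mul_cancel₀ _ hy.ne']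
    have h1 : inner ℝ x y ≤ ρ * ‖y‖ := (real_inner_le_norm x y).trans (by gcongr)
    have h2 : (1 - ρ / ‖y‖) * inner ℝ x y ≤ (1 - ρ / ‖y‖) * (ρ * ‖y‖) :=
      mul_le_mul_of_nonneg_left h1 (by rw [sub_nonneg, div_le_one hy]; exact h.le)
    have h3 : (1 - ρ / ‖y‖) * (ρ * ‖y‖) = ρ * ‖y‖ - ρ ^ 2 := by field_simp
    nlinarith [sq_nonneg (‖y‖ - ρ)]

end Sparsification

/-! ### Covering numbers of networks on a sample -/

/-- A sample of `N` vectors with the Frobenius norm. -/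
abbrev Sample (N m : ℕ) : Type := PiLp 2 fun _ : Fin N => RVec m

/-- The sample obtained by applying a map to every vector. -/
def mapSample {N m n : ℕ} (f : RVec m → RVec n) (X : Sample N m) : Sample N n :=
  WithLp.toLp 2 fun i => f (X i)

@[simp] lemma mapSample_apply {N m n : ℕ} (f : RVec m → RVec n) (X : Sample N m) (i : Fin N) :
    mapSample f X i = f (X i) := rfl

lemma norm_mapSample_sub_le {N m n : ℕ} {f : RVec m → RVec n} {L : ℝ} (hL : 0 ≤ L)
    (hf : ∀ x y, ‖f x - f y‖ ≤ L * ‖x - y‖) (X Y : Sample N m) :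
    ‖mapSample f X - mapSample f Y‖ ≤ L * ‖X - Y‖ := by
  refine le_of_sq_le_sq ?_ (by positivity)
  rw [mul_pow, PiLp.norm_sq_eq_of_L2, PiLp.norm_sq_eq_of_L2, Finset.mul_sum]
  refine Finset.sum_le_sum fun i _ => ?_
  rw [← mul_pow]
  exact pow_le_pow_left₀ (norm_nonneg _) (hf _ _) 2

lemma norm_mapSample_le {N m n : ℕ} {f : RVec m → RVec n} {L : ℝ} (hL : 0 ≤ L)
    (hf : ∀ x, ‖f x‖ ≤ L * ‖x‖) (X : Sample N m) : ‖mapSample f X‖ ≤ L * ‖X‖ := by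
  refine le_of_sq_le_sq ?_ (by positivity)
  rw [mul_pow, PiLp.norm_sq_eq_of_L2, PiLp.norm_sq_eq_of_L2, Finset.mul_sum]
  refine Finset.sum_le_sum fun i _ => ?_
  rw [← mul_pow]
  exact pow_le_pow_left₀ (norm_nonneg _) (hf _) 2

/-- Row `i` of the data matrix, placed in output coordinate `j`. -/
def rowAtom {N m n : ℕ} (X : Sample N m) (p : Fin n × Fin m) : Sample N n :=
  WithLp.toLp 2 fun k => EuclideanSpace.single p.1 (X k p.2)

lemma norm_rowAtom {N m n : ℕ} (X : Sample N m) (p : Fin n × Fin m) :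
    ‖rowAtom X p‖ = √(∑ k, X k p.2 ^ 2) := by
  rw [PiLp.norm_eq_of_L2]
  simp [rowAtom]

/-- The atoms do not depend on the weights; the matrix entries are the coefficients to be
sparsified. -/
lemma mapSample_toEuclideanLin {N m n : ℕ} (A : Matrix (Fin n) (Fin m) ℝ) (X : Sample N m) :
    mapSample (Matrix.toEuclideanLin A) X = ∑ p : Fin n × Fin m, A p.1 p.2 • rowAtom X p := by
  ext k j
  simp only [mapSample_apply, Matrix.toLpLin_apply, Matrix.mulVec, dotProduct]
  rw [Fintype.sum_prod_type, WithLp.ofLp_sum, Finset.sum_apply, WithLp.ofLp_sum, Finset.sum_apply,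
    Finset.sum_eq_single j]
  · rw [WithLp.ofLp_sum, Finset.sum_apply, WithLp.ofLp_sum, Finset.sum_apply]
    simp [rowAtom]
  · intro b _ hb
    rw [WithLp.ofLp_sum, Finset.sum_apply, WithLp.ofLp_sum, Finset.sum_apply]
    simp [rowAtom, hb.symm]
  · simp

/-- Cauchy–Schwarz in each output coordinate. This is where the `(2,1)` norm becomes the weighted
`ℓ¹` norm of Maurey's lemma. -/
lemma sum_norm_rowAtom_le {N m n : ℕ} (A : Matrix (Fin n) (Fin m) ℝ) (X : Sample N m) :
    ∑ p : Fin n × Fin m, |A p.1 p.2| * ‖rowAtom X p‖ ≤ norm21 A.transpose * ‖X‖ := by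
  rw [Fintype.sum_prod_type, norm21, Finset.sum_mul]
  refine Finset.sum_le_sum fun j _ => ?_
  have h := Real.sum_mul_le_sqrt_mul_sqrt Finset.univ (fun i => |A j i|)
    (fun i => √(∑ k, X k i ^ 2))
  simp only [norm_rowAtom]
  refine h.trans_eq ?_
  congr 1
  · simp
  · rw [PiLp.norm_eq_of_L2]
    congr 1
    simp only [EuclideanSpace.norm_sq_eq, Real.norm_eq_abs, sq_abs]
    rw [Finset.sum_comm]
    exact Finset.sum_congr rfl fun i _ => Real.sq_sqrt (Finset.sum_nonneg fun k _ => sq_nonneg _)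

lemma norm_toEuclideanLin_le {m n : ℕ} (A : Matrix (Fin n) (Fin m) ℝ) (x : RVec m) :
    ‖Matrix.toEuclideanLin A x‖ ≤ specNorm A * ‖x‖ :=
  (Matrix.toEuclideanLin A).toContinuousLinearMap.le_opNorm x

lemma log_two_mul_sq_nonneg (D : ℕ) : 0 ≤ Real.log (2 * (D : ℝ) ^ 2) := by
  rcases Nat.eq_zero_or_pos D with rfl | h
  · simp
  · have : (1 : ℝ) ≤ D := by exact_mod_cast h
    exact Real.log_nonneg (by nlinarith)

/-- The covering number of one linear layer on a sample. -/
lemma LayerSpec.exists_cover {m n N D : ℕ} (ℓ : LayerSpec m n) (hm : m ≤ D) (hn : n ≤ D)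
    (X : Sample N m) {κ η : ℝ} (hκ : 0 ≤ κ) (hη : 0 ≤ η) (hb : η = 0 → ℓ.b = 0) :
    ∃ C : Finset (Sample N n), C.Nonempty ∧ (∀ c ∈ C, ‖c‖ ≤ ℓ.s * ‖X‖) ∧
      Real.log C.card ≤ 2 * Real.log (2 * (D : ℝ) ^ 2) * (κ * (ℓ.b * ‖X‖) / η) ^ 2 ∧
      ∀ A ∈ ℓ.weights, ∃ c ∈ C, κ * ‖mapSample (Matrix.toEuclideanLin A) X - c‖ ≤ η := by
  have hlog := log_two_mul_sq_nonneg D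
  set ρ := ℓ.s * ‖X‖ with hρ
  have hρ0 : 0 ≤ ρ := mul_nonneg ℓ.s_pos.le (norm_nonneg _)
  set W := ℓ.b * ‖X‖ with hW
  have hW0 : 0 ≤ W := mul_nonneg ℓ.b_nonneg (norm_nonneg _)
  set Z := mapSample (Matrix.toEuclideanLin ℓ.ref) X with hZ
  have hA : ∀ A ∈ ℓ.weights, ‖mapSample (Matrix.toEuclideanLin A) X‖ ≤ ρ := fun A hA =>
    norm_mapSample_le ℓ.s_pos.le (fun x => (norm_toEuclideanLin_le A x).trans
      (mul_le_mul_of_nonneg_right hA.1 (norm_nonneg _))) X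
  have hdec : ∀ A : Matrix (Fin n) (Fin m) ℝ, mapSample (Matrix.toEuclideanLin A) X
      = Z + ∑ p : Fin n × Fin m, (A - ℓ.ref) p.1 p.2 • rowAtom X p := by
    intro A
    rw [hZ, mapSample_toEuclideanLin, mapSample_toEuclideanLin, ← Finset.sum_add_distrib]
    refine Finset.sum_congr rfl fun p _ => ?_
    rw [← add_smul]
    simp
  have hl1 : ∀ A ∈ ℓ.weights,
      ∑ p : Fin n × Fin m, |(A - ℓ.ref) p.1 p.2| * ‖rowAtom X p‖ ≤ W := by
    intro A hA
    refine (sum_norm_rowAtom_le _ X).trans (mul_le_mul_of_nonneg_right ?_ (norm_nonneg _))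
    rw [Matrix.transpose_sub]
    exact hA.2
  -- Here the projected reference output alone suffices. In the other case `κ * W / η > 1`, so
  -- rounding the number of atoms up costs at most a factor 2.
  by_cases hsmall : κ * W ≤ η
  · refine ⟨{ballProj ρ Z}, by simp, ?_, ?_, fun A hA' => ⟨_, Finset.mem_singleton_self _, ?_⟩⟩
    · intro c hc
      rw [Finset.mem_singleton.1 hc]
      exact norm_ballProj_le hρ0 _
    · simp only [Finset.card_singleton, Nat.cast_one, Real.log_one]
      positivity
    · refine le_trans (mul_le_mul_of_nonneg_left ?_ hκ) hsmall
      refine (norm_sub_ballProj_le (hA A hA') Z).trans ?_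
      rw [hdec A, add_sub_cancel_left]
      refine (norm_sum_le _ _).trans (le_trans (le_of_eq ?_) (hl1 A hA'))
      exact Finset.sum_congr rfl fun p _ => by rw [norm_smul, Real.norm_eq_abs]
  · push Not at hsmall
    have hη0 : 0 < η := by
      refine lt_of_le_of_ne hη fun h => ?_
      rw [hW, hb h.symm] at hsmall
      simp only [zero_mul, mul_zero] at hsmall
      exact absurd hsmall (not_lt.2 hη)
    have hWp : 0 < W := by
      refine lt_of_le_of_ne hW0 fun h => ?_
      rw [← h, mul_zero] at hsmall
      exact absurd hsmall (not_lt.2 hη)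
    have hXne : X ≠ 0 := by
      rintro rfl
      simp [hW] at hWp
    have hmpos : 0 < m := by
      rcases Nat.eq_zero_or_pos m with rfl | h
      · exact absurd (Subsingleton.elim X 0) hXne
      · exact h
    rcases Nat.eq_zero_or_pos n with rfl | hnpos
    · refine ⟨{0}, by simp, by simpa using hρ0, ?_, fun A _ => ⟨0, by simp, ?_⟩⟩
      · simp only [Finset.card_singleton, Nat.cast_one, Real.log_one]
        positivity
      · rw [Subsingleton.elim (mapSample (Matrix.toEuclideanLin A) X - 0) 0]
        simpa using hη
    have : Nonempty (Fin n × Fin m) := ⟨(⟨0, hnpos⟩, ⟨0, hmpos⟩)⟩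
    set x := κ * W / η with hx
    have hx1 : 1 < x := by rwa [hx, one_lt_div hη0]
    set k := ⌈x ^ 2⌉₊ with hk
    have hkx : x ^ 2 ≤ k := Nat.le_ceil _
    have hk2 : (k : ℝ) ≤ 2 * x ^ 2 := by
      have := Nat.ceil_lt_add_one (sq_nonneg x)
      rw [← hk] at this
      nlinarith
    have hkpos : 0 < k := Nat.ceil_pos.2 (by positivity)
    have hk' : (0 : ℝ) < k := by exact_mod_cast hkpos
    let pt : (Fin k → (Fin n × Fin m) × Bool) → Sample N n := fun a =>
      ballProj ρ (Z + (k : ℝ)⁻¹ • ∑ j, signedAtom W (rowAtom X) (a j))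
    refine ⟨Finset.univ.image pt, Finset.univ_nonempty.image _, ?_, ?_, fun A hA' => ?_⟩
    · intro c hc
      obtain ⟨a, _, rfl⟩ := Finset.mem_image.1 hc
      exact norm_ballProj_le hρ0 _
    -- Each of the `k` atoms is one of `n * m` rows with one of two signs.
    · have h1 : ((Finset.univ.image pt).card : ℝ) ≤ (2 * (D : ℝ) ^ 2) ^ k := by
        have h2 : (Finset.univ.image pt).card ≤ (n * m * 2) ^ k := by
          refine Finset.card_image_le.trans_eq ?_
          simp
        have h3 : (n * m * 2) ^ k ≤ (2 * D ^ 2) ^ k := by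
          refine Nat.pow_le_pow_left ?_ k
          rw [sq]
          nlinarith [Nat.mul_le_mul hn hm]
        exact_mod_cast h2.trans h3
      have h0 : (0 : ℝ) < (Finset.univ.image pt).card := by
        exact_mod_cast Finset.card_pos.2 (Finset.univ_nonempty.image _)
      refine (Real.log_le_log h0 h1).trans ?_
      rw [Real.log_pow]
      nlinarith
    · obtain ⟨a, ha⟩ := exists_avg_near (fun p : Fin n × Fin m => (A - ℓ.ref) p.1 p.2)
        (rowAtom X) hWp (hl1 A hA') hkpos
      refine ⟨pt a, Finset.mem_image_of_mem _ (Finset.mem_univ _), ?_⟩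
      have h1 := norm_sub_ballProj_le (hA A hA')
        (Z + (k : ℝ)⁻¹ • ∑ j, signedAtom W (rowAtom X) (a j))
      rw [hdec A, add_sub_add_left_eq_sub, ← hdec A] at h1
      refine le_of_sq_le_sq ?_ hη
      rw [mul_pow]
      have h2 := pow_le_pow_left₀ (norm_nonneg _) h1 2
      have h3 : κ ^ 2 * (W ^ 2 / k) ≤ η ^ 2 := by
        rw [← mul_div_assoc, div_le_iff₀ hk']
        have : κ ^ 2 * W ^ 2 = x ^ 2 * η ^ 2 := by
          rw [hx]
          field_simp
        rw [this, mul_comm]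
        exact mul_le_mul_of_nonneg_left hkx (sq_nonneg _)
      exact (mul_le_mul_of_nonneg_left (h2.trans ha) (sq_nonneg κ)).trans h3

namespace Architecture

lemma le_width_left : ∀ {m p : ℕ} (a : Architecture m p), m ≤ a.width
  | _, _, nil _ => le_rfl
  | _, _, cons _ _ => le_max_left _ _

lemma lipProd_nonneg : ∀ {m p : ℕ} (a : Architecture m p), 0 ≤ a.lipProd
  | _, _, nil _ => zero_le_one
  | _, _, cons ℓ rest => mul_nonneg (by positivity) rest.lipProd_nonneg

lemma ratioSum_nonneg : ∀ {m p : ℕ} (a : Architecture m p), 0 ≤ a.ratioSum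
  | _, _, nil _ => le_rfl
  | _, _, cons ℓ rest => add_nonneg
      (Real.rpow_nonneg (div_nonneg ℓ.b_nonneg ℓ.s_pos.le) _) rest.ratioSum_nonneg

lemma complexity_nonneg {m p : ℕ} (a : Architecture m p) : 0 ≤ a.complexity :=
  mul_nonneg (mul_nonneg (log_two_mul_sq_nonneg _) a.lipProd_nonneg)
    (pow_nonneg a.ratioSum_nonneg 3)

lemma nets_lipschitz : ∀ {m p : ℕ} (a : Architecture m p), ∀ g ∈ a.nets, ∀ x y,
    ‖g x - g y‖ ≤ √a.lipProd * ‖x - y‖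
  | _, _, nil _, g, hg, x, y => by
      have hg' : g = id := hg
      simp [hg', lipProd]
  | _, _, cons ℓ rest, h, hh, x, y => by
      obtain ⟨A, hA, g, hg, rfl⟩ := hh
      have h1 := nets_lipschitz rest g hg (ℓ.act (Matrix.toEuclideanLin A x))
        (ℓ.act (Matrix.toEuclideanLin A y))
      have h2 := ℓ.act_lipschitz.dist_le_mul (Matrix.toEuclideanLin A x)
        (Matrix.toEuclideanLin A y)
      rw [dist_eq_norm, dist_eq_norm, ← map_sub] at h2
      have h3 := (norm_toEuclideanLin_le A (x - y)).trans
        (mul_le_mul_of_nonneg_right hA.1 (norm_nonneg _))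
      have hs := ℓ.s_pos.le
      have e : √(cons ℓ rest).lipProd = √rest.lipProd * (ℓ.lip * ℓ.s) := by
        rw [lipProd, ← mul_pow, mul_comm, Real.sqrt_mul rest.lipProd_nonneg,
          Real.sqrt_sq (mul_nonneg hs ℓ.lip.coe_nonneg), mul_comm ℓ.s]
      rw [e, mul_assoc, mul_assoc]
      refine h1.trans (mul_le_mul_of_nonneg_left (h2.trans ?_) (Real.sqrt_nonneg _))
      exact mul_le_mul_of_nonneg_left h3 ℓ.lip.2

/-- The covering number of a class of networks on a sample, with a free scale parameter. -/
theorem exists_cover {N D : ℕ} {θ : ℝ} (hθ : 0 < θ) : ∀ {m p : ℕ} (a : Architecture m p),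
    a.width ≤ D → ∀ X : Sample N m, ∃ C : Finset (Sample N p), C.Nonempty ∧
      Real.log C.card ≤ 2 * Real.log (2 * (D : ℝ) ^ 2) * ‖X‖ ^ 2 * a.lipProd * a.ratioSum / θ ^ 2 ∧
      ∀ g ∈ a.nets, ∃ c ∈ C, ‖mapSample g X - c‖ ≤ θ * a.ratioSum
  | _, _, nil n, _, X => by
      refine ⟨{X}, by simp, by simp [ratioSum], fun g hg => ⟨X, by simp, ?_⟩⟩
      have hg' : g = id := hg
      have : mapSample id X = X := rfl
      simp [hg', this, ratioSum]
  | m, p, cons (n := n) ℓ rest, hD, X => by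
      have hlog := log_two_mul_sq_nonneg D
      have hmD : m ≤ D := (le_max_left _ _).trans hD
      have hrD : rest.width ≤ D := (le_max_right _ _).trans hD
      have hnD : n ≤ D := rest.le_width_left.trans hrD
      have hs := ℓ.s_pos
      have hlip : (0 : ℝ) ≤ ℓ.lip := ℓ.lip.2
      -- The layer receives the error budget `θ q`. Its entropy is proportional to `(b / s)² / (θ
      -- q)² = q / θ²` if `q ≠ 0`. So errors and entropies both sum to multiples of the same
      -- `ratioSum`, and the exponent `2 / 3` is exactly what achieves this.
      set q : ℝ := (ℓ.b / ℓ.s) ^ (2 / 3 : ℝ) with hq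
      have hbs : 0 ≤ ℓ.b / ℓ.s := div_nonneg ℓ.b_nonneg hs.le
      have hq0 : 0 ≤ q := Real.rpow_nonneg hbs _
      have hq3 : q ^ 3 = (ℓ.b / ℓ.s) ^ 2 := by
        rw [hq, ← Real.rpow_natCast, ← Real.rpow_mul hbs, ← Real.rpow_natCast]
        norm_num
      set κ : ℝ := √rest.lipProd * ℓ.lip with hκ
      have hκ0 : 0 ≤ κ := mul_nonneg (Real.sqrt_nonneg _) hlip
      have hκ2 : κ ^ 2 = rest.lipProd * ℓ.lip ^ 2 := by
        rw [hκ, mul_pow, Real.sq_sqrt rest.lipProd_nonneg]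
      obtain ⟨C1, hC1ne, hC1n, hC1c, hC1⟩ := ℓ.exists_cover hmD hnD X hκ0
        (mul_nonneg hθ.le hq0) (by
          intro h
          have hq00 : q = 0 := by
            rcases mul_eq_zero.1 h with h | h
            · exact absurd h hθ.ne'
            · exact h
          rw [hq00] at hq3
          have h2 : ℓ.b / ℓ.s = 0 := by
            have : (ℓ.b / ℓ.s) ^ 2 = 0 := by rw [← hq3]; norm_num
            exact pow_eq_zero_iff (two_ne_zero) |>.1 this
          rcases div_eq_zero_iff.1 h2 with h | h
          · exact h
          · exact absurd h hs.ne')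
      have hIH : ∀ u : Sample N n, _ := fun u => exists_cover hθ rest hrD (mapSample ℓ.act u)
      choose C2 hC2ne hC2c hC2 using hIH
      set b2 : ℝ := 2 * Real.log (2 * (D : ℝ) ^ 2) * (ℓ.lip * (ℓ.s * ‖X‖)) ^ 2 * rest.lipProd
        * rest.ratioSum / θ ^ 2 with hb2
      have hcard2 : ∀ u ∈ C1, ((C2 u).card : ℝ) ≤ Real.exp b2 := by
        intro u hu
        have hpos : (0 : ℝ) < (C2 u).card := by exact_mod_cast Finset.card_pos.2 (hC2ne u)
        rw [← Real.log_le_iff_le_exp hpos]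
        refine (hC2c u).trans ?_
        rw [hb2]
        have h1 : ‖mapSample ℓ.act u‖ ≤ ℓ.lip * (ℓ.s * ‖X‖) := by
          refine (norm_mapSample_le hlip (fun x => ?_) u).trans
            (mul_le_mul_of_nonneg_left (hC1n u hu) hlip)
          have := ℓ.act_lipschitz.dist_le_mul x 0
          rwa [ℓ.act_zero, dist_zero_right, dist_zero_right] at this
        have h2 := pow_le_pow_left₀ (norm_nonneg _) h1 2
        have := rest.lipProd_nonneg
        have := rest.ratioSum_nonneg
        gcongr
      classical
      -- A cover of the first layer, refined at each centre `u` by a cover of the remaining network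
      -- with input `act u`. The norm bound on `u` makes the second entropy uniform.
      refine ⟨C1.biUnion C2, ?_, ?_, ?_⟩
      · obtain ⟨u, hu⟩ := hC1ne
        obtain ⟨w, hw⟩ := hC2ne u
        exact ⟨w, Finset.mem_biUnion.2 ⟨u, hu, hw⟩⟩
      · have h1 : ((C1.biUnion C2).card : ℝ) ≤ C1.card * Real.exp b2 := by
          have h2 : ((C1.biUnion C2).card : ℝ) ≤ ∑ u ∈ C1, ((C2 u).card : ℝ) := by
            exact_mod_cast Finset.card_biUnion_le
          refine h2.trans ((Finset.sum_le_sum hcard2).trans_eq ?_)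
          rw [Finset.sum_const, nsmul_eq_mul]
        have h0 : (0 : ℝ) < (C1.biUnion C2).card := by
          obtain ⟨u, hu⟩ := hC1ne
          obtain ⟨w, hw⟩ := hC2ne u
          exact_mod_cast Finset.card_pos.2 ⟨w, Finset.mem_biUnion.2 ⟨u, hu, hw⟩⟩
        have h3 : (C1.card : ℝ) ≠ 0 := by
          exact_mod_cast (Finset.card_pos.2 hC1ne).ne'
        refine (Real.log_le_log h0 h1).trans ?_
        rw [Real.log_mul h3 (Real.exp_pos _).ne', Real.log_exp]
        have h4 : (κ * (ℓ.b * ‖X‖) / (θ * q)) ^ 2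
            = ‖X‖ ^ 2 * (ℓ.s ^ 2 * ℓ.lip ^ 2 * rest.lipProd) * q / θ ^ 2 := by
          by_cases hq00 : q = 0
          · simp [hq00]
          · have hb : ℓ.b ^ 2 = q ^ 3 * ℓ.s ^ 2 := by
              rw [hq3]
              field_simp
            rw [div_pow, mul_pow κ, mul_pow ℓ.b, hκ2, hb]
            field_simp
        rw [h4] at hC1c
        refine (add_le_add_left hC1c b2).trans_eq ?_
        rw [hb2, ratioSum, lipProd, ← hq]
        ring
      · rintro _ ⟨A, hA, g, hg, rfl⟩
        obtain ⟨u, hu, hud⟩ := hC1 A hA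
        obtain ⟨w, hw, hwd⟩ := hC2 u g hg
        refine ⟨w, Finset.mem_biUnion.2 ⟨u, hu, hw⟩, ?_⟩
        set Y := mapSample (Matrix.toEuclideanLin A) X with hY
        have e : mapSample (fun x => g (ℓ.act (Matrix.toEuclideanLin A x))) X - w
            = (mapSample (fun x => g (ℓ.act x)) Y - mapSample (fun x => g (ℓ.act x)) u)
              + (mapSample g (mapSample ℓ.act u) - w) := by
          have e1 : mapSample (fun x => g (ℓ.act (Matrix.toEuclideanLin A x))) X
              = mapSample (fun x => g (ℓ.act x)) Y := rfl
          have e2 : mapSample (fun x => g (ℓ.act x)) u = mapSample g (mapSample ℓ.act u) := rfl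
          rw [e1, e2]
          abel
        rw [e, ratioSum, mul_add]
        refine (norm_add_le _ _).trans (add_le_add ?_ hwd)
        refine (norm_mapSample_sub_le hκ0 (fun x y => ?_) Y u).trans hud
        refine (nets_lipschitz rest g hg _ _).trans ?_
        rw [hκ, mul_assoc]
        refine mul_le_mul_of_nonneg_left ?_ (Real.sqrt_nonneg _)
        have := ℓ.act_lipschitz.dist_le_mul x y
        rwa [dist_eq_norm, dist_eq_norm] at this

/-- The covering number of a class of networks at scale `r` is at most
`exp (2 R ‖X‖² / r²)`. -/
theorem exists_cover_radius {N m p : ℕ} (a : Architecture m p) (X : Sample N m) {r : ℝ}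
    (hr : 0 < r) : ∃ C : Finset (Sample N p),
      Real.log C.card ≤ 2 * a.complexity * ‖X‖ ^ 2 / r ^ 2 ∧
      ∀ g ∈ a.nets, ∃ c ∈ C, ‖mapSample g X - c‖ ≤ r := by
  -- If the ratio sum vanishes, both the error and the entropy bound are zero for any scale
  -- parameter. Otherwise `θ = r / ratioSum` turns `ratioSum / θ²` into `ratioSum³ / r²`.
  rcases a.ratioSum_nonneg.eq_or_lt with h0 | h0
  · obtain ⟨C, _, hC1, hC2⟩ := exists_cover one_pos a le_rfl X
    refine ⟨C, ?_, fun g hg => ?_⟩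
    · rw [← h0] at hC1
      rw [complexity, ← h0]
      simpa using hC1
    · obtain ⟨c, hc, hcd⟩ := hC2 g hg
      refine ⟨c, hc, hcd.trans ?_⟩
      rw [← h0]
      linarith
  · obtain ⟨C, _, hC1, hC2⟩ := exists_cover (div_pos hr h0) a le_rfl X
    refine ⟨C, hC1.trans_eq ?_, fun g hg => ?_⟩
    · rw [complexity]
      field_simp
    · obtain ⟨c, hc, hcd⟩ := hC2 g hg
      refine ⟨c, hc, hcd.trans_eq ?_⟩
      field_simp

end Architecture

/-! ### Geometry of the simplex -/

lemma permVec_apply {K : ℕ} (π : Equiv.Perm (Fin K)) (v : RVec K) (k : Fin K) :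
    permVec π v k = v (π k) := by
  simp [permVec, Matrix.toLpLin_apply, Matrix.permMatrix_mulVec]

lemma permVec_sub {K : ℕ} (π : Equiv.Perm (Fin K)) (v w : RVec K) :
    permVec π v - permVec π w = permVec π (v - w) := by
  simp [permVec]

lemma norm_permVec {K : ℕ} (π : Equiv.Perm (Fin K)) (v : RVec K) : ‖permVec π v‖ = ‖v‖ := by
  rw [EuclideanSpace.norm_eq, EuclideanSpace.norm_eq]
  simp only [permVec_apply]
  rw [Equiv.sum_comp π fun k => ‖v k‖ ^ 2]

lemma continuous_permVec {K : ℕ} (π : Equiv.Perm (Fin K)) :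
    Continuous (permVec π : RVec K → RVec K) :=
  (Matrix.toEuclideanLin (π.permMatrix ℝ)).continuous_of_finiteDimensional

lemma permVec_mem_probSimplex {K : ℕ} (π : Equiv.Perm (Fin K)) {v : RVec K}
    (hv : v ∈ probSimplex K) : permVec π v ∈ probSimplex K := by
  refine ⟨fun k => ?_, ?_⟩
  · rw [permVec_apply]
    exact hv.1 _
  · simp only [permVec_apply]
    rw [Equiv.sum_comp π fun k => v k]
    exact hv.2

lemma le_one_of_mem_probSimplex {K : ℕ} {v : RVec K} (hv : v ∈ probSimplex K) (k : Fin K) :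
    v k ≤ 1 :=
  hv.2 ▸ Finset.single_le_sum (f := fun k => v k) (fun l _ => hv.1 l) (Finset.mem_univ k)

lemma isClosed_probSimplex {K : ℕ} : IsClosed (probSimplex K) := by
  have : probSimplex K = (⋂ k, {m : RVec K | 0 ≤ m k}) ∩ {m | ∑ k, m k = 1} := by
    ext m
    simp [probSimplex]
  rw [this]
  refine IsClosed.inter (isClosed_iInter fun k => isClosed_le continuous_const (by fun_prop)) ?_
  exact isClosed_eq (by fun_prop) continuous_const

lemma norm_sq_le_one_of_mem_probSimplex {K : ℕ} {v : RVec K} (hv : v ∈ probSimplex K) :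
    ‖v‖ ^ 2 ≤ 1 := by
  rw [EuclideanSpace.norm_sq_eq, ← hv.2]
  refine Finset.sum_le_sum fun k _ => ?_
  rw [Real.norm_eq_abs, sq_abs]
  nlinarith [hv.1 k, le_one_of_mem_probSimplex hv k]

lemma norm_le_one_of_mem_probSimplex {K : ℕ} {v : RVec K} (hv : v ∈ probSimplex K) :
    ‖v‖ ≤ 1 := by
  nlinarith [norm_sq_le_one_of_mem_probSimplex hv, norm_nonneg v]

lemma inner_eq_sum {K : ℕ} (u v : RVec K) : inner ℝ u v = ∑ k, u k * v k := by
  rw [PiLp.inner_apply]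
  refine Finset.sum_congr rfl fun k _ => ?_
  rw [real_inner_eq_re_inner]
  simp [mul_comm]

lemma inner_nonneg_of_mem_probSimplex {K : ℕ} {u v : RVec K} (hu : u ∈ probSimplex K)
    (hv : v ∈ probSimplex K) : 0 ≤ inner ℝ u v := by
  rw [inner_eq_sum]
  exact Finset.sum_nonneg fun k _ => mul_nonneg (hu.1 k) (hv.1 k)

lemma norm_sub_sq_le_two {K : ℕ} {u v : RVec K} (hu : u ∈ probSimplex K)
    (hv : v ∈ probSimplex K) : ‖u - v‖ ^ 2 ≤ 2 := by
  rw [norm_sub_sq_real]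
  linarith [norm_sq_le_one_of_mem_probSimplex hu, norm_sq_le_one_of_mem_probSimplex hv,
    inner_nonneg_of_mem_probSimplex hu hv]

lemma norm_sub_le_sqrt_two {K : ℕ} {u v : RVec K} (hu : u ∈ probSimplex K)
    (hv : v ∈ probSimplex K) : ‖u - v‖ ≤ √2 :=
  Real.le_sqrt_of_sq_le (norm_sub_sq_le_two hu hv)

/-- Factor the difference of squares; the mean of the two distances is at most the diameter bound
`√2`. -/
lemma abs_half_norm_sub_sq_sub_le {K : ℕ} {u v w : RVec K} (hu : u ∈ probSimplex K)
    (hv : v ∈ probSimplex K) (hw : w ∈ probSimplex K) :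
    |‖u - w‖ ^ 2 / 2 - ‖v - w‖ ^ 2 / 2| ≤ √2 * ‖u - v‖ := by
  have h1 := norm_sub_le_sqrt_two hu hw
  have h2 := norm_sub_le_sqrt_two hv hw
  have h3 : |‖u - w‖ - ‖v - w‖| ≤ ‖u - v‖ := by
    refine (abs_norm_sub_norm_le _ _).trans_eq ?_
    congr 1
    abel
  have h4 : ‖u - w‖ ^ 2 / 2 - ‖v - w‖ ^ 2 / 2
      = (‖u - w‖ - ‖v - w‖) * ((‖u - w‖ + ‖v - w‖) / 2) := by ring
  rw [h4, abs_mul, mul_comm (√2), abs_of_nonneg (a := (‖u - w‖ + ‖v - w‖) / 2) (by positivity)]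
  exact mul_le_mul h3 (by linarith) (by positivity) (norm_nonneg _)

/-! ### A data dependent uniform deviation bound for finite classes -/

section FiniteClass

variable {E ι : Type*} [Fintype ι] [Nonempty ι] {N : ℕ}

lemma abs_sum_update_sub_le {φ : Fin N → E → ℝ} (hφ : ∀ n x y, |φ n x - φ n y| ≤ 1)
    (X : Fin N → E) (i : Fin N) (y : E) :
    |∑ n, φ n (Function.update X i y n) - ∑ n, φ n (X n)| ≤ 1 := by
  rw [← Finset.sum_sub_distrib, Finset.sum_eq_single i]
  · simpa using hφ i y (X i)
  · intro n _ hn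
    simp [Function.update_of_ne hn]
  · simp

lemma abs_sub_le_one {a b : ℝ} (ha : 0 ≤ a ∧ a ≤ 1) (hb : 0 ≤ b ∧ b ≤ 1) : |a - b| ≤ 1 :=
  abs_le.2 ⟨by linarith [ha.1, hb.2], by linarith [ha.2, hb.1]⟩

lemma boundedDiff_empRad {h : ι → E → ℝ} (hb : ∀ i x, 0 ≤ h i x ∧ h i x ≤ 1) :
    BoundedDiff (fun X : Fin N → E => empRad h X) 1 := by
  intro X n y
  simp only [empRad]
  rw [← radAvg_sub]
  refine abs_radAvg_le fun σ => abs_fmax_sub_fmax_le fun i => ?_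
  refine abs_sum_update_sub_le (φ := fun n x => rsign (σ n) * h i x) (fun n x z => ?_) X n y
  rw [← mul_sub, abs_mul, abs_rsign, one_mul]
  exact abs_sub_le_one (hb _ _) (hb _ _)

variable [MeasurableSpace E]

/-- The Rademacher average is subtracted before concentrating. The difference has nonpositive mean
by symmetrization, so a single use of McDiarmid's inequality leaves the average of the actual sample
in the bound. -/
theorem measure_exists_lt_integral_le (μ : Measure E) [IsProbabilityMeasure μ] (hN : 0 < N)
    (h : ι → E → ℝ) (hm : ∀ i, Measurable (h i)) (hb : ∀ i x, 0 ≤ h i x ∧ h i x ≤ 1)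
    (V : (Fin N → E) → ℝ) (hV : ∀ X, empRad h X ≤ V X) {u : ℝ} (hu : 0 ≤ u) :
    Measure.pi (fun _ : Fin N => μ)
        {X | ∃ i, (∑ n, h i (X n) + 2 * V X) / N + u < ∫ x, h i x ∂μ}
      ≤ ENNReal.ofReal (Real.exp (-(2 * N * u ^ 2 / 9))) := by
  have hN' : (0 : ℝ) < N := by exact_mod_cast hN
  have hb1 : ∀ i x, |h i x| ≤ 1 := fun i x => by
    rw [abs_of_nonneg (hb i x).1]
    exact (hb i x).2
  set ν := Measure.pi fun _ : Fin N => μ with hν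
  let Φ : (Fin N → E) → ℝ := fun X => fmax fun i => ∑ n : Fin N, (∫ x, h i x ∂μ - h i (X n))
  have hΦm : Measurable Φ := measurable_fmax fun i => Finset.measurable_sum _ fun n _ =>
    ((hm i).comp (measurable_pi_apply n)).const_sub _
  have hΦb : ∀ X, |Φ X| ≤ N * 2 := fun X => abs_fmax_le fun i => abs_sum_le_card fun n => by
    refine (abs_sub _ _).trans ?_
    linarith [hb1 i (X n), abs_integral_le_of_abs_le (ν := μ) (hb1 i)]
  have hRm : Measurable fun X : Fin N → E => empRad h X := by
    simp only [empRad, radAvg]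
    exact (Finset.measurable_sum _ fun σ _ => measurable_signSum hm σ).div_const _
  have hRb : ∀ X : Fin N → E, |empRad h X| ≤ N * 1 := fun X =>
    abs_radAvg_le fun σ => abs_signSum_le hb1 σ X
  let Ψ : (Fin N → E) → ℝ := fun X => Φ X - 2 * empRad h X
  have hΨm : Measurable Ψ := hΦm.sub (hRm.const_mul 2)
  have hΨb : ∀ X, |Ψ X| ≤ N * 4 := fun X => by
    refine (abs_sub _ _).trans ?_
    rw [abs_mul, abs_of_pos (zero_lt_two' ℝ)]
    linarith [hΦb X, hRb X]
  -- One from the deviation and two from twice the Rademacher average.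
  have hΨd : BoundedDiff Ψ 3 := by
    intro X n y
    have h1 : |Φ (Function.update X n y) - Φ X| ≤ 1 := by
      refine abs_fmax_sub_fmax_le fun i => ?_
      refine abs_sum_update_sub_le (φ := fun n x => ∫ x, h i x ∂μ - h i x) (fun n x z => ?_) X n y
      rw [sub_sub_sub_cancel_left]
      exact abs_sub_le_one (hb _ _) (hb _ _)
    have h2 := boundedDiff_empRad hb X n y
    simp only [Ψ]
    rw [abs_le] at *
    constructor <;> linarith [h1.1, h1.2, h2.1, h2.2]
  have hmean : ∫ X, Ψ X ∂ν ≤ 0 := by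
    simp only [Ψ]
    rw [integral_sub (integrable_of_abs_le hΦm hΦb)
      ((integrable_of_abs_le hRm hRb).const_mul 2), integral_const_mul]
    have := integral_fmax_le_empRad (N := N) μ h hm hb1
    linarith
  have hmc := measure_ge_le_of_boundedDiff μ (c := 3) (by norm_num) hN hΨm ⟨_, hΨb⟩ hΨd
    (u := N * u) (by positivity)
  have e : 2 * ((N : ℝ) * u) ^ 2 / (N * 3 ^ 2) = 2 * N * u ^ 2 / 9 := by
    field_simp
    norm_num
  rw [e] at hmc
  refine (measure_mono ?_).trans hmc
  rintro X ⟨i, hi⟩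
  have h1 := le_fmax (fun i => ∑ n : Fin N, (∫ x, h i x ∂μ - h i (X n))) i
  simp only [Finset.sum_sub_distrib, Finset.sum_const, Finset.card_univ, Fintype.card_fin,
    nsmul_eq_mul] at h1
  have h2 := mul_lt_mul_of_pos_left hi hN'
  rw [mul_add, mul_div_cancel₀ _ hN'.ne'] at h2
  have h3 := hV X
  simp only [Set.mem_ofPred_eq, Ψ, Φ, Finset.sum_sub_distrib, Finset.sum_const, Finset.card_univ,
    Fintype.card_fin, nsmul_eq_mul]
  simp only [Ψ, Φ, Finset.sum_sub_distrib, Finset.sum_const, Finset.card_univ,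
    Fintype.card_fin, nsmul_eq_mul] at hmean
  linarith

end FiniteClass

/-! ### The generalization bound for network classes -/

/-- Half of the squared distance between the relabelled prediction and the target. -/
def halfSqLoss {d K : ℕ} (π : Equiv.Perm (Fin K)) (f g : RVec d → RVec K) (x : RVec d) : ℝ :=
  ‖permVec π (f x) - g x‖ ^ 2 / 2

lemma halfSqLoss_mem {d K : ℕ} (π : Equiv.Perm (Fin K)) {f g : RVec d → RVec K} {x : RVec d}
    (hf : f x ∈ probSimplex K) (hg : g x ∈ probSimplex K) :
    0 ≤ halfSqLoss π f g x ∧ halfSqLoss π f g x ≤ 1 := by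
  have := norm_sub_sq_le_two (permVec_mem_probSimplex π hf) hg
  unfold halfSqLoss
  exact ⟨by positivity, by linarith⟩

lemma frobNorm_dataMatrix {d N : ℕ} (X : Fin N → RVec d) :
    frobNorm (dataMatrix X) = ‖(WithLp.toLp 2 X : Sample N d)‖ := by
  rw [PiLp.norm_eq_of_L2, frobNorm, Finset.sum_comm]
  simp [dataMatrix, EuclideanSpace.norm_sq_eq]

lemma sampleError_eq {d K N : ℕ} (π : Equiv.Perm (Fin K)) (f g : RVec d → RVec K)
    (X : Fin N → RVec d) :
    sampleError π f g X = √(∑ n, ‖permVec π (f (X n)) - g (X n)‖ ^ 2) := by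
  rw [sampleError, frobNorm, Finset.sum_comm]
  congr 1
  refine Finset.sum_congr rfl fun n _ => ?_
  rw [EuclideanSpace.norm_sq_eq]
  refine Finset.sum_congr rfl fun k _ => ?_
  rw [Real.norm_eq_abs, sq_abs]
  congr 1

lemma ae_forall_mem {d N : ℕ} {P : Measure (RVec d)} [IsProbabilityMeasure P] {𝒳 : Set (RVec d)}
    (hP : ∀ᵐ x ∂P, x ∈ 𝒳) : ∀ᵐ X ∂(Measure.pi fun _ : Fin N => P), ∀ n, X n ∈ 𝒳 := by
  rw [ae_all_iff]
  intro n
  exact (Measure.quasiMeasurePreserving_eval (fun _ : Fin N => P) n).ae hP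

namespace NetworkClass

variable {d K : ℕ}

lemma R_nonneg (F : NetworkClass d K) : 0 ≤ F.R := F.arch.complexity_nonneg

lemma mem_probSimplex (F : NetworkClass d K) {f : RVec d → RVec K} (hf : f ∈ F.functions)
    (x : RVec d) : f x ∈ probSimplex K := by
  obtain ⟨g, _, rfl⟩ := hf
  exact F.out.mem_simplex _

lemma continuous_of_mem (F : NetworkClass d K) {f : RVec d → RVec K} (hf : f ∈ F.functions) :
    Continuous f := by
  obtain ⟨g, hg, rfl⟩ := hf
  refine F.out.lipschitz.continuous.comp ?_
  refine (LipschitzWith.of_dist_le_mul (K := ⟨√F.arch.lipProd, Real.sqrt_nonneg _⟩)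
    fun x y => ?_).continuous
  rw [dist_eq_norm, dist_eq_norm]
  exact F.arch.nets_lipschitz g hg x y

/-- The bound on the empirical Rademacher average obtained by chaining over `m` scales. -/
def chainBound {N : ℕ} (F : NetworkClass d K) (m : ℕ) (X : Fin N → RVec d) : ℝ :=
  N / 2 / 4 ^ m + m * (15 / 2 * (2 * √F.R * frobNorm (dataMatrix X)))

/-- The loss is `√2`-Lipschitz in the network output, because relabelling is an isometry and the
output layer is 1-Lipschitz. A network cover at scale `r / √2` thus gives a loss cover at scale `r`
with entropy `4 R ‖X‖² / r²`, that is, `B = 2 √R ‖X‖`. -/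
lemma empRad_halfSqLoss_le (F : NetworkClass d K) {N : ℕ} (hN : 0 < N) {ι : Type*} [Fintype ι]
    [Nonempty ι] (π : Equiv.Perm (Fin K)) (f : ι → RVec d → RVec K) (hf : ∀ i, f i ∈ F.functions)
    {g : RVec d → RVec K} (hg : ∀ x, g x ∈ probSimplex K) (m : ℕ) (X : Fin N → RVec d) :
    empRad (fun i => halfSqLoss π (f i) g) X ≤ F.chainBound m X := by
  rw [chainBound, frobNorm_dataMatrix]
  set S : Sample N d := WithLp.toLp 2 X with hS
  refine radAvg_fmax_le_of_cover hN
    (fun i => (WithLp.toLp 2 fun n => halfSqLoss π (f i) g (X n) : RVec N))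
    (fun i n => halfSqLoss_mem π (F.mem_probSimplex (hf i) _) (hg _)) (by positivity)
    (fun r hr => ?_) m
  obtain ⟨C, hC, hcov⟩ := F.arch.exists_cover_radius S (r := r / √2) (by positivity)
  classical
  let Ψ : Sample N K → RVec N := fun c =>
    WithLp.toLp 2 fun n => ‖permVec π (F.out.toFun (c n)) - g (X n)‖ ^ 2 / 2
  refine ⟨C.image Ψ, ?_, fun i => ?_⟩
  · have h1 : Real.log (C.image Ψ).card ≤ Real.log C.card := by
      rcases Nat.eq_zero_or_pos (C.image Ψ).card with h0 | h0
      · rw [h0]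
        simp only [Nat.cast_zero, Real.log_zero]
        exact Real.log_natCast_nonneg _
      · exact Real.log_le_log (by exact_mod_cast h0) (by exact_mod_cast Finset.card_image_le)
    refine (h1.trans hC).trans_eq ?_
    have hR := Real.sq_sqrt F.R_nonneg
    rw [div_pow, Real.sq_sqrt zero_le_two, mul_pow, mul_pow, hR, R]
    field_simp
  · obtain ⟨φ, hφ, hfi⟩ := hf i
    obtain ⟨c, hc, hcd⟩ := hcov φ hφ
    refine ⟨Ψ c, Finset.mem_image_of_mem _ hc, ?_⟩
    have h1 : ‖(WithLp.toLp 2 fun n => halfSqLoss π (f i) g (X n) : RVec N) - Ψ c‖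
        ≤ √2 * ‖mapSample φ S - c‖ := by
      refine le_of_sq_le_sq ?_ (by positivity)
      rw [mul_pow, EuclideanSpace.norm_sq_eq, PiLp.norm_sq_eq_of_L2, Finset.mul_sum]
      refine Finset.sum_le_sum fun n _ => ?_
      rw [← mul_pow]
      refine pow_le_pow_left₀ (norm_nonneg _) ?_ 2
      have h2 := abs_half_norm_sub_sq_sub_le
        (permVec_mem_probSimplex π (F.out.mem_simplex (φ (X n))))
        (permVec_mem_probSimplex π (F.out.mem_simplex (c n))) (hg (X n))
      have h3 := F.out.lipschitz.dist_le_mul (φ (X n)) (c n)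
      rw [NNReal.coe_one, one_mul, dist_eq_norm, dist_eq_norm] at h3
      rw [permVec_sub, norm_permVec] at h2
      have h4 := h2.trans (mul_le_mul_of_nonneg_left h3 (Real.sqrt_nonneg 2))
      simpa [halfSqLoss, hfi, Ψ, hS] using h4
    refine h1.trans ((mul_le_mul_of_nonneg_left hcd (Real.sqrt_nonneg 2)).trans_eq ?_)
    field_simp

/-- The deviation term for confidence `1 - δ / 4`. -/
def deviation (N : ℕ) (δ : ℝ) : ℝ := 3 * √(Real.log (4 / δ) / (2 * N))

lemma measure_finite_le (F : NetworkClass d K) {N : ℕ} (hN : 0 < N) {ι : Type*} [Fintype ι]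
    [Nonempty ι] (P : Measure (RVec d)) [IsProbabilityMeasure P]
    (π : Equiv.Perm (Fin K)) (f : ι → RVec d → RVec K) (hf : ∀ i, f i ∈ F.functions)
    {g : RVec d → RVec K} (hgm : Measurable g) (hg : ∀ x, g x ∈ probSimplex K) (m : ℕ)
    {δ : ℝ} (hδ : δ ∈ Set.Ioo (0 : ℝ) 1) :
    Measure.pi (fun _ : Fin N => P)
        {X | ∃ i, (∑ n, halfSqLoss π (f i) g (X n) + 2 * F.chainBound m X) / N + deviation N δ
          < ∫ x, halfSqLoss π (f i) g x ∂P} ≤ ENNReal.ofReal (δ / 4) := by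
  have hN' : (0 : ℝ) < N := by exact_mod_cast hN
  have hδ0 := hδ.1
  have hlog : 0 ≤ Real.log (4 / δ) := Real.log_nonneg (by
    rw [le_div_iff₀ hδ0]
    linarith [hδ.2])
  refine (measure_exists_lt_integral_le P hN (fun i => halfSqLoss π (f i) g) (fun i => ?_)
    (fun i x => halfSqLoss_mem π (F.mem_probSimplex (hf i) _) (hg _)) _
    (F.empRad_halfSqLoss_le hN π f hf hg m) (u := deviation N δ) ?_).trans_eq ?_
  · have := ((continuous_permVec π).comp (F.continuous_of_mem (hf i))).measurable
    exact ((this.sub hgm).norm.pow_const 2).div_const 2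
  · unfold deviation
    positivity
  · congr 1
    have : 2 * N * deviation N δ ^ 2 / 9 = Real.log (4 / δ) := by
      rw [deviation, mul_pow, Real.sq_sqrt (by positivity)]
      field_simp
      ring
    rw [this, Real.exp_neg, Real.exp_log (by positivity), inv_div]

lemma continuous_halfSqLoss (π : Equiv.Perm (Fin K)) (g : RVec d → RVec K) (x : RVec d) :
    Continuous fun f : C(RVec d, RVec K) => halfSqLoss π f g x := by
  unfold halfSqLoss
  have h1 : Continuous fun f : C(RVec d, RVec K) => permVec π (f x) :=
    (continuous_permVec π).comp (continuous_eval_const x)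
  fun_prop

/-- Both sides of the strict inequality are continuous in `f` for the topology of `C(RVec d, RVec
K)`, so a violation by some network is a violation by a member of a dense sequence. The events for
its initial segments increase and share the bound for finite classes. -/
theorem measure_exists_le (F : NetworkClass d K) (hne : F.functions.Nonempty) {N : ℕ} (hN : 0 < N)
    (P : Measure (RVec d)) [IsProbabilityMeasure P] (π : Equiv.Perm (Fin K))
    {g : RVec d → RVec K} (hgm : Measurable g) (hg : ∀ x, g x ∈ probSimplex K) (m : ℕ)
    {δ : ℝ} (hδ : δ ∈ Set.Ioo (0 : ℝ) 1) :
    Measure.pi (fun _ : Fin N => P)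
        {X | ∃ f ∈ F.functions,
          (∑ n, halfSqLoss π f g (X n) + 2 * F.chainBound m X) / N + deviation N δ
          < ∫ x, halfSqLoss π f g x ∂P} ≤ ENNReal.ofReal (δ / 4) := by
  let S : Set C(RVec d, RVec K) := {f | ⇑f ∈ F.functions}
  have hS : Nonempty S := by
    obtain ⟨f, hf⟩ := hne
    exact ⟨⟨⟨f, F.continuous_of_mem hf⟩, hf⟩⟩
  obtain ⟨u, hu⟩ := TopologicalSpace.exists_dense_seq S
  have hcont : Continuous fun f : S => ∫ x, halfSqLoss π f.1 g x ∂P := by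
    refine continuous_of_dominated (bound := fun _ => 1) (fun f => ?_) (fun f => ?_)
      (integrable_const _) (Eventually.of_forall fun x =>
        (continuous_halfSqLoss π g x).comp continuous_subtype_val)
    · have := ((continuous_permVec π).comp f.1.continuous).measurable
      exact (((this.sub hgm).norm.pow_const 2).div_const 2).aestronglyMeasurable
    · refine Eventually.of_forall fun x => ?_
      have := halfSqLoss_mem π (F.mem_probSimplex f.2 x) (hg x)
      rw [Real.norm_eq_abs, abs_of_nonneg this.1]
      exact this.2
  let A : ℕ → Set (Fin N → RVec d) := fun k => {X | ∃ i : Fin (k + 1),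
    (∑ n, halfSqLoss π (u i).1 g (X n) + 2 * F.chainBound m X) / N + deviation N δ
      < ∫ x, halfSqLoss π (u i).1 g x ∂P}
  have hA : Monotone A := by
    rintro k l hkl X ⟨i, hi⟩
    exact ⟨Fin.castLE (by omega) i, hi⟩
  have hsub : {X : Fin N → RVec d | ∃ f ∈ F.functions,
      (∑ n, halfSqLoss π f g (X n) + 2 * F.chainBound m X) / N + deviation N δ
        < ∫ x, halfSqLoss π f g x ∂P} ⊆ ⋃ k, A k := by
    rintro X ⟨f, hf, hlt⟩
    let U : Set S := {φ | (∑ n, halfSqLoss π φ.1 g (X n) + 2 * F.chainBound m X) / N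
      + deviation N δ < ∫ x, halfSqLoss π φ.1 g x ∂P}
    have hU : IsOpen U := by
      refine isOpen_lt ?_ hcont
      have : ∀ n, Continuous fun φ : S => halfSqLoss π φ.1 g (X n) := fun n =>
        (continuous_halfSqLoss π g (X n)).comp continuous_subtype_val
      fun_prop
    obtain ⟨k, hk⟩ := hu.exists_mem_open hU ⟨⟨⟨f, F.continuous_of_mem hf⟩, hf⟩, hlt⟩
    exact Set.mem_iUnion.2 ⟨k, Fin.last k, hk⟩
  refine (measure_mono hsub).trans ?_
  rw [hA.measure_iUnion]
  exact iSup_le fun k => F.measure_finite_le hN P π (fun i : Fin (k + 1) => (u i).1)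
    (fun i => (u i).2) hgm hg m hδ

/-- With about `log₁₆ N` scales, `4 ^ m` is of order `√N`, so the chaining remainder has the order
of the deviation term and is absorbed in it. -/
lemma chain_le_genBound (F : NetworkClass d K) (hK : 0 < K) {N : ℕ} (hN : 0 < N)
    (X : Fin N → RVec d) {δ : ℝ} (hδ : δ ∈ Set.Ioo (0 : ℝ) 1) {e : ℝ} (he : e ≤ 2) :
    2 / K * ((e + 2 * F.chainBound (Nat.log 16 N) X) / N + deviation N δ)
      ≤ genBound K F.R X δ := by
  have hN' : (0 : ℝ) < N := by exact_mod_cast hN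
  have hK' : (0 : ℝ) < K := by exact_mod_cast hK
  set m := Nat.log 16 N with hm
  set x := frobNorm (dataMatrix X) with hx
  have hx0 : 0 ≤ x := Real.sqrt_nonneg _
  set s := √(N : ℝ) with hs
  have hs0 : 0 < s := Real.sqrt_pos.2 hN'
  have hs2 : s ^ 2 = N := Real.sq_sqrt hN'.le
  have hδ0 := hδ.1
  set l := Real.log (4 / δ) with hl
  have hl4 : 2 * Real.log 2 ≤ l := by
    rw [hl, show 2 * Real.log 2 = Real.log 4 by
      rw [show (4 : ℝ) = 2 ^ 2 by norm_num, Real.log_pow]; norm_num]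
    refine Real.log_le_log (by norm_num) ?_
    rw [le_div_iff₀ hδ0]
    linarith [hδ.2]
  have hlog2 := Real.log_two_gt_d9
  have hl0 : 0 ≤ l := by linarith
  set a := √l with ha
  have ha0 : 0 ≤ a := Real.sqrt_nonneg _
  have ha2 : a ^ 2 = l := Real.sq_sqrt hl0
  set t := √(2 : ℝ) with ht
  have ht2 : t ^ 2 = 2 := Real.sq_sqrt zero_le_two
  have ht0 : 0 < t := Real.sqrt_pos.2 zero_lt_two
  -- From `log (4 / δ) ≥ log 4`: `25 * 2 * log 4 ≥ 64`. This pays for the chaining remainder `4 /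
  -- s`.
  have hat : 8 ≤ 5 * (t * a) := by
    refine le_of_sq_le_sq ?_ (by positivity)
    rw [mul_pow, mul_pow, ht2, ha2]
    nlinarith
  -- the number of scales
  have hm1 : (m : ℝ) * (4 * Real.log 2) ≤ Real.log N := by
    have h1 : (16 : ℕ) ^ m ≤ N := Nat.pow_log_le_self 16 hN.ne'
    have h2 : ((16 : ℝ)) ^ m ≤ N := by exact_mod_cast h1
    have h3 := Real.log_le_log (by positivity) h2
    rw [Real.log_pow, show (16 : ℝ) = 2 ^ 4 by norm_num, Real.log_pow] at h3
    exact_mod_cast h3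
  have hm2 : s ≤ 4 * 4 ^ m := by
    have h1 : N < 16 ^ (m + 1) := Nat.lt_pow_succ_log_self (by norm_num) N
    have h2 : (N : ℝ) < 16 ^ (m + 1) := by exact_mod_cast h1
    refine le_of_sq_le_sq ?_ (by positivity)
    rw [hs2, mul_pow, ← pow_mul, mul_comm m 2, pow_mul]
    rw [pow_succ] at h2
    norm_num at h2 ⊢
    linarith
  set r := √F.R with hr
  have hr0 : 0 ≤ r := Real.sqrt_nonneg _
  have eR : √(2 * F.R) = t * r := by rw [Real.sqrt_mul zero_le_two]
  have eL : √(2 * l / ((N : ℝ) * (K : ℝ) ^ 2)) = t * a / (s * K) := by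
    rw [Real.sqrt_div (by positivity), Real.sqrt_mul zero_le_two, Real.sqrt_mul hN'.le,
      Real.sqrt_sq hK'.le]
  have eD : deviation N δ = 3 * (t * a / (2 * s)) := by
    rw [deviation, ← hl, Real.sqrt_div hl0, Real.sqrt_mul zero_le_two]
    rw [← ht, ← ha, ← hs]
    field_simp
    rw [ht2]
  rw [genBound, ← hl, eR, eL, eD, chainBound, ← hr, ← hx]
  clear_value s a t l r x m
  have k1 : 2 / K * (e / N) ≤ 8 / ((N : ℝ) * K) := by
    rw [div_mul_div_comm, mul_comm (K : ℝ)]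
    gcongr
    linarith
  have k2 : 2 / K * (2 * (m * (15 / 2 * (2 * r * x))) / N)
      ≤ 12 * (t * r) * x * Real.log N / ((N : ℝ) * K * Real.log 2) := by
    have hlp : 0 < Real.log 2 := by linarith
    have e1 : 2 / K * (2 * (m * (15 / 2 * (2 * r * x))) / N) = 60 * m * (r * x) / (N * K) := by
      field_simp
      ring
    have e2 : 12 * (t * r) * x * Real.log N / ((N : ℝ) * K * Real.log 2)
        = 12 * t * (Real.log N / Real.log 2) * (r * x) / (N * K) := by
      field_simp
    rw [e1, e2]
    have h1 : 4 * (m : ℝ) ≤ Real.log N / Real.log 2 := by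
      rw [le_div_iff₀ hlp]
      linarith
    -- Since `4 m ≤ log N / log 2`, the chaining constant `60 m` is at most `15 log N / log 2`, and
    -- `15 = 12 * (5 / 4) ≤ 12 √2`.
    have h2 : 5 / 4 ≤ t := by nlinarith
    have h3 : 60 * (m : ℝ) ≤ 12 * t * (Real.log N / Real.log 2) := by
      have : (0 : ℝ) ≤ m := Nat.cast_nonneg _
      nlinarith [mul_le_mul h2 h1 (by positivity) ht0.le]
    gcongr
  have k3 : 2 / K * (2 * (N / 2 / 4 ^ m) / N + 3 * (t * a / (2 * s)))
      ≤ 8 * (t * a / (s * K)) := by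
    have h1 : 2 * ((N : ℝ) / 2 / 4 ^ m) / N ≤ 4 / s := by
      rw [show 2 * ((N : ℝ) / 2 / 4 ^ m) / N = 1 / 4 ^ m by field_simp,
        div_le_div_iff₀ (by positivity) hs0]
      linarith
    have e2 : 8 * (t * a / (s * K)) = 2 / K * (4 * (t * a) / s) := by
      field_simp
      ring
    rw [e2]
    refine mul_le_mul_of_nonneg_left ?_ (by positivity)
    have e3 : 4 * (t * a) / s = 5 * (t * a) / (2 * s) + 3 * (t * a / (2 * s)) := by
      field_simp
      ring
    have h2 : 4 / s ≤ 5 * (t * a) / (2 * s) := by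
      rw [div_le_div_iff₀ hs0 (by positivity)]
      have := mul_le_mul_of_nonneg_right hat hs0.le
      linarith
    rw [e3]
    exact add_le_add (h1.trans h2) le_rfl
  calc _ = 2 / K * (e / N) + 2 / K * (2 * (m * (15 / 2 * (2 * r * x))) / N)
        + 2 / K * (2 * (N / 2 / 4 ^ m) / N + 3 * (t * a / (2 * s))) := by ring
    _ ≤ _ := add_le_add (add_le_add k1 k2) k3

/-- With high probability over the samples, every network of the class that is close to the
target on the samples satisfies the generalization bound. -/
theorem measure_genBound_lt_le (F : NetworkClass d K) (hne : F.functions.Nonempty) {N : ℕ}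
    (hN : 0 < N) (P : Measure (RVec d)) [IsProbabilityMeasure P] {𝒳 : Set (RVec d)}
    (hP : ∀ᵐ x ∂P, x ∈ 𝒳) {g : RVec d → RVec K} (hgm : Measurable g)
    (hg : ∀ x ∈ 𝒳, g x ∈ probSimplex K) (π : Equiv.Perm (Fin K))
    {δ : ℝ} (hδ : δ ∈ Set.Ioo (0 : ℝ) 1) :
    Measure.pi (fun _ : Fin N => P)
        {X | ∃ f ∈ F.functions, sampleError π f g X ≤ 2 ∧
          genBound K F.R X δ < expectedError P π f g} ≤ ENNReal.ofReal (δ / 4) := by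
  classical
  have hN' : (0 : ℝ) < N := by exact_mod_cast hN
  obtain ⟨x0, hx0⟩ := hP.exists
  have hK : 0 < K := by
    rcases Nat.eq_zero_or_pos K with rfl | h
    · have := (hg x0 hx0).2
      simp at this
    · exact h
  have hK' : (0 : ℝ) < K := by exact_mod_cast hK
  -- The target is changed off `𝒳` only, so that the loss is bounded by 1 everywhere and not just
  -- almost everywhere.
  let g0 : RVec d → RVec K := fun x => if g x ∈ probSimplex K then g x else g x0
  have hg0m : Measurable g0 := Measurable.ite (hgm isClosed_probSimplex.measurableSet) hgm measurable_const
  have hg0 : ∀ x, g0 x ∈ probSimplex K := by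
    intro x
    simp only [g0]
    split_ifs with h
    · exact h
    · exact hg x0 hx0
  have hgg : ∀ x ∈ 𝒳, g0 x = g x := fun x hx => if_pos (hg x hx)
  have h1 := F.measure_exists_le hne hN P π hg0m hg0 (Nat.log 16 N) hδ
  refine le_trans (measure_mono_ae ?_) h1
  filter_upwards [ae_forall_mem hP] with X hX
  rintro ⟨f, hf, hs, hlt⟩
  refine ⟨f, hf, ?_⟩
  have e1 : ∑ n, halfSqLoss π f g0 (X n) = sampleError π f g X ^ 2 / 2 := by
    rw [sampleError_eq, Real.sq_sqrt (Finset.sum_nonneg fun n _ => sq_nonneg _), Finset.sum_div]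
    refine Finset.sum_congr rfl fun n _ => ?_
    rw [halfSqLoss, hgg _ (hX n)]
  have e2 : expectedError P π f g = 2 / K * ∫ x, halfSqLoss π f g0 x ∂P := by
    rw [expectedError, ← integral_const_mul]
    refine integral_congr_ae ?_
    filter_upwards [hP] with x hx
    rw [halfSqLoss, hgg x hx]
    ring
  have h0 : 0 ≤ sampleError π f g X := Real.sqrt_nonneg _
  have h2 := (F.chain_le_genBound hK hN X hδ (e := ∑ n, halfSqLoss π f g0 (X n))
    (by rw [e1]; nlinarith)).trans_lt hlt
  rw [e2] at h2
  exact lt_of_mul_lt_mul_left h2 (by positivity)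

end NetworkClass

/-! ### Identifiability under the sufficiently scattered condition -/

section Identifiability

variable {K N : ℕ}

lemma mem_scatterCone_of_sq_le {x : RVec K} (hK : 0 < K) (h0 : 0 ≤ ∑ k, x k)
    (h : ((K : ℝ) - 1) * ∑ k, x k ^ 2 ≤ (∑ k, x k) ^ 2) : x ∈ scatterCone K := by
  have hK' : (1 : ℝ) ≤ K := by exact_mod_cast hK
  have key : √((K : ℝ) - 1) * ‖x‖ ≤ ∑ k, x k := by
    refine le_of_sq_le_sq ?_ h0
    rw [mul_pow, Real.sq_sqrt (by linarith), EuclideanSpace.norm_sq_eq]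
    simpa only [Real.norm_eq_abs, sq_abs] using h
  exact key

lemma ones_mem_scatterCone (k : Fin K) : (WithLp.toLp 2 fun _ => 1 : RVec K) ∈ scatterCone K := by
  refine mem_scatterCone_of_sq_le k.pos (by simp) ?_
  simp
  nlinarith [Nat.cast_nonneg (α := ℝ) K]

lemma ones_add_single_mem_scatterCone (k : Fin K) :
    (WithLp.toLp 2 (fun l => 1 + (Pi.single k 1 : Fin K → ℝ) l) : RVec K) ∈ scatterCone K := by
  have hsum : ∑ l, (1 + (Pi.single k 1 : Fin K → ℝ) l) = K + 1 := by
    simp [Finset.sum_add_distrib]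
  have hsq : ∑ l : Fin K, (1 + (Pi.single k 1 : Fin K → ℝ) l) ^ (2 : ℕ) = (K : ℝ) + 3 := by
    have : ∀ l, (1 + (Pi.single k 1 : Fin K → ℝ) l) ^ 2
        = 1 + 3 * (Pi.single k 1 : Fin K → ℝ) l := by
      intro l
      by_cases h : l = k
      · subst h
        simp
        norm_num
      · simp [h]
    simp only [this, Finset.sum_add_distrib, ← Finset.mul_sum]
    simp
  refine mem_scatterCone_of_sq_le k.pos ?_ ?_
  · refine hsum.symm.le.trans' ?_
    positivity
  · refine (congrArg _ hsq).le.trans (le_of_le_of_eq ?_ (congrArg (· ^ 2) hsum).symm)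
    nlinarith [Nat.cast_nonneg (α := ℝ) K]

lemma submatrix_eq_mul (A : Matrix (Fin K) (Fin N) ℝ) (J : Finset (Fin N)) :
    A.submatrix id (Subtype.val : {n // n ∈ J} → Fin N)
      = A * (1 : Matrix (Fin N) (Fin N) ℝ).submatrix id (Subtype.val : {n // n ∈ J} → Fin N) := by
  ext k i
  simp [Matrix.mul_apply, Matrix.one_apply]

/-- The cone contains the all-ones vector and its sum with each unit vector. Their differences put
every unit vector in the column span. -/
lemma exists_right_inverse_of_scattered {A : Matrix (Fin K) (Fin N) ℝ} {J : Finset (Fin N)}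
    (h : scatterCone K ⊆ colCone (A.submatrix id (Subtype.val : {n // n ∈ J} → Fin N))) :
    ∃ B : Matrix (Fin N) (Fin K) ℝ, A * B = 1 := by
  have hrange : ∀ y ∈ scatterCone K, ∃ θ : Fin N → ℝ, A.mulVec θ = y.ofLp := by
    intro y hy
    obtain ⟨θ, _, rfl⟩ := h hy
    rw [submatrix_eq_mul]
    exact ⟨_, Matrix.mulVec_mulVec _ _ _⟩
  have hk : ∀ k : Fin K, ∃ θ : Fin N → ℝ, A.mulVec θ = Pi.single k 1 := by
    intro k
    obtain ⟨θ1, h1⟩ := hrange _ (ones_mem_scatterCone k)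
    obtain ⟨θ2, h2⟩ := hrange _ (ones_add_single_mem_scatterCone k)
    refine ⟨θ2 - θ1, ?_⟩
    rw [Matrix.mulVec_sub, h1, h2]
    ext l
    simp
  choose θ hθ using hk
  refine ⟨Matrix.of fun n k => θ k n, ?_⟩
  ext l k
  have := congrFun (hθ k) l
  rw [Matrix.mul_apply]
  simp only [Matrix.mulVec, dotProduct] at this
  simp only [Matrix.of_apply, this, Matrix.one_apply, Pi.single_apply]

lemma eq_of_transpose_mul_self_eq_zero {m n : ℕ} {C : Matrix (Fin m) (Fin n) ℝ}
    (h : C.transpose * C = 0) : C = 0 := by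
  ext i j
  have h1 := congrFun (congrFun h j) j
  simp only [Matrix.mul_apply, Matrix.transpose_apply, Matrix.zero_apply] at h1
  rw [Finset.sum_eq_zero_iff_of_nonneg fun i _ => mul_self_nonneg _] at h1
  simpa using h1 i (Finset.mem_univ i)

/-- A sufficiently scattered matrix is determined by its Gram matrix among the nonnegative
matrices, up to a permutation of the rows. -/
theorem SufficientlyScattered.exists_perm {A B : Matrix (Fin K) (Fin N) ℝ}
    (hA : SufficientlyScattered A) (hB : ∀ k n, 0 ≤ B k n)
    (hG : B.transpose * B = A.transpose * A) :
    ∃ π : Equiv.Perm (Fin K), π.permMatrix ℝ * B = A := by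
  obtain ⟨J, hJ, hQ⟩ := hA
  obtain ⟨R, hR⟩ := exists_right_inverse_of_scattered hJ
  -- Equality of the Gram matrices makes `Q` orthogonal with `Q * A = B`. Hence `A = Qᵀ B` with `B ≥
  -- 0`, so the selected columns of `A` lie in the cone of `Qᵀ` and the second half of the SSC
  -- applies to `Qᵀ`.
  set Q := B * R with hQdef
  have hQQ : Q.transpose * Q = 1 := by
    rw [hQdef, Matrix.transpose_mul, Matrix.mul_assoc, ← Matrix.mul_assoc B.transpose, hG,
      Matrix.mul_assoc A.transpose, hR, Matrix.mul_one, ← Matrix.transpose_mul, hR,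
      Matrix.transpose_one]
  have hQA : Q * A = B := by
    rw [← sub_eq_zero]
    apply eq_of_transpose_mul_self_eq_zero
    have e : Q * A - B = B * (R * A - 1) := by
      rw [hQdef, Matrix.mul_sub, Matrix.mul_one, Matrix.mul_assoc]
    have e2 : A * (R * A - 1) = 0 := by
      rw [Matrix.mul_sub, Matrix.mul_one, ← Matrix.mul_assoc, hR, Matrix.one_mul, sub_self]
    rw [e, Matrix.transpose_mul, Matrix.mul_assoc, ← Matrix.mul_assoc B.transpose, hG,
      Matrix.mul_assoc A.transpose, e2, Matrix.mul_zero, Matrix.mul_zero]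
  obtain ⟨π, hπ⟩ := hQ Q.transpose (by
      rw [Matrix.mem_orthogonalGroup_iff]
      simpa using hQQ) (by
    rintro _ ⟨θ, hθ, rfl⟩
    refine ⟨(B.submatrix id (Subtype.val : {n // n ∈ J} → Fin N)).mulVec θ, fun k => ?_, ?_⟩
    · simp only [Matrix.mulVec, dotProduct]
      exact Finset.sum_nonneg fun i _ => mul_nonneg (hB _ _) (hθ i)
    · congr 1
      rw [submatrix_eq_mul B, ← hQA, Matrix.mulVec_mulVec, ← Matrix.mul_assoc, ← Matrix.mul_assoc,
        hQQ, Matrix.one_mul, ← submatrix_eq_mul])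
  refine ⟨π, ?_⟩
  rw [← hπ, ← hQA, ← Matrix.mul_assoc, hQQ, Matrix.one_mul]

/-! ### Stability of the identification -/

lemma isCompact_probSimplex : IsCompact (probSimplex K) := by
  refine (isCompact_closedBall (0 : RVec K) 1).of_isClosed_subset isClosed_probSimplex fun v hv => ?_
  rw [mem_closedBall_zero_iff]
  exact norm_le_one_of_mem_probSimplex hv

/-- The distance of two families of vectors after relabelling the coordinates of the first. -/
def relabelDist (π : Equiv.Perm (Fin K)) (v u : Fin N → RVec K) : ℝ :=
  √(∑ n, ‖permVec π (v n) - u n‖ ^ 2)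

lemma continuous_relabelDist (π : Equiv.Perm (Fin K)) :
    Continuous fun p : (Fin N → RVec K) × (Fin N → RVec K) => relabelDist π p.1 p.2 := by
  unfold relabelDist
  have h : ∀ n, Continuous fun p : (Fin N → RVec K) × (Fin N → RVec K) => permVec π (p.1 n) :=
    fun n => (continuous_permVec π).comp ((continuous_apply n).comp continuous_fst)
  fun_prop

/-- The memberships in the simplex whose Gram matrix is within `η` of that of `u` but that stay at
distance `ε` from `u` under every relabelling. -/
def ambiguities (ε η : ℝ) (u : Fin N → RVec K) : Set (Fin N → RVec K) :=
  {v | (∀ n, v n ∈ probSimplex K) ∧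
    (∀ i j, |inner ℝ (v i) (v j) - inner ℝ (u i) (u j)| ≤ η) ∧ ∀ π, ε ≤ relabelDist π v u}

/-- The memberships that are not identified up to `ε` by their Gram matrix up to `η`. -/
def ambiguous (K N : ℕ) (ε η : ℝ) : Set (Fin N → RVec K) := {u | (ambiguities ε η u).Nonempty}

lemma isClosed_setOf_gram_le (η : ℝ) :
    IsClosed {p : (Fin N → RVec K) × (Fin N → RVec K) |
      ∀ i j, |inner ℝ (p.1 i) (p.1 j) - inner ℝ (p.2 i) (p.2 j)| ≤ η} := by
  simp only [Set.ofPred_forall]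
  refine isClosed_iInter fun i => isClosed_iInter fun j => isClosed_le ?_ continuous_const
  fun_prop

lemma isClosed_setOf_le_relabelDist (ε : ℝ) :
    IsClosed {p : (Fin N → RVec K) × (Fin N → RVec K) | ∀ π, ε ≤ relabelDist π p.1 p.2} := by
  simp only [Set.ofPred_forall]
  exact isClosed_iInter fun π => isClosed_le continuous_const (continuous_relabelDist π)

lemma isCompact_ambiguities (ε η : ℝ) (u : Fin N → RVec K) : IsCompact (ambiguities ε η u) := by
  have hc : IsCompact (Set.univ.pi fun _ : Fin N => probSimplex K) :=
    isCompact_univ_pi fun _ => isCompact_probSimplex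
  have hcl := ((isClosed_setOf_gram_le (K := K) (N := N) η).inter
    (isClosed_setOf_le_relabelDist ε)).preimage
    (show Continuous fun v : Fin N → RVec K => (v, u) by fun_prop)
  convert hc.inter_right hcl using 1
  ext v
  simp [ambiguities]

/-- A projection along the compact factor of witnesses `v` is a closed map. Closedness supplies the
measurability needed for random samples. -/
lemma isClosed_ambiguous (ε η : ℝ) : IsClosed (ambiguous K N ε η) := by
  have hc : CompactSpace ↥(Set.univ.pi fun _ : Fin N => probSimplex K) :=
    isCompact_iff_compactSpace.1 (isCompact_univ_pi fun _ => isCompact_probSimplex)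
  have hcl := ((isClosed_setOf_gram_le (K := K) (N := N) η).inter
    (isClosed_setOf_le_relabelDist ε)).preimage
    (show Continuous fun p : ↥(Set.univ.pi fun _ : Fin N => probSimplex K) × (Fin N → RVec K) =>
      (p.1.1, p.2) by fun_prop)
  have := isClosedMap_snd_of_compactSpace _ hcl
  convert this using 1
  ext u
  constructor
  · rintro ⟨v, hv, h1, h2⟩
    exact ⟨(⟨v, fun n _ => hv n⟩, u), ⟨h1, h2⟩, rfl⟩
  · rintro ⟨⟨v, u'⟩, ⟨h1, h2⟩, rfl⟩
    exact ⟨v.1, fun n => v.2 n (Set.mem_univ n), h1, h2⟩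

lemma ambiguities_mono {ε η η' : ℝ} (h : η ≤ η') (u : Fin N → RVec K) :
    ambiguities ε η u ⊆ ambiguities ε η' u :=
  fun _ hv => ⟨hv.1, fun i j => (hv.2.1 i j).trans h, hv.2.2⟩

lemma ambiguous_antitone (ε : ℝ) : Antitone fun n : ℕ => ambiguous K N ε (1 / ((n : ℝ) + 1)) := by
  intro n m hnm u hu
  exact hu.mono (ambiguities_mono (Nat.one_div_le_one_div hnm) u)

/-- Cantor's intersection theorem for the nested compact sets of witnesses yields one witness for
all tolerances, hence for tolerance zero. -/
lemma iInter_ambiguous_subset (ε : ℝ) :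
    ⋂ n : ℕ, ambiguous K N ε (1 / ((n : ℝ) + 1)) ⊆ ambiguous K N ε 0 := by
  intro u hu
  rw [Set.mem_iInter] at hu
  obtain ⟨v, hv⟩ := IsCompact.nonempty_iInter_of_sequence_nonempty_isCompact_isClosed
    (fun n : ℕ => ambiguities ε (1 / ((n : ℝ) + 1)) u)
    (fun n => ambiguities_mono (Nat.one_div_le_one_div n.le_succ) u) hu
    (isCompact_ambiguities _ _ _) fun n => (isCompact_ambiguities _ _ _).isClosed
  rw [Set.mem_iInter] at hv
  refine ⟨v, (hv 0).1, fun i j => ?_, (hv 0).2.2⟩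
  refine ge_of_tendsto' tendsto_one_div_add_atTop_nhds_zero_nat fun n => (hv n).2.1 i j

lemma SufficientlyScattered.notMem_ambiguous {d : ℕ} {f : RVec d → RVec K} {X : Fin N → RVec d}
    (h : SufficientlyScattered (membershipMatrix f X)) {ε : ℝ} (hε : 0 < ε) :
    (fun n => f (X n)) ∉ ambiguous K N ε 0 := by
  rintro ⟨v, hv, hG, hd⟩
  obtain ⟨π, hπ⟩ := h.exists_perm (B := Matrix.of fun k n => v n k) (fun k n => (hv n).1 k) (by
    ext i j
    have := sub_eq_zero.1 (abs_nonpos_iff.1 (hG i j))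
    rw [inner_eq_sum, inner_eq_sum] at this
    simpa [Matrix.mul_apply, membershipMatrix] using this)
  have h0 : relabelDist π v (fun n => f (X n)) = 0 := by
    rw [relabelDist, Real.sqrt_eq_zero']
    refine (Finset.sum_eq_zero fun n _ => ?_).le
    have : permVec π (v n) = f (X n) := by
      ext k
      have := congrFun (congrFun hπ k) n
      rw [Matrix.mul_apply] at this
      simpa [permVec, Matrix.toLpLin_apply, Matrix.mulVec, dotProduct, membershipMatrix] using this
    simp [this]
  linarith [hd π]

end Identifiability

/-! ### Concentration of the annotation frequencies -/

section Annotations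

variable {d K N : ℕ}

/-- The probability of an annotation, given its pair. -/
def labelProb (f : RVec d → RVec K) (X : Fin N → RVec d) (a : Annotation N) : ℝ :=
  bif a.2 then similarity f X a.1 else 1 - similarity f X a.1

/-- The law of a single annotation. -/
def singleLaw (f : RVec d → RVec K) (X : Fin N → RVec d) : Measure (Annotation N) :=
  Measure.count.withDensity fun a => ENNReal.ofReal (1 / (N : ℝ) ^ 2 * labelProb f X a)

lemma count_withDensity_singleton {α : Type*} [MeasurableSpace α] [MeasurableSingletonClass α]
    (w : α → ENNReal) (a : α) : Measure.count.withDensity w {a} = w a := by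
  rw [withDensity_apply _ (measurableSet_singleton a), lintegral_singleton]
  simp

lemma labelProb_nonneg {f : RVec d → RVec K} {X : Fin N → RVec d}
    (h : ∀ p, 0 ≤ similarity f X p ∧ similarity f X p ≤ 1) (a : Annotation N) :
    0 ≤ labelProb f X a := by
  unfold labelProb
  cases a.2
  · simpa using (h a.1).2
  · simpa using (h a.1).1

lemma labelProb_le_one {f : RVec d → RVec K} {X : Fin N → RVec d}
    (h : ∀ p, 0 ≤ similarity f X p ∧ similarity f X p ≤ 1) (a : Annotation N) :
    labelProb f X a ≤ 1 := by
  unfold labelProb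
  cases a.2
  · simpa using (h a.1).1
  · simpa using (h a.1).2

lemma sum_labelProb (hN : 0 < N) (f : RVec d → RVec K) (X : Fin N → RVec d) :
    ∑ a, 1 / (N : ℝ) ^ 2 * labelProb f X a = 1 := by
  have hN' : (0 : ℝ) < N := by exact_mod_cast hN
  rw [← Finset.mul_sum, Fintype.sum_prod_type]
  simp only [Fintype.univ_bool, labelProb]
  simp
  field_simp

lemma isProbabilityMeasure_singleLaw (hN : 0 < N) {f : RVec d → RVec K} {X : Fin N → RVec d}
    (h : ∀ p, 0 ≤ similarity f X p ∧ similarity f X p ≤ 1) :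
    IsProbabilityMeasure (singleLaw f X) := by
  refine ⟨?_⟩
  rw [singleLaw, withDensity_apply _ MeasurableSet.univ, setLIntegral_univ, lintegral_count,
    tsum_fintype, ← ENNReal.ofReal_sum_of_nonneg, sum_labelProb hN, ENNReal.ofReal_one]
  exact fun a _ => mul_nonneg (by positivity) (labelProb_nonneg h a)

lemma annotationLaw_eq_pi (hN : 0 < N) {f : RVec d → RVec K} {X : Fin N → RVec d}
    (h : ∀ p, 0 ≤ similarity f X p ∧ similarity f X p ≤ 1) (M : ℕ) :
    annotationLaw f X M = Measure.pi fun _ : Fin M => singleLaw f X := by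
  have := isProbabilityMeasure_singleLaw hN h
  refine Measure.ext_of_singleton fun S => ?_
  rw [annotationLaw, count_withDensity_singleton, Measure.pi_singleton]
  simp only [singleLaw, count_withDensity_singleton]
  rfl

/-- The number of occurrences of an annotation. -/
def occurrences {M : ℕ} (S : Fin M → Annotation N) (a : Annotation N) : ℝ :=
  ∑ m, if S m = a then 1 else 0

/-- The annotations whose empirical frequencies deviate by at least `κ` from the probabilities. -/
def atypical (f : RVec d → RVec K) (X : Fin N → RVec d) (M : ℕ) (κ : ℝ) :
    Set (Fin M → Annotation N) :=
  {S | ∃ a, κ ≤ |occurrences S a / M - 1 / (N : ℝ) ^ 2 * labelProb f X a|}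

lemma integral_occurrences (hN : 0 < N) {f : RVec d → RVec K} {X : Fin N → RVec d}
    (h : ∀ p, 0 ≤ similarity f X p ∧ similarity f X p ≤ 1) (M : ℕ) (a : Annotation N) :
    ∫ S, occurrences S a ∂(Measure.pi fun _ : Fin M => singleLaw f X)
      = M * (1 / (N : ℝ) ^ 2 * labelProb f X a) := by
  have := isProbabilityMeasure_singleLaw hN h
  have h1 : ∫ b, (if b = a then (1 : ℝ) else 0) ∂(singleLaw f X)
      = 1 / (N : ℝ) ^ 2 * labelProb f X a := by
    have : (fun b => if b = a then (1 : ℝ) else 0) = Set.indicator {a} 1 := by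
      ext b
      simp [Set.indicator_apply]
    rw [this, integral_indicator_one (measurableSet_singleton a), Measure.real, singleLaw,
      count_withDensity_singleton, ENNReal.toReal_ofReal]
    exact mul_nonneg (by positivity) (labelProb_nonneg h a)
  have hm : Measurable fun b : Annotation N => if b = a then (1 : ℝ) else 0 :=
    measurable_of_finite _
  simp only [occurrences]
  rw [integral_finsetSum (f := fun m (S : Fin M → Annotation N) => if S m = a then (1 : ℝ) else 0)]
  · rw [Finset.sum_congr rfl fun m _ => (integral_comp_measurePreserving
      (measurePreserving_eval (fun _ : Fin M => singleLaw f X) m) hm).trans h1]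
    simp
  · intro m _
    refine integrable_of_abs_le (C := 1) (measurable_of_finite _) fun S => ?_
    split_ifs <;> simp

lemma abs_ite_sub_ite_le {α : Type*} [DecidableEq α] (a x y : α) :
    |(if x = a then (1 : ℝ) else 0) - (if y = a then 1 else 0)| ≤ 1 := by
  split_ifs <;> simp

/-- Each count has bounded differences 1, so McDiarmid's inequality applies on both sides; a union
bound over the finite alphabet follows. The result does not depend on `X`. -/
theorem annotationLaw_atypical_le (hN : 0 < N) {f : RVec d → RVec K} {X : Fin N → RVec d}
    (h : ∀ p, 0 ≤ similarity f X p ∧ similarity f X p ≤ 1) {M : ℕ} (hM : 0 < M) {κ : ℝ}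
    (hκ : 0 ≤ κ) :
    annotationLaw f X M (atypical f X M κ)
      ≤ Fintype.card (Annotation N) * (2 * ENNReal.ofReal (Real.exp (-(2 * M * κ ^ 2)))) := by
  have := isProbabilityMeasure_singleLaw hN h
  rw [annotationLaw_eq_pi hN h]
  set ν := Measure.pi fun _ : Fin M => singleLaw f X with hν
  have hM' : (0 : ℝ) < M := by exact_mod_cast hM
  have hexp : 2 * ((M : ℝ) * κ) ^ 2 / (M * 1 ^ 2) = 2 * M * κ ^ 2 := by field_simp
  have hbd : ∀ a, ∀ S : Fin M → Annotation N, |occurrences S a| ≤ M * 1 := fun a S =>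
    abs_sum_le_card fun m => by split_ifs <;> simp
  have hdiff : ∀ a, BoundedDiff (fun S : Fin M → Annotation N => occurrences S a) 1 := by
    intro a S m b
    exact abs_sum_update_sub_le (φ := fun _ x => if x = a then (1 : ℝ) else 0)
      (fun _ x y => abs_ite_sub_ite_le a x y) S m b
  have hone : ∀ a, ν {S | κ ≤ |occurrences S a / M - 1 / (N : ℝ) ^ 2 * labelProb f X a|}
      ≤ 2 * ENNReal.ofReal (Real.exp (-(2 * M * κ ^ 2))) := by
    intro a
    have h1 := measure_ge_le_of_boundedDiff (singleLaw f X) one_pos hM (measurable_of_finite _)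
      ⟨_, hbd a⟩ (hdiff a) (u := M * κ) (by positivity)
    have h2 := measure_ge_le_of_boundedDiff (singleLaw f X) one_pos hM
      (g := fun S => -occurrences S a) (measurable_of_finite _)
      ⟨M * 1, fun S => by rw [abs_neg]; exact hbd a S⟩ (fun S m b => by
        rw [neg_sub_neg, abs_sub_comm]
        exact hdiff a S m b) (u := M * κ) (by positivity)
    rw [integral_neg] at h2
    rw [integral_occurrences hN h, hexp] at h1 h2
    rw [two_mul]
    refine le_trans (measure_mono ?_) ((measure_union_le _ _).trans (add_le_add h1 h2))
    intro S hS
    have e : occurrences S a = M * (occurrences S a / M) := by field_simp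
    rcases le_abs.1 (show κ ≤ |_| from hS) with h3 | h3
    · left
      have := mul_le_mul_of_nonneg_left h3 hM'.le
      rw [mul_sub, ← e] at this
      simp only [Set.mem_ofPred_eq]
      linarith
    · right
      have := mul_le_mul_of_nonneg_left h3 hM'.le
      rw [mul_neg, mul_sub, ← e] at this
      simp only [Set.mem_ofPred_eq]
      linarith
  have hsub : atypical f X M κ
      = ⋃ a, {S | κ ≤ |occurrences S a / M - 1 / (N : ℝ) ^ 2 * labelProb f X a|} := by
    ext S
    simp [atypical]
  rw [hsub]
  refine (measure_iUnion_fintype_le ν _).trans ((Finset.sum_le_sum fun a _ => hone a).trans_eq ?_)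
  rw [Finset.sum_const, nsmul_eq_mul, Finset.card_univ]

/-! ### From the logistic loss to the Gram matrix -/

/-- A distribution `q` that has at least the likelihood of `r` under the weights `p` is close to
`r` in the Hellinger distance if `p` is close to `r`. -/
lemma sum_sq_sqrt_sub_sqrt_le {α : Type*} [Fintype α] {p q r : α → ℝ} (hp : ∀ a, 0 ≤ p a)
    (hq : ∀ a, 0 < q a) (hr : ∀ a, 0 < r a) (hq1 : ∑ a, q a = 1) (hr1 : ∑ a, r a = 1)
    (hlik : 0 ≤ ∑ a, p a * (Real.log (q a) - Real.log (r a))) {κ C : ℝ} (hC : 1 ≤ C)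
    (hpr : ∀ a, |p a - r a| ≤ κ) (hqr : ∀ a, √(q a / r a) ≤ C) :
    ∑ a, (√(q a) - √(r a)) ^ 2 ≤ 2 * (Fintype.card α * (κ * C)) := by
  set t : α → ℝ := fun a => √(q a / r a) - 1 with ht
  have h1 : 0 ≤ ∑ a, p a * t a := by
    -- `log x ≤ x - 1` at `x = √(q / r)`. Under `r` instead of `p`, the mean of `t` is minus half
    -- the squared Hellinger distance, so only the error `p - r` is left to bound.
    have h2 : ∑ a, p a * (Real.log (q a) - Real.log (r a)) ≤ ∑ a, 2 * (p a * t a) := by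
      refine Finset.sum_le_sum fun a _ => ?_
      have h3 : 0 < √(q a / r a) := Real.sqrt_pos.2 (div_pos (hq a) (hr a))
      have h4 := Real.log_le_sub_one_of_pos h3
      rw [Real.log_sqrt (div_pos (hq a) (hr a)).le, Real.log_div (hq a).ne' (hr a).ne'] at h4
      have h5 := mul_le_mul_of_nonneg_left h4 (hp a)
      simp only [ht]
      linarith
    rw [← Finset.mul_sum] at h2
    linarith
  have h2 : ∑ a, r a * t a = -(∑ a, (√(q a) - √(r a)) ^ 2) / 2 := by
    have h3 : ∀ a, r a * t a = (q a - r a - (√(q a) - √(r a)) ^ 2) / 2 := by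
      intro a
      have e1 : √(q a / r a) = √(q a) / √(r a) := Real.sqrt_div (hq a).le _
      have e2 := Real.sq_sqrt (hq a).le
      have e3 := Real.sq_sqrt (hr a).le
      have e4 : 0 < √(r a) := Real.sqrt_pos.2 (hr a)
      have e5 : r a * (√(q a) / √(r a)) = √(r a) * √(q a) := by
        nth_rewrite 1 [← e3]
        field_simp
      simp only [ht]
      rw [e1, mul_sub, e5, sub_sq, e2, e3]
      ring
    simp only [h3]
    rw [← Finset.sum_div, Finset.sum_sub_distrib, Finset.sum_sub_distrib, hq1, hr1]
    ring
  have h3 : ∑ a, (p a - r a) * t a ≤ Fintype.card α * (κ * C) := by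
    refine (Finset.sum_le_sum (g := fun _ => κ * C) fun a _ => ?_).trans_eq (by simp)
    refine (le_abs_self _).trans ?_
    rw [abs_mul]
    refine mul_le_mul (hpr a) ?_ (abs_nonneg _) ((abs_nonneg _).trans (hpr a))
    rw [abs_le]
    have := Real.sqrt_nonneg (q a / r a)
    simp only [ht]
    constructor <;> linarith [hqr a]
  simp only [sub_mul, Finset.sum_sub_distrib] at h3
  linarith

lemma sum_comp_eq_sum_occurrences {M : ℕ} (S : Fin M → Annotation N) (φ : Annotation N → ℝ) :
    ∑ m, φ (S m) = ∑ a, occurrences S a * φ a := by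
  simp only [occurrences, Finset.sum_mul]
  rw [Finset.sum_comm]
  refine Finset.sum_congr rfl fun m _ => ?_
  simp

/-- The loss is a cross-entropy against the empirical frequencies, so comparing losses is comparing
likelihoods. -/
lemma lossCC_eq {M : ℕ} (X : Fin N → RVec d) (S : Fin M → Annotation N) (f : RVec d → RVec K) :
    lossCC X S f = -∑ a, occurrences S a / M * Real.log (labelProb f X a) := by
  have h1 : lossCC X S f = 1 / (M : ℝ) * ∑ m, -Real.log (labelProb f X (S m)) := by
    rw [lossCC]
    congr 1
    refine Finset.sum_congr rfl fun m _ => ?_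
    unfold labelProb
    cases (S m).2 <;> simp
  rw [h1, sum_comp_eq_sum_occurrences S fun a => -Real.log (labelProb f X a), Finset.mul_sum,
    ← Finset.sum_neg_distrib]
  refine Finset.sum_congr rfl fun a _ => ?_
  ring

lemma occurrences_nonneg {M : ℕ} (S : Fin M → Annotation N) (a : Annotation N) :
    0 ≤ occurrences S a :=
  Finset.sum_nonneg fun m _ => by split_ifs <;> simp

/-- If the annotation frequencies are close to their probabilities, then a network that fits them
at least as well as an accurate approximation of the target has almost the Gram matrix of the
target. -/
theorem exists_abs_similarity_sub_le (hN : 0 < N) {c η : ℝ} (hc : 0 < c) (hη : 0 < η) :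
    ∃ κ > 0, ∀ (M : ℕ) (X : Fin N → RVec d) (S : Fin M → Annotation N)
      (f g h : RVec d → RVec K),
      (∀ p, 0 < similarity f X p ∧ similarity f X p < 1) →
      (∀ p, c ≤ similarity h X p ∧ similarity h X p ≤ 1 - c) →
      (∀ p, |similarity h X p - similarity g X p| ≤ κ) →
      lossCC X S f ≤ lossCC X S h → S ∉ atypical g X M κ →
      ∀ p, |similarity f X p - similarity g X p| ≤ η := by
  have hN' : (1 : ℝ) ≤ N := by exact_mod_cast hN
  set A : ℝ := (Fintype.card (Annotation N) : ℝ) with hA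
  set C : ℝ := √(1 / c) + 1 with hC
  -- The expression collects the Hellinger bound, the factor 2 from the sum of two square roots of
  -- probabilities, the pair probability `1 / N²`, and the distance from `h` to the target. It
  -- vanishes at `κ = 0`. The inner `2 * κ` is one `κ` for the frequencies and one for replacing the
  -- target by `h`.
  obtain ⟨κ, hκ0, hκ⟩ : ∃ κ > 0, (N : ℝ) ^ 2 * (√(2 * (A * (2 * κ * C))) * 2) + κ ≤ η := by
    have hcont : Continuous fun κ : ℝ => (N : ℝ) ^ 2 * (√(2 * (A * (2 * κ * C))) * 2) + κ := by
      fun_prop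
    have h0 := (hcont.tendsto 0).mono_left (nhdsWithin_le_nhds (s := Set.Ioi (0 : ℝ)))
    simp only [mul_zero, zero_mul, Real.sqrt_zero, add_zero] at h0
    obtain ⟨κ, hκ1, hκ2⟩ := ((h0.eventually (gt_mem_nhds hη)).and self_mem_nhdsWithin).exists
    exact ⟨κ, hκ2, hκ1.le⟩
  refine ⟨κ, hκ0, fun M X S f g h hf hh hhg hloss hS p => ?_⟩
  set n2 : ℝ := 1 / (N : ℝ) ^ 2 with hn2
  have hn2p : 0 < n2 := by positivity
  have hn21 : n2 ≤ 1 := by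
    rw [hn2, div_le_one (by positivity)]
    nlinarith
  have hfl : ∀ a, 0 < labelProb f X a := fun a => by
    unfold labelProb
    cases a.2
    · simpa using (hf a.1).2
    · simpa using (hf a.1).1
  have hhl : ∀ a, c ≤ labelProb h X a := fun a => by
    unfold labelProb
    cases a.2
    · simpa using by linarith [(hh a.1).2]
    · simpa using (hh a.1).1
  have hf1 := labelProb_le_one fun p => ⟨(hf p).1.le, (hf p).2.le⟩
  have hh1 := labelProb_le_one (f := h) (X := X)
    fun p => ⟨hc.le.trans (hh p).1, (hh p).2.trans (by linarith)⟩
  have hhgl : ∀ a, |labelProb h X a - labelProb g X a| ≤ κ := fun a => by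
    unfold labelProb
    cases a.2
    · simpa [abs_sub_comm] using hhg a.1
    · simpa using hhg a.1
  have hS' : ∀ a, |occurrences S a / M - n2 * labelProb g X a| < κ := by
    intro a
    by_contra hcon
    exact hS ⟨a, not_lt.1 hcon⟩
  have key := sum_sq_sqrt_sub_sqrt_le (p := fun a => occurrences S a / M)
    (q := fun a => n2 * labelProb f X a) (r := fun a => n2 * labelProb h X a)
    (fun a => div_nonneg (occurrences_nonneg S a) (Nat.cast_nonneg M))
    (fun a => mul_pos hn2p (hfl a)) (fun a => mul_pos hn2p (hc.trans_le (hhl a)))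
    (sum_labelProb hN f X) (sum_labelProb hN h X) (κ := 2 * κ) (C := C) (by
      rw [lossCC_eq, lossCC_eq] at hloss
      have e : ∀ a, occurrences S a / M * (Real.log (n2 * labelProb f X a)
          - Real.log (n2 * labelProb h X a)) = occurrences S a / M * Real.log (labelProb f X a)
            - occurrences S a / M * Real.log (labelProb h X a) := by
        intro a
        rw [Real.log_mul hn2p.ne' (hfl a).ne', Real.log_mul hn2p.ne' (hc.trans_le (hhl a)).ne']
        ring
      simp only [e, Finset.sum_sub_distrib]
      linarith) (by rw [hC]; linarith [Real.sqrt_nonneg (1 / c)]) (fun a => by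
      have e : occurrences S a / M - n2 * labelProb h X a
          = (occurrences S a / M - n2 * labelProb g X a)
            - n2 * (labelProb h X a - labelProb g X a) := by ring
      rw [e]
      refine (abs_sub _ _).trans ?_
      rw [abs_mul, abs_of_pos hn2p]
      have := mul_le_mul hn21 (hhgl a) (abs_nonneg _) zero_le_one
      linarith [hS' a]) (fun a => by
      rw [mul_div_mul_left _ _ hn2p.ne', hC]
      have : √(labelProb f X a / labelProb h X a) ≤ √(1 / c) :=
        Real.sqrt_le_sqrt (div_le_div₀ zero_le_one (hf1 a) hc (hhl a))
      linarith)
  set a : Annotation N := (p, true) with ha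
  have h1 := (Finset.single_le_sum (f := fun a => (√(n2 * labelProb f X a)
    - √(n2 * labelProb h X a)) ^ 2) (fun a _ => sq_nonneg _) (Finset.mem_univ a)).trans key
  have h2 := Real.abs_le_sqrt h1
  have h3 : ∀ φ : RVec d → RVec K, 0 ≤ labelProb φ X a → labelProb φ X a ≤ 1 →
      √(n2 * labelProb φ X a) ≤ 1 := fun φ h0 h1 => by
    exact Real.sqrt_le_iff.2 ⟨zero_le_one, by nlinarith⟩
  have h4 : |n2 * labelProb f X a - n2 * labelProb h X a| ≤ √(2 * (A * (2 * κ * C))) * 2 := by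
    have e : n2 * labelProb f X a - n2 * labelProb h X a
        = (√(n2 * labelProb f X a) - √(n2 * labelProb h X a))
          * (√(n2 * labelProb f X a) + √(n2 * labelProb h X a)) := by
      have e1 := Real.sq_sqrt (mul_pos hn2p (hfl a)).le
      have e2 := Real.sq_sqrt (mul_pos hn2p (hc.trans_le (hhl a))).le
      linear_combination -e1 + e2
    rw [e, abs_mul]
    refine mul_le_mul h2 ?_ (abs_nonneg _) (Real.sqrt_nonneg _)
    rw [abs_of_nonneg (by positivity)]
    linarith [h3 f (hfl a).le (hf1 a), h3 h (hc.le.trans (hhl a)) (hh1 a)]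
  have h5 : |similarity f X p - similarity h X p| ≤ (N : ℝ) ^ 2 * (√(2 * (A * (2 * κ * C))) * 2) := by
    have e : similarity f X p - similarity h X p
        = (N : ℝ) ^ 2 * (n2 * labelProb f X a - n2 * labelProb h X a) := by
      simp only [labelProb, ha, cond_true, hn2]
      field_simp
    rw [e, abs_mul, abs_of_nonneg (by positivity)]
    gcongr
  have e : similarity f X p - similarity g X p
      = (similarity f X p - similarity h X p) + (similarity h X p - similarity g X p) := by ring
  rw [e]
  exact (abs_add_le _ _).trans ((add_le_add h5 (hhg p)).trans hκ)

end Annotations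

/-! ### Approximation of the target by the classes -/

section Approximation

variable {d K : ℕ}

lemma abs_inner_sub_inner_le {a b a' b' : RVec K} {ν : ℝ} (hb : ‖b‖ ≤ 1) (ha' : ‖a'‖ ≤ 1)
    (haa : ‖a - a'‖ ≤ ν) (hbb : ‖b - b'‖ ≤ ν) : |inner ℝ a b - inner ℝ a' b'| ≤ 2 * ν := by
  have e : inner ℝ a b - inner ℝ a' b' = inner ℝ (a - a') b + inner ℝ a' (b - b') := by
    rw [inner_sub_left, inner_sub_right]
    ring
  rw [e]
  refine (abs_add_le _ _).trans ?_
  have h1 := abs_real_inner_le_norm (a - a') b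
  have h2 := abs_real_inner_le_norm a' (b - b')
  nlinarith [norm_nonneg (a - a'), norm_nonneg (b - b'), norm_nonneg a', norm_nonneg b]

/-- One class with `ν / α < 1 / 4` already keeps the similarities of the fixed target at distance `α
/ 2` from 0 and 1. Close approximants in later classes inherit half of this margin, however small `α
M` becomes. -/
theorem exists_approximation {𝒳 : Set (RVec d)} (hne : 𝒳.Nonempty) {fnat : RVec d → RVec K}
    (hsimplex : ∀ x ∈ 𝒳, fnat x ∈ probSimplex K) {F : ℕ → NetworkClass d K} {α ν : ℕ → ℝ}
    (hα : ∀ M, 0 < α M ∧ α M < 1)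
    (hF : ∀ M, ∀ f ∈ (F M).functions, ∀ x ∈ 𝒳, ∀ y ∈ 𝒳,
      α M < inner ℝ (f x) (f y) ∧ inner ℝ (f x) (f y) < 1 - α M)
    (hν : ∀ M, ∃ f ∈ (F M).functions, ∀ x ∈ 𝒳, ‖f x - fnat x‖ ≤ ν M)
    (hνα : Tendsto (fun M => ν M / α M) atTop (𝓝 0)) :
    ∃ c > 0, ∀ κ > 0, ∀ᶠ M in atTop, ∃ f ∈ (F M).functions, ∀ x ∈ 𝒳, ∀ y ∈ 𝒳,
      (c ≤ inner ℝ (f x) (f y) ∧ inner ℝ (f x) (f y) ≤ 1 - c) ∧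
      |inner ℝ (f x) (f y) - inner ℝ (fnat x) (fnat y)| ≤ κ := by
  obtain ⟨x0, hx0⟩ := hne
  have hν0 : ∀ M, 0 ≤ ν M := fun M => by
    obtain ⟨f, _, hf⟩ := hν M
    exact (norm_nonneg _).trans (hf x0 hx0)
  have hνlim : Tendsto ν atTop (𝓝 0) := by
    refine squeeze_zero hν0 (fun M => ?_) hνα
    rw [le_div_iff₀ (hα M).1]
    nlinarith [hν0 M, (hα M).2]
  have hdiff : ∀ M, ∀ f ∈ (F M).functions, (∀ x ∈ 𝒳, ‖f x - fnat x‖ ≤ ν M) → ∀ x ∈ 𝒳, ∀ y ∈ 𝒳,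
      |inner ℝ (f x) (f y) - inner ℝ (fnat x) (fnat y)| ≤ 2 * ν M :=
    fun M f hf hfν x hx y hy => abs_inner_sub_inner_le
      (norm_le_one_of_mem_probSimplex ((F M).mem_probSimplex hf y))
      (norm_le_one_of_mem_probSimplex (hsimplex x hx)) (hfν x hx) (hfν y hy)
  obtain ⟨M0, hM0⟩ := (hνα.eventually (gt_mem_nhds (show (0 : ℝ) < 1 / 4 by norm_num))).exists
  have hα0 := (hα M0).1
  rw [div_lt_iff₀ hα0] at hM0
  have hnat : ∀ x ∈ 𝒳, ∀ y ∈ 𝒳, α M0 / 2 ≤ inner ℝ (fnat x) (fnat y) ∧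
      inner ℝ (fnat x) (fnat y) ≤ 1 - α M0 / 2 := by
    intro x hx y hy
    obtain ⟨f, hf, hfν⟩ := hν M0
    have h1 := abs_le.1 (hdiff M0 f hf hfν x hx y hy)
    have h2 := hF M0 f hf x hx y hy
    constructor <;> linarith [h1.1, h1.2, h2.1, h2.2]
  refine ⟨α M0 / 4, by linarith, fun κ hκ => ?_⟩
  filter_upwards [hνlim.eventually (gt_mem_nhds (show 0 < min (κ / 2) (α M0 / 8) by positivity))]
    with M hM
  have hM1 := hM.trans_le (min_le_left _ _)
  have hM2 := hM.trans_le (min_le_right _ _)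
  obtain ⟨f, hf, hfν⟩ := hν M
  refine ⟨f, hf, fun x hx y hy => ?_⟩
  have h1 := hdiff M f hf hfν x hx y hy
  have h2 := abs_le.1 h1
  have h3 := hnat x hx y hy
  exact ⟨⟨by linarith [h2.1], by linarith [h2.2]⟩, by linarith⟩

/-- Eventually, for typical annotations, every learned network has almost the Gram matrix of the
target, uniformly in the samples. -/
theorem exists_learned_similarity_near {N : ℕ} (hN : 0 < N) {𝒳 : Set (RVec d)} (hne : 𝒳.Nonempty)
    {fnat : RVec d → RVec K} (hsimplex : ∀ x ∈ 𝒳, fnat x ∈ probSimplex K)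
    {F : ℕ → NetworkClass d K} {α ν : ℕ → ℝ} (hα : ∀ M, 0 < α M ∧ α M < 1)
    (hF : ∀ M, ∀ f ∈ (F M).functions, ∀ x ∈ 𝒳, ∀ y ∈ 𝒳,
      α M < inner ℝ (f x) (f y) ∧ inner ℝ (f x) (f y) < 1 - α M)
    (hν : ∀ M, ∃ f ∈ (F M).functions, ∀ x ∈ 𝒳, ‖f x - fnat x‖ ≤ ν M)
    (hνα : Tendsto (fun M => ν M / α M) atTop (𝓝 0)) {η : ℝ} (hη : 0 < η) :
    ∃ κ > 0, ∀ᶠ M in atTop, ∀ X : Fin N → RVec d, (∀ n, X n ∈ 𝒳) →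
      ∀ S ∉ atypical fnat X M κ, ∀ f ∈ learned (F M) X S, ∀ p,
        |similarity f X p - similarity fnat X p| ≤ η := by
  obtain ⟨c, hc, hap⟩ := exists_approximation hne hsimplex hα hF hν hνα
  obtain ⟨κ, hκ, hmain⟩ := exists_abs_similarity_sub_le (d := d) (K := K) hN hc hη
  refine ⟨κ, hκ, ?_⟩
  filter_upwards [hap κ hκ] with M hM X hX S hS f hf
  obtain ⟨h, hh, hhx⟩ := hM
  refine hmain M X S f fnat h (fun p => ?_) (fun p => (hhx _ (hX _) _ (hX _)).1)
    (fun p => (hhx _ (hX _) _ (hX _)).2) (hf.2 h hh) hS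
  have h1 := hF M f hf.1 _ (hX p.1) _ (hX p.2)
  have h2 := (hα M).1
  exact ⟨h2.trans h1.1, h1.2.trans (by linarith)⟩

/-- Memberships with almost the Gram matrix of an unambiguous target are close to the target after
relabelling. -/
lemma exists_sampleError_lt {N : ℕ} {fnat f : RVec d → RVec K} {X : Fin N → RVec d} {ε η : ℝ}
    (hu : (fun n => fnat (X n)) ∉ ambiguous K N ε η) (hf : ∀ x, f x ∈ probSimplex K)
    (hG : ∀ p, |similarity f X p - similarity fnat X p| ≤ η) :
    ∃ π : Equiv.Perm (Fin K), sampleError π f fnat X < ε := by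
  by_contra hcon
  push Not at hcon
  refine hu ⟨fun n => f (X n), fun n => hf _, fun i j => hG (i, j), fun π => ?_⟩
  have := hcon π
  rwa [sampleError_eq] at this

end Approximation

/-! ### The joint law of samples and annotations -/

section JointLaw

variable {d K N : ℕ}

lemma similarity_mem_unitInterval {𝒳 : Set (RVec d)} {f : RVec d → RVec K}
    (hf : ∀ x ∈ 𝒳, f x ∈ probSimplex K) {X : Fin N → RVec d} (hX : ∀ n, X n ∈ 𝒳)
    (p : Fin N × Fin N) : 0 ≤ similarity f X p ∧ similarity f X p ≤ 1 := by
  have h1 := hf _ (hX p.1)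
  have h2 := hf _ (hX p.2)
  refine ⟨inner_nonneg_of_mem_probSimplex h1 h2, (real_inner_le_norm _ _).trans ?_⟩
  exact mul_le_one₀ (norm_le_one_of_mem_probSimplex h1) (norm_nonneg _)
    (norm_le_one_of_mem_probSimplex h2)

lemma measurable_labelProb {f : RVec d → RVec K} (hf : Measurable f) (a : Annotation N) :
    Measurable fun X : Fin N → RVec d => labelProb f X a := by
  have h : Measurable fun X : Fin N → RVec d => similarity f X a.1 :=
    (hf.comp (measurable_pi_apply a.1.1)).inner (hf.comp (measurable_pi_apply a.1.2))
  unfold labelProb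
  cases a.2
  · simpa using h.const_sub 1
  · simpa using h

lemma measurable_annotationWeight {f : RVec d → RVec K} (hf : Measurable f) (M : ℕ) :
    Measurable fun z : (Fin N → RVec d) × (Fin M → Annotation N) =>
      annotationWeight f z.1 z.2 := by
  refine measurable_from_prod_countable_left fun S => ?_
  exact Finset.measurable_prod _ fun m _ =>
    ((measurable_labelProb hf (S m)).const_mul _).ennreal_ofReal

lemma jointLaw_apply (P : Measure (RVec d)) [IsProbabilityMeasure P] {f : RVec d → RVec K}
    (hf : Measurable f) (M : ℕ) {s : Set ((Fin N → RVec d) × (Fin M → Annotation N))}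
    (hs : MeasurableSet s) :
    jointLaw P f N M s
      = ∫⁻ X, annotationLaw f X M (Prod.mk X ⁻¹' s) ∂(Measure.pi fun _ : Fin N => P) := by
  rw [jointLaw, withDensity_apply _ hs, ← lintegral_indicator hs,
    lintegral_prod _ ((measurable_annotationWeight hf M).indicator hs).aemeasurable]
  refine lintegral_congr fun X => ?_
  have hs' : MeasurableSet (Prod.mk X ⁻¹' s) := measurable_prodMk_left hs
  rw [annotationLaw, withDensity_apply _ hs', ← lintegral_indicator hs']
  rfl

lemma isProbabilityMeasure_annotationLaw (hN : 0 < N) {f : RVec d → RVec K} {X : Fin N → RVec d}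
    (h : ∀ p, 0 ≤ similarity f X p ∧ similarity f X p ≤ 1) (M : ℕ) :
    IsProbabilityMeasure (annotationLaw f X M) := by
  have := isProbabilityMeasure_singleLaw hN h
  rw [annotationLaw_eq_pi hN h]
  infer_instance

/-- Given almost every sample the annotations carry total mass one. The measurable hull is used
because `B` may involve existence over a whole network class. -/
lemma jointLaw_preimage_fst_le (hN : 0 < N) {P : Measure (RVec d)} [IsProbabilityMeasure P]
    {𝒳 : Set (RVec d)} (hP : ∀ᵐ x ∂P, x ∈ 𝒳) {f : RVec d → RVec K} (hf : Measurable f)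
    (hsimplex : ∀ x ∈ 𝒳, f x ∈ probSimplex K) (M : ℕ) (B : Set (Fin N → RVec d)) :
    jointLaw P f N M (Prod.fst ⁻¹' B) ≤ Measure.pi (fun _ : Fin N => P) B := by
  set ν := Measure.pi fun _ : Fin N => P with hν
  have hT := measurableSet_toMeasurable ν B
  rw [← measure_toMeasurable (μ := ν) B]
  refine (measure_mono (Set.preimage_mono (subset_toMeasurable ν B))).trans ?_
  rw [jointLaw_apply P hf M (measurable_fst hT), ← lintegral_indicator_one hT]
  refine lintegral_mono_ae ?_
  filter_upwards [ae_forall_mem hP] with X hX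
  have := isProbabilityMeasure_annotationLaw hN (similarity_mem_unitInterval hsimplex hX) M
  by_cases h : X ∈ toMeasurable ν B
  · rw [Set.indicator_of_mem h]
    exact prob_le_one
  · have : Prod.mk X ⁻¹' (Prod.fst ⁻¹' toMeasurable ν B)
        = (∅ : Set (Fin M → Annotation N)) := by
      ext S
      simp [h]
    rw [this]
    simp

lemma measurableSet_atypical {f : RVec d → RVec K} (hf : Measurable f) (M : ℕ) (κ : ℝ) :
    MeasurableSet {z : (Fin N → RVec d) × (Fin M → Annotation N) | z.2 ∈ atypical f z.1 M κ} := by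
  have : {z : (Fin N → RVec d) × (Fin M → Annotation N) | z.2 ∈ atypical f z.1 M κ}
      = ⋃ a, {z | κ ≤ |occurrences z.2 a / M - 1 / (N : ℝ) ^ 2 * labelProb f z.1 a|} := by
    ext z
    simp [atypical]
  rw [this]
  refine MeasurableSet.iUnion fun a => measurableSet_le measurable_const ?_
  have h1 : Measurable fun z : (Fin N → RVec d) × (Fin M → Annotation N) => occurrences z.2 a :=
    (measurable_of_finite fun S : Fin M → Annotation N => occurrences S a).comp measurable_snd
  have h2 : Measurable fun z : (Fin N → RVec d) × (Fin M → Annotation N) => labelProb f z.1 a :=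
    (measurable_labelProb hf a).comp measurable_fst
  exact ((h1.div_const _).sub (h2.const_mul _)).abs

/-- The bound on the probability of atypical annotations. -/
def atypicalBound (N : ℕ) (κ : ℝ) (M : ℕ) : ENNReal :=
  Fintype.card (Annotation N) * (2 * ENNReal.ofReal (Real.exp (-(2 * M * κ ^ 2))))

lemma tendsto_atypicalBound (N : ℕ) {κ : ℝ} (hκ : 0 < κ) :
    Tendsto (atypicalBound N κ) atTop (𝓝 0) := by
  have h1 : Tendsto (fun M : ℕ => Real.exp (-(2 * M * κ ^ 2))) atTop (𝓝 0) := by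
    refine Real.tendsto_exp_neg_atTop_nhds_zero.comp ?_
    exact (tendsto_natCast_atTop_atTop.const_mul_atTop zero_lt_two).atTop_mul_const (by positivity)
  have h2 := ENNReal.tendsto_ofReal h1
  rw [ENNReal.ofReal_zero] at h2
  have h3 := ENNReal.Tendsto.const_mul (a := 2) h2 (Or.inr (by simp))
  have h4 := ENNReal.Tendsto.const_mul (a := (Fintype.card (Annotation N) : ENNReal)) h3
    (Or.inr (ENNReal.natCast_ne_top _))
  rw [mul_zero, mul_zero] at h4
  exact h4

lemma jointLaw_atypical_le (hN : 0 < N) {P : Measure (RVec d)} [IsProbabilityMeasure P]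
    {𝒳 : Set (RVec d)} (hP : ∀ᵐ x ∂P, x ∈ 𝒳) {f : RVec d → RVec K} (hf : Measurable f)
    (hsimplex : ∀ x ∈ 𝒳, f x ∈ probSimplex K) {M : ℕ} (hM : 0 < M) {κ : ℝ} (hκ : 0 ≤ κ) :
    jointLaw P f N M {z | z.2 ∈ atypical f z.1 M κ} ≤ atypicalBound N κ M := by
  rw [jointLaw_apply P hf M (measurableSet_atypical hf M κ)]
  calc _ ≤ ∫⁻ _, atypicalBound N κ M ∂(Measure.pi fun _ : Fin N => P) := by
        refine lintegral_mono_ae ?_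
        filter_upwards [ae_forall_mem hP] with X hX
        exact annotationLaw_atypical_le hN (similarity_mem_unitInterval hsimplex hX) hM hκ
    _ = atypicalBound N κ M := by simp

/-- Unlike the SSC event itself, these differences are visibly measurable. They decrease to the
empty set, and scattered samples avoid `ambiguous K N ε 0`. -/
lemma exists_measure_ambiguous_diff_lt (P : Measure (RVec d)) [IsProbabilityMeasure P]
    {f : RVec d → RVec K} (hf : Measurable f) (ε : ℝ) {δ : ENNReal} (hδ : 0 < δ) :
    ∃ n : ℕ, Measure.pi (fun _ : Fin N => P)
      {X | (fun i => f (X i)) ∈ ambiguous K N ε (1 / ((n : ℝ) + 1)) \ ambiguous K N ε 0} < δ := by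
  have hfm : Measurable fun (X : Fin N → RVec d) i => f (X i) :=
    measurable_pi_lambda _ fun i => hf.comp (measurable_pi_apply i)
  let A : ℕ → Set (Fin N → RVec d) := fun n =>
    {X | (fun i => f (X i)) ∈ ambiguous K N ε (1 / ((n : ℝ) + 1)) \ ambiguous K N ε 0}
  have hA : ∀ n, MeasurableSet (A n) := fun n =>
    hfm ((isClosed_ambiguous _ _).measurableSet.diff (isClosed_ambiguous _ _).measurableSet)
  have hanti : Antitone A := fun n m hnm X hX => ⟨ambiguous_antitone ε hnm hX.1, hX.2⟩
  have h0 : ⋂ n, A n = ∅ := by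
    rw [Set.eq_empty_iff_forall_notMem]
    intro X hX
    rw [Set.mem_iInter] at hX
    exact (hX 0).2 (iInter_ambiguous_subset ε (Set.mem_iInter.2 fun n => (hX n).1))
  have ht := tendsto_measure_iInter_atTop (μ := Measure.pi fun _ : Fin N => P)
    (fun n => (hA n).nullMeasurableSet) hanti ⟨0, measure_ne_top _ _⟩
  rw [h0, measure_empty] at ht
  exact (ht.eventually (gt_mem_nhds hδ)).exists

lemma permVec_one {K : ℕ} (v : RVec K) : permVec 1 v = v := by
  ext k
  rw [permVec_apply]
  rfl

lemma sampleError_one_permVec (π : Equiv.Perm (Fin K)) (f g : RVec d → RVec K)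
    (X : Fin N → RVec d) :
    sampleError 1 (fun x => permVec π (f x)) g X = sampleError π f g X := by
  rw [sampleError_eq, sampleError_eq]
  simp only [permVec_one]

lemma expectedError_one_permVec (P : Measure (RVec d)) (π : Equiv.Perm (Fin K))
    (f g : RVec d → RVec K) :
    expectedError P 1 (fun x => permVec π (f x)) g = expectedError P π f g := by
  simp only [expectedError, permVec_one]

end JointLaw

end

/-! ### Assembly of the three claims -/

theorem theorem3 {d K N : ℕ} (hN : 0 < N)
    -- the data domain, the data distribution, and the ground truth membership function
    (𝒳 : Set (RVec d)) (P : Measure (RVec d)) [IsProbabilityMeasure P] (hP : ∀ᵐ x ∂P, x ∈ 𝒳)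
    (fnat : RVec d → RVec K) (hfnat : Measurable fnat) (hsimplex : ∀ x ∈ 𝒳, fnat x ∈ probSimplex K)
    -- the network class used with `M` annotations, and its parameters
    (F : ℕ → NetworkClass d K) (α ν : ℕ → ℝ)
    (hα : ∀ M, 0 < α M ∧ α M < 1)
    (hF : ∀ M, ∀ f ∈ (F M).functions, ∀ x ∈ 𝒳, ∀ y ∈ 𝒳,
      α M < inner ℝ (f x) (f y) ∧ inner ℝ (f x) (f y) < 1 - α M)
    -- the ground truth belongs to the class (`ν M = 0`), or at least to the limit of the classes
    (hν : ∀ M, ∃ f ∈ (F M).functions, ∀ x ∈ 𝒳, ‖f x - fnat x‖ ≤ ν M)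
    (hνα : Tendsto (fun M => ν M / α M) atTop (𝓝 0))
    -- the limit of large samples
    (hlim : Tendsto (fun M : ℕ =>
      max (Real.log (1 / α M)) (Real.log M * √((F M).R) / α M) / √(M : ℝ)) atTop (𝓝 0)) :
    -- (i) identification of the memberships
    (∀ X : Fin N → RVec d, (∀ n, X n ∈ 𝒳) → SufficientlyScattered (membershipMatrix fnat X) →
      ∀ ε > 0, Tendsto (fun M => annotationLaw fnat X M
        {S | ¬ ∀ f ∈ learned (F M) X S, ∃ π : Equiv.Perm (Fin K), sampleError π f fnat X ≤ ε})
        atTop (𝓝 0)) ∧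
    -- (ii) generalization, with the permutation that identifies the memberships
    ((∀ M, (F M).RelabelClosed) → ∀ δ ∈ Set.Ioo (0 : ℝ) 1, ∀ ε > 0, ∀ᶠ M in atTop,
      jointLaw P fnat N M
        {z | ¬ (SufficientlyScattered (membershipMatrix fnat z.1) →
          ∀ f ∈ learned (F M) z.1 z.2, ∃ π : Equiv.Perm (Fin K),
            sampleError π f fnat z.1 ≤ ε ∧
            expectedError P π f fnat ≤ genBound K (F M).R z.1 δ)} ≤ ENNReal.ofReal δ) ∧
    -- (ii) for classes that need not be closed under relabelling: each permutation separately
    (∀ δ ∈ Set.Ioo (0 : ℝ) 1, ∃ ε > 0, ∀ π : Equiv.Perm (Fin K), ∀ M,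
      jointLaw P fnat N M
        {z | ¬ ∀ f ∈ learned (F M) z.1 z.2, sampleError π f fnat z.1 ≤ ε →
            expectedError P π f fnat ≤ genBound K (F M).R z.1 δ} ≤ ENNReal.ofReal δ) := by
  obtain ⟨x0, hx0⟩ := hP.exists
  have hne : 𝒳.Nonempty := ⟨x0, hx0⟩
  have hFne : ∀ M, (F M).functions.Nonempty := fun M => by
    obtain ⟨f, hf, _⟩ := hν M
    exact ⟨f, hf⟩
  have hgen : ∀ δ ∈ Set.Ioo (0 : ℝ) 1, ∀ (π : Equiv.Perm (Fin K)) (M : ℕ),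
      jointLaw P fnat N M (Prod.fst ⁻¹' {X | ∃ f ∈ (F M).functions, sampleError π f fnat X ≤ 2 ∧
        genBound K (F M).R X δ < expectedError P π f fnat}) ≤ ENNReal.ofReal (δ / 4) :=
    fun δ hδ π M => (jointLaw_preimage_fst_le hN hP hfnat hsimplex M _).trans
      ((F M).measure_genBound_lt_le (hFne M) hN P hP hfnat hsimplex π hδ)
  refine ⟨?_, ?_, ?_⟩
  · intro X hX hssc ε hε
    obtain ⟨n, hn⟩ : ∃ n : ℕ, (fun i => fnat (X i)) ∉ ambiguous K N ε (1 / ((n : ℝ) + 1)) := by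
      by_contra hcon
      push Not at hcon
      exact hssc.notMem_ambiguous hε (iInter_ambiguous_subset ε (Set.mem_iInter.2 hcon))
    obtain ⟨κ, hκ, hev⟩ := exists_learned_similarity_near hN hne hsimplex hα hF hν hνα
      (Nat.one_div_pos_of_nat (n := n))
    refine tendsto_of_tendsto_of_tendsto_of_le_of_le' tendsto_const_nhds
      (tendsto_atypicalBound N hκ) (Eventually.of_forall fun _ => zero_le) ?_
    filter_upwards [hev, eventually_gt_atTop 0] with M hM hM0
    refine (measure_mono fun S hS => ?_).trans
      (annotationLaw_atypical_le hN (similarity_mem_unitInterval hsimplex hX) hM0 hκ.le)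
    by_contra hS'
    refine hS fun f hf => ?_
    obtain ⟨π, hπ⟩ := exists_sampleError_lt hn ((F M).mem_probSimplex hf.1) (hM X hX S hS' f hf)
    exact ⟨π, hπ.le⟩
  · intro hclosed δ hδ ε hε
    have hδ4 : 0 < δ / 4 := by linarith [hδ.1]
    have hδ4' : 0 < ENNReal.ofReal (δ / 4) := ENNReal.ofReal_pos.2 hδ4
    -- The cap 2 makes the summed half squared losses at most 2, as the generalization bound
    -- requires.
    have hε2 : 0 < min ε 2 := lt_min hε zero_lt_two
    obtain ⟨n, hn⟩ := exists_measure_ambiguous_diff_lt (N := N) P hfnat (min ε 2) hδ4'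
    obtain ⟨κ, hκ, hev⟩ := exists_learned_similarity_near hN hne hsimplex hα hF hν hνα
      (Nat.one_div_pos_of_nat (n := n))
    filter_upwards [hev, eventually_gt_atTop 0,
      (tendsto_atypicalBound N hκ).eventually (gt_mem_nhds hδ4')] with M hM hM0 hMb
    have hnull := (jointLaw_preimage_fst_le hN hP hfnat hsimplex M _).trans_eq
      (ae_iff.1 (ae_forall_mem (N := N) hP))
    have hamb := (jointLaw_preimage_fst_le hN hP hfnat hsimplex M _).trans hn.le
    have htyp := (jointLaw_atypical_le hN hP hfnat hsimplex hM0 hκ.le).trans hMb.le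
    -- Three exceptional events of probability at most `δ / 4` and a null set. The first concerns
    -- the identity permutation only.
    have htotal := (measure_union_le _ _).trans (add_le_add (hgen δ hδ 1 M)
      ((measure_union_le _ _).trans (add_le_add htyp
        ((measure_union_le _ _).trans (add_le_add hamb hnull)))))
    refine (measure_mono ?_).trans (htotal.trans ?_)
    · intro z hz
      by_contra hcon
      simp only [Set.mem_union, not_or] at hcon
      obtain ⟨h1, h2, h3, h4⟩ := hcon
      refine hz fun hssc f hf => ?_
      have hX : ∀ n, z.1 n ∈ 𝒳 := by
        by_contra hcon
        exact h4 hcon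
      have h5 : (fun i => fnat (z.1 i)) ∉ ambiguous K N (min ε 2) (1 / ((n : ℝ) + 1)) :=
        fun h => h3 ⟨h, hssc.notMem_ambiguous hε2⟩
      obtain ⟨π, hπ⟩ := exists_sampleError_lt h5 ((F M).mem_probSimplex hf.1)
        (hM z.1 hX z.2 h2 f hf)
      refine ⟨π, hπ.le.trans (min_le_left _ _), ?_⟩
      by_contra hlt
      -- The relabelled network need not be learned; it only has to lie in the class, over which the
      -- bound is uniform. This allows `π` to depend on the data.
      refine h1 ⟨_, hclosed M π f hf.1, ?_, ?_⟩
      · rw [sampleError_one_permVec]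
        exact hπ.le.trans (min_le_right _ _)
      · rw [expectedError_one_permVec]
        exact not_le.1 hlt
    · rw [add_zero, ← ENNReal.ofReal_add hδ4.le hδ4.le, ← ENNReal.ofReal_add hδ4.le (by linarith)]
      exact ENNReal.ofReal_le_ofReal (by linarith)
  · intro δ hδ
    -- The tolerance 2 works for all `δ`, `π` and `M`, since the uniform bound asks for no more.
    refine ⟨2, zero_lt_two, fun π M => ?_⟩
    refine (measure_mono fun z hz => ?_).trans ((hgen δ hδ π M).trans
      (ENNReal.ofReal_le_ofReal (by linarith [hδ.1])))
    by_contra hcon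
    refine hz fun f hf hs => ?_
    by_contra hlt
    exact hcon ⟨f, hf.1, hs, not_le.1 hlt⟩
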